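/- **Conventions.** An algorithm is a uniform family of quantum random-access circuits: the map sending a problem size to its circuit is computable. A circuit acts on qubits addressed by natural numbers. Its gates are Hadamard, controlled phases $e^{2\pi i a/b}$ ($a/b$ rational), NOT, Toffoli/CNOT, and reads and writes of a memory qubit at an address held in superposition, each of unit cost, together with reversible integer arithmetic ($+,-,\cdot,$ floor division, remainder; the result is XORed into a target block) on blocks of $m$ qubits in total, at cost $1+m^2$. Running time is the total cost of the gates; a circuit using only the non-Hadamard, non-phase gates is a classical one. A problem size consists of $n$ and a finite field $\mathbb F_q$, $q=p^k$, given as $\mathbb F_p[X]/(f)$ with $f$ monic irreducible of degree $k$; field elements are stored as their $k$ coefficients, with $\lceil\log_2 p\rceil$ qubits each. Write $\langle X,Y\rangle=\sum_{i,j}X_{ij}Y_{ij}$ and $\lambda(x)$ for the coefficient of $X^{k-1}$ of $x\in\mathbb F_q$ (so $\lambda(x)=x$ if $q$ is prime). A phase oracle for the functions $C\mapsto\langle AB,C^T\rangle$ is a circuit mapping $|A,B,C,0\rangle\mapsto e^{2\pi i\lambda(\langle AB,C^T\rangle)/p}\,|A,B,C,0\rangle$ for all $A,B,C\in\mathbb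 F_q^{n\times n}$. A circuit computes $\mathrm{tr}(ABC)$ if, on every input $|A,B,C,0\rangle$, a measurement finds $\mathrm{tr}(ABC)$ in the output register with certainty (the other qubits may end in any state). "For sizes with $q\le n^c$" below means for all $n$ and all such descriptions of fields with $q\le n^c$. **Theorem (Matrix multiplication to trilinear form).** Fix $c,d\in\mathbb N$. There are uniform families of circuits $V_s,W_s$ (where $s\in\mathbb N$ bounds the qubits used by the query circuit) and $\Phi$, depending only on the problem size and on $s$, and constants $K,e$, such that for sizes with $q\le n^c$: 1. $V_s$, $\Phi$ and $W_s$ together take time at most $K n^2(\lfloor\log_2 n\rfloor)^e=\tilde O(n^2)$, uniformly in $s$. 2. (One Bernstein–Vazirani query.) For every phase oracle $O$ for $C\mapsto\langle AB,C^T\rangle$ using only qubits with addresses below $s$, running $V_s$, then $O$ once, then $W_s$ on $|A,B,0\rangle$ outputs $AB$ with probability at least $1-n^{-d}$, for all $A,B\in\mathbb F_q^{n\times n}$. 3. If $U$ is a circuit computing $\mathrm{tr}(ABC)$, then $U$ followed by $\Phi$ and $U^{-1}$ is a phase oracle for $C\mapsto\langle AB,C^T\rangle$. 4. For every set $S$ of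 problem sizes with $q\le n^c$ and every $T:\mathbb N\to\mathbb N$: if a uniform family $O$ implements, for all sizes in $S$, the phase oracle in time $T(n)$, then for suitable $s$ the family $V_s,O,W_s$ is uniform, and for all sizes in $S$ it outputs $AB$ with probability at least $1-n^{-d}$ in time at most $T(n)+K n^2(\lfloor\log_2 n\rfloor)^e=T(n)+\tilde O(n^2)$. 5. For every such $S$ and $T$: if a uniform family $U$ computes $\mathrm{tr}(ABC)$, for all sizes in $S$, in time $T(n)$, then for suitable $s$ the family $V_s,(U,\Phi,U^{-1}),W_s$ is uniform, and for all sizes in $S$ it outputs $AB$ with probability at least $1-n^{-d}$ in time at most $2T(n)+K n^2(\lfloor\log_2 n\rfloor)^e=O(T(n))+\tilde O(n^2)$. 6. With exact quantum Fourier transforms the success probability is $1$: for every finite field $\mathbb F_q$, every nontrivial additive character $\chi$ of $\mathbb F_q$ (for $q$ prime, e.g. $\chi(x)=e^{2\pi i x/q}$), every $n$ and all $A,B\in\mathbb F_q^{n\times n}$, $$(QFT_\chi^{-1})^{\otimes n^2}\;U_\chi\;QFT_\chi^{\otimes n^2}\,|0\rangle=|(AB)^T\rangle,$$ where $QFT_\chi|x\rangle=q^{-1/2}\sum_{y}\chi(xy)|y\rangle$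 and $U_\chi|C\rangle=\chi(\langle AB,C^T\rangle)|C\rangle$. -/

import Mathlib

open Polynomial

namespace QuantumMM

noncomputable section

/-! ### Quantum random-access circuits -/

/-- Integer operations available on blocks of qubits (truncated subtraction, floor division). -/
inductive ArithOp
  | add | sub | mul | div | mod
  deriving DecidableEq

/-- The value of an integer operation. -/
def ArithOp.eval : ArithOp → ℕ → ℕ → ℕ
  | .add, x, y => x + y
  | .sub, x, y => x - y
  | .mul, x, y => x * y
  | .div, x, y => x / y
  | .mod, x, y => x % y

/-- The instruction set. Qubits are addressed by natural numbers.
* `had i`: Hadamard gate on qubit `i`;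
* `cphase a b i j`: multiply by `exp (2 π i a / b)` if qubits `i` and `j` are both `1`
  (a single-qubit phase shift if `i = j`);
* `flip i`: NOT gate;
* `toffoli i j k`: flip qubit `k` if `i` and `j` are both `1` (a CNOT gate if `i = j`);
* `qread base addr k`: add to qubit `k`, mod 2, the qubit at address `base + (value of addr)`;
* `qwrite base addr k`: add qubit `k`, mod 2, to the qubit at address `base + (value of addr)`;
* `arith op xs ys zs`: add to the block `zs`, bitwise mod 2, the binary expansion of
  `op (value of xs) (value of ys)`, truncated to the length of `zs`. -/
inductive Gate
  | had (i : ℕ)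
  | cphase (a : ℤ) (b : ℕ) (i j : ℕ)
  | flip (i : ℕ)
  | toffoli (i j k : ℕ)
  | qread (base : ℕ) (addr : List ℕ) (k : ℕ)
  | qwrite (base : ℕ) (addr : List ℕ) (k : ℕ)
  | arith (op : ArithOp) (xs ys zs : List ℕ)

/-- A circuit: the gates are applied from left to right. -/
abbrev Circuit := List Gate

/-- A classical content of the quantum memory (a computational basis vector). -/
abbrev Config := ℕ → Bool

/-- State vectors: finite superpositions of computational basis vectors. -/
abbrev State := Config →₀ ℂ

/-- The number written on a block of qubits, least significant bit first. -/
def value (c : Config) : List ℕ → ℕ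
  | [] => 0
  | x :: xs => (c x).toNat + 2 * value c xs

/-- A random access with this base, address block and data qubit is legal: the addressable cells
`base, …, base + 2 ^ (length of addr) - 1`, the address block and the data qubit are disjoint.
(An illegal access does nothing, so that every gate is unitary.) -/
def LegalAccess (base : ℕ) (addr : List ℕ) (k : ℕ) : Prop :=
  k ∉ addr ∧ ∀ x ∈ k :: addr, x < base ∨ base + 2 ^ addr.length ≤ x

open Classical in
/-- The image of a computational basis vector under a gate. -/
def Gate.onBasis : Gate → Config → State
  | .had i, c =>
      ((1 / Real.sqrt 2 : ℝ) : ℂ) •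
        (Finsupp.single (Function.update c i false) 1 +
          Finsupp.single (Function.update c i true) (if c i then -1 else 1))
  | .cphase a b i j, c =>
      Finsupp.single c
        (if c i && c j then Complex.exp (2 * Real.pi * Complex.I * ((a : ℂ) / (b : ℂ))) else 1)
  | .flip i, c => Finsupp.single (Function.update c i (!(c i))) 1
  | .toffoli i j k, c =>
      Finsupp.single
        (if k ≠ i ∧ k ≠ j then Function.update c k (xor (c k) (c i && c j)) else c) 1
  | .qread base addr k, c =>
      Finsupp.single
        (if LegalAccess base addr k then
          Function.update c k (xor (c k) (c (base + value c addr))) else c) 1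
  | .qwrite base addr k, c =>
      Finsupp.single
        (if LegalAccess base addr k then
          Function.update c (base + value c addr) (xor (c (base + value c addr)) (c k)) else c) 1
  | .arith op xs ys zs, c =>
      Finsupp.single
        (if ∀ z ∈ zs, z ∉ xs ∧ z ∉ ys then
          fun z => if z ∈ zs then
            xor (c z) ((op.eval (value c xs) (value c ys)).testBit (zs.idxOf z)) else c z
        else c) 1

/-- The linear operator of a gate. -/
def Gate.op (g : Gate) : State →ₗ[ℂ] State := Finsupp.linearCombination ℂ g.onBasis

/-- The state obtained by running a circuit. -/
def run (Γ : Circuit) (ψ : State) : State := Γ.foldl (fun φ g => g.op φ) ψ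

/-- Time of one gate: elementary gates and random accesses have unit cost, integer arithmetic on
blocks with `m` qubits in total costs `1 + m ^ 2` (the schoolbook bound). -/
def Gate.cost : Gate → ℕ
  | .arith _ xs ys zs => 1 + (xs.length + ys.length + zs.length) ^ 2
  | _ => 1

/-- Running time of a circuit. -/
def cost (Γ : Circuit) : ℕ := (Γ.map Gate.cost).sum

/-- The inverse of a gate. -/
def Gate.inv : Gate → Gate
  | .cphase a b i j => .cphase (-a) b i j
  | g => g

/-- The inverse circuit. -/
def inverse (Γ : Circuit) : Circuit := (Γ.map Gate.inv).reverse

/-- The gate touches no qubit with address `≥ s`. -/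
def Gate.Below (s : ℕ) : Gate → Prop
  | .had i => i < s
  | .cphase _ _ i j => i < s ∧ j < s
  | .flip i => i < s
  | .toffoli i j k => i < s ∧ j < s ∧ k < s
  | .qread base addr k => base + 2 ^ addr.length ≤ s ∧ k < s ∧ ∀ x ∈ addr, x < s
  | .qwrite base addr k => base + 2 ^ addr.length ≤ s ∧ k < s ∧ ∀ x ∈ addr, x < s
  | .arith _ xs ys zs => (∀ x ∈ xs, x < s) ∧ (∀ x ∈ ys, x < s) ∧ ∀ x ∈ zs, x < s

/-- The circuit touches no qubit with address `≥ s`. -/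
def UsesBelow (s : ℕ) (Γ : Circuit) : Prop := ∀ g ∈ Γ, g.Below s

open Classical in
/-- The probability that measuring all qubits gives a result in the event `E`. -/
def prob (ψ : State) (E : Config → Prop) : ℝ :=
  ∑ c ∈ ψ.support, if E c then ‖ψ c‖ ^ 2 else 0

/-! ### Uniform circuit families -/

/-- A number naming an integer operation. -/
def ArithOp.code : ArithOp → ℕ
  | .add => 0
  | .sub => 1
  | .mul => 2
  | .div => 3
  | .mod => 4

/-- Written form of a gate. -/
def Gate.code : Gate → List (List ℕ)
  | .had i => [[0], [i]]
  | .cphase a b i j => [[1], [a.toNat, (-a).toNat, b, i, j]]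
  | .flip i => [[2], [i]]
  | .toffoli i j k => [[3], [i, j, k]]
  | .qread base addr k => [[4], [base, k], addr]
  | .qwrite base addr k => [[5], [base, k], addr]
  | .arith op xs ys zs => [[6], [op.code], xs, ys, zs]

/-- An algorithm is a uniform family of circuits: one program prints the circuit for each
parameter. -/
def Uniform {α : Type} [Primcodable α] (fam : α → Circuit) : Prop :=
  Computable fun a => (fam a).map Gate.code

/-! ### Matrices over finite fields in the quantum memory -/

/-- A problem size `(n, p, [f₀, …, f_{k-1}])`: matrices of size `n × n` over the finite field
`𝔽_p[X] / (X ^ k + f_{k-1} X ^ (k-1) + ⋯ + f₀)` with `p ^ k` elements. -/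
abbrev Inst := ℕ × ℕ × List ℕ

namespace Inst

/-- The dimension `n` of the matrices. -/
abbrev size (I : Inst) : ℕ := I.1

/-- The characteristic `p`. -/
abbrev char (I : Inst) : ℕ := I.2.1

/-- The degree `k` of the field over its prime field. -/
abbrev deg (I : Inst) : ℕ := I.2.2.length

/-- The defining polynomial of the field. -/
def poly (I : Inst) : (ZMod I.char)[X] :=
  X ^ I.deg + ∑ i : Fin I.deg, C ((I.2.2.get i : ℕ) : ZMod I.char) * X ^ (i : ℕ)

theorem poly_monic (I : Inst) : I.poly.Monic :=
  monic_X_pow_add (degree_sum_fin_lt _)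

/-- The field `𝔽_q`. -/
abbrev Fq (I : Inst) : Type := AdjoinRoot I.poly

/-- Square matrices over `𝔽_q`. -/
abbrev Mat (I : Inst) : Type := Matrix (Fin I.size) (Fin I.size) I.Fq

/-- The data describe a finite field with `q = p ^ k ≤ n ^ c` elements. -/
structure Admissible (c : ℕ) (I : Inst) : Prop where
  prime : I.char.Prime
  reduced : ∀ a ∈ I.2.2, a < I.char
  irreducible : Irreducible I.poly
  bound : I.char ^ I.deg ≤ I.size ^ c

/-- The coefficient of `X ^ l` of a field element, as an integer in `{0, …, p - 1}`. -/
def coord (I : Inst) (x : I.Fq) (l : ℕ) : ℕ :=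
  ((AdjoinRoot.modByMonicHom I.poly_monic x).coeff l).val

/-- Number of qubits for a coefficient, `⌈log₂ p⌉`. -/
def digitBits (I : Inst) : ℕ := Nat.clog 2 I.char

/-- Number of qubits for a field element. -/
def fieldBits (I : Inst) : ℕ := I.deg * I.digitBits

/-- Number of qubits for a matrix. -/
def matBits (I : Inst) : ℕ := I.size * I.size * I.fieldBits

/-- Bit `t` of the binary representation of a field element: the coefficients are listed by
increasing degree, each with its least significant bit first. -/
def bit (I : Inst) (x : I.Fq) (t : ℕ) : Bool :=
  (I.coord x (t / I.digitBits)).testBit (t % I.digitBits)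

/-- The qubits from address `base` on hold the field element `x`. -/
def Holds (I : Inst) (base : ℕ) (x : I.Fq) (c : Config) : Prop :=
  ∀ t < I.fieldBits, c (base + t) = I.bit x t

/-- The first qubit of entry `(i, j)` of a matrix that is stored, row by row, from `base` on. -/
def entryAddr (I : Inst) (base : ℕ) (i j : Fin I.size) : ℕ :=
  base + ((i : ℕ) * I.size + (j : ℕ)) * I.fieldBits

/-- The qubits from address `base` on hold the matrix `M`. -/
def HoldsMat (I : Inst) (base : ℕ) (M : I.Mat) (c : Config) : Prop :=
  ∀ i j, I.Holds (I.entryAddr base i j) (M i j) c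

open Classical in
/-- The memory that holds the matrix `M` from address `base` on and is `0` elsewhere. -/
def matConfig (I : Inst) (base : ℕ) (M : I.Mat) : Config := fun z =>
  decide (∃ i j, ∃ t < I.fieldBits, z = I.entryAddr base i j + t ∧ I.bit (M i j) t = true)

/-- The basis vector that holds `A`, `B` one after the other from address `0` on; all other qubits
are `0`. -/
def input₂ (I : Inst) (A B : I.Mat) : Config := fun z =>
  I.matConfig 0 A z || I.matConfig I.matBits B z

/-- The basis vector that holds `A`, `B`, `C` one after the other from address `0` on; all other
qubits are `0`. -/
def input₃ (I : Inst) (A B C : I.Mat) : Config := fun z =>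
  I.input₂ A B z || I.matConfig (2 * I.matBits) C z

/-- The inner product `⟨X, Y⟩ = ∑ i j, X i j * Y i j` of matrices. -/
def _root_.QuantumMM.matInner {n : ℕ} {R : Type*} [CommRing R] (X Y : Matrix (Fin n) (Fin n) R) :
    R :=
  ∑ i, ∑ j, X i j * Y i j

/-- The circuit computes `tr (A B C)`: run on the input `A, B, C`, it leaves, with certainty, the
result right behind the input. The other qubits may end in any state. -/
def ComputesTrace (I : Inst) (Γ : Circuit) : Prop :=
  ∀ A B C : I.Mat,
    prob (run Γ (Finsupp.single (I.input₃ A B C) 1))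
      (I.Holds (3 * I.matBits) (Matrix.trace (A * B * C))) = 1

/-- The circuit computes `A B` with success probability at least `r`, leaving the result right
behind the input. -/
def ComputesProduct (I : Inst) (r : ℝ) (Γ : Circuit) : Prop :=
  ∀ A B : I.Mat,
    r ≤ prob (run Γ (Finsupp.single (I.input₂ A B) 1)) (I.HoldsMat (2 * I.matBits) (A * B))

/-- The phase `exp (2 π i λ(x) / p)` of a field element, where `λ(x)` is the last coefficient
(that of `X ^ (k - 1)`); for a prime field this is `ω_q ^ x`. -/
def phase (I : Inst) (x : I.Fq) : ℂ :=
  Complex.exp (2 * Real.pi * Complex.I * ((I.coord x (I.deg - 1) : ℂ) / (I.char : ℂ)))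

/-- The circuit is a phase oracle for the linear functions `C ↦ ⟨A B, Cᵀ⟩`. -/
def IsPhaseOracle (I : Inst) (Γ : Circuit) : Prop :=
  ∀ A B C : I.Mat,
    run Γ (Finsupp.single (I.input₃ A B C) 1) =
      Finsupp.single (I.input₃ A B C) (I.phase (matInner (A * B) C.transpose))

end Inst

/-! ### The exact quantum Fourier transform on matrix registers -/

/-- The quantum Fourier transform, with respect to an additive character `χ` of `F`, of a register
that holds an `n × n` matrix over `F`. As `χ` turns sums into products, it is the tensor product of
the transforms `|x⟩ ↦ q ^ (-1 / 2) ∑ y, χ (x y) |y⟩` of the `n²` entries. -/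
def matQFT {F : Type} [Field F] [Fintype F] {n : ℕ} (χ : AddChar F ℂ)
    (ψ : Matrix (Fin n) (Fin n) F → ℂ) : Matrix (Fin n) (Fin n) F → ℂ := by
  classical exact fun Y =>
    ((1 / Real.sqrt ((Fintype.card F : ℝ) ^ (n * n)) : ℝ) : ℂ) *
      ∑ X : Matrix (Fin n) (Fin n) F, χ (matInner X Y) * ψ X

open Classical in
/-- The basis vector `|M⟩` of a matrix register. -/
def ket {F : Type} {n : ℕ} (M : Matrix (Fin n) (Fin n) F) : Matrix (Fin n) (Fin n) F → ℂ :=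
  fun X => if X = M then 1 else 0

end

end QuantumMM

namespace QuantumMM

noncomputable section

/-! ### Linear algebra of circuits -/

/-! The product M = AB is the coefficient vector of the linear form C ↦ ⟨M, Cᵀ⟩, and
Bernstein–Vazirani reads off all coefficients of a linear phase with one query. With exact Fourier
transforms over the field this is just orthogonality of additive characters (`sum_char_matInner`,
`matQFT_query`). The circuits use Fourier transforms modulo 2^m instead, so there the last step
becomes phase estimation, with a small error.

There is one register of m qubits, in uniform superposition, for each coefficient of each matrix
entry. If an entry owns the contents x_0, …, x_{k-1}, the matching entry of C is Σ x_i δ_i, where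
δ_i is the basis dual to the power basis under the form λ (`coeffZ_mul_dual`,
`coeffZ_mul_assemble`). The query phase is then exp(2πi Σ x_r s_r / p), with s_r the coefficients of
Mᵀ (`Ready.run_query`), so the registers decouple. The coefficients of Σ x_i δ_i form a convolution
with the defining polynomial; one integer multiplication per entry computes it by Kronecker
substitution (`digit_mul`, `Ready.run_prep`). Running this computation backwards after the query
erases C.

A further phase exp(2πi x / 2p) moves the frequency of a register to (s + 1/2)/p, the midpoint of
the interval of all v with ⌊vp⌋ = s. After the inverse Fourier transform the reading y gives
⌊yp/2^m⌋. Every y giving a wrong answer has amplitude at most p/2^m, so a register fails with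
probability at most p²/2^m (`norm_estAmp_le`, `le_sum_norm_sq_estAmp`), and n²k registers together
fail with probability at most n²kp²/2^m (`le_sum_registers`). As k and p are at most n^c, some m =
O(log n) makes this at most n^{-d}, and the circuits have cost n² times a power of log n.

Three more ingredients connect this to arbitrary oracles. A circuit confined to addresses below s
ignores the contents above, so an oracle specified on clean inputs also works beside the registers
(`UsesBelow.run_single_of_eqOn`). A circuit U that computes the trace with certainty leaves the same
answer in every basis vector of its output, so a phase on the answer is a scalar and U⁻¹ removes the
garbage (`of_prob_eq_one`). Uniformity holds because the circuits are printed primitive recursively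
and a valid s can be computed from the printed query circuit (`Uniform.comp_bound`). -/

theorem Gate.op_single (g : Gate) (c : Config) (a : ℂ) :
    g.op (Finsupp.single c a) = a • g.onBasis c := by
  simp [Gate.op, Finsupp.linearCombination_single]

theorem run_nil (ψ : State) : run [] ψ = ψ := rfl

theorem run_cons (g : Gate) (Γ : Circuit) (ψ : State) : run (g :: Γ) ψ = run Γ (g.op ψ) := rfl

theorem run_append (Γ Δ : Circuit) (ψ : State) : run (Γ ++ Δ) ψ = run Δ (run Γ ψ) := by
  simp [run, List.foldl_append]

/-- Running a circuit, as a linear map. -/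
def runHom (Γ : Circuit) : State →ₗ[ℂ] State where
  toFun := run Γ
  map_add' := by
    induction Γ with
    | nil => intros; rfl
    | cons g Γ ih => intro ψ φ; simp only [run_cons, map_add, ih]
  map_smul' := by
    induction Γ with
    | nil => intros; rfl
    | cons g Γ ih => intro a ψ; simp only [run_cons, map_smul, ih, RingHom.id_apply]

theorem run_smul (Γ : Circuit) (a : ℂ) (ψ : State) : run Γ (a • ψ) = a • run Γ ψ :=
  (runHom Γ).map_smul a ψ

theorem run_sum (Γ : Circuit) {ι : Type*} (s : Finset ι) (ψ : ι → State) :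
    run Γ (∑ i ∈ s, ψ i) = ∑ i ∈ s, run Γ (ψ i) :=
  map_sum (runHom Γ) ψ s

theorem run_single (Γ : Circuit) (c : Config) (a : ℂ) :
    run Γ (Finsupp.single c a) = a • run Γ (Finsupp.single c 1) := by
  rw [← run_smul, Finsupp.smul_single, smul_eq_mul, mul_one]

/-- The image of a state is the superposition of the images of the basis vectors. -/
theorem run_apply (Γ : Circuit) (ψ : State) (c : Config) :
    run Γ ψ c = ψ.sum fun c' a => a * run Γ (Finsupp.single c' 1) c := by
  conv_lhs => rw [← Finsupp.sum_single ψ]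
  rw [Finsupp.sum, run_sum, Finsupp.finsetSum_apply]
  refine Finset.sum_congr rfl fun c' _ => ?_
  rw [run_single]; rfl

/-! ### Inverse circuits and unitarity -/

theorem value_congr {c c' : Config} {xs : List ℕ} (h : ∀ x ∈ xs, c x = c' x) :
    value c xs = value c' xs := by
  induction xs with
  | nil => rfl
  | cons x xs ih =>
    simp only [value, h x (by simp), ih fun y hy => h y (by simp [hy])]

open Classical in
/-- The action of a gate that permutes the computational basis. -/
def Gate.perm : Gate → Config → Config
  | .had _, c => c
  | .cphase _ _ _ _, c => c
  | .flip i, c => Function.update c i (!(c i))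
  | .toffoli i j k, c =>
        if k ≠ i ∧ k ≠ j then Function.update c k (xor (c k) (c i && c j)) else c
  | .qread base addr k, c =>
        if LegalAccess base addr k then
          Function.update c k (xor (c k) (c (base + value c addr))) else c
  | .qwrite base addr k, c =>
        if LegalAccess base addr k then
          Function.update c (base + value c addr) (xor (c (base + value c addr)) (c k)) else c
  | .arith op xs ys zs, c =>
        if ∀ z ∈ zs, z ∉ xs ∧ z ∉ ys then
          fun z => if z ∈ zs then
            xor (c z) ((op.eval (value c xs) (value c ys)).testBit (zs.idxOf z)) else c z
        else c

theorem value_lt (c : Config) (xs : List ℕ) : value c xs < 2 ^ xs.length := by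
  induction xs with
  | nil => simp [value]
  | cons x xs ih =>
    simp only [value, List.length_cons, pow_succ]
    have := Bool.toNat_le (c x)
    omega

/-- Each such gate XORs a value into its target, and the legality conditions keep the target
disjoint from everything that determines this value. The second application therefore XORs the same
value into the same place. -/
theorem Gate.perm_perm (g : Gate) (c : Config) : g.perm (g.perm c) = c := by
  cases g with
  | had => rfl
  | cphase => rfl
  | flip i => simp [Gate.perm]
  | toffoli i j k =>
    by_cases h : k ≠ i ∧ k ≠ j
    · simp [Gate.perm, h, Function.update_of_ne h.1.symm, Function.update_of_ne h.2.symm]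
    · simp [Gate.perm, h]
  | qread base addr k =>
    by_cases h : LegalAccess base addr k
    · have h1 (v) : value (Function.update c k v) addr = value c addr :=
        value_congr fun x hx => Function.update_of_ne (by rintro rfl; exact h.1 hx) _ _
      have h2 : base + value c addr ≠ k := by
        have := value_lt c addr
        have := h.2 k (by simp)
        omega
      simp [Gate.perm, h, h1, Function.update_of_ne h2]
    · simp [Gate.perm, h]
  | qwrite base addr k =>
    by_cases h : LegalAccess base addr k
    · have hlt := value_lt c addr
      have h1 (v) : value (Function.update c (base + value c addr) v) addr = value c addr :=
        value_congr fun x hx => Function.update_of_ne (by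
          have := h.2 x (by simp [hx])
          omega) _ _
      have h2 : k ≠ base + value c addr := by
        have := h.2 k (by simp)
        omega
      simp [Gate.perm, h, h1, Function.update_of_ne h2]
    · simp [Gate.perm, h]
  | arith op xs ys zs =>
    by_cases h : ∀ z ∈ zs, z ∉ xs ∧ z ∉ ys
    · have h1 : (Gate.arith op xs ys zs).perm c = fun z => if z ∈ zs then
            xor (c z) ((op.eval (value c xs) (value c ys)).testBit (zs.idxOf z)) else c z := by
        rw [Gate.perm, if_pos h]
      have h2 : value ((Gate.arith op xs ys zs).perm c) xs = value c xs := by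
        refine value_congr fun x hx => ?_
        rw [h1]; exact if_neg fun hz => (h x hz).1 hx
      have h3 : value ((Gate.arith op xs ys zs).perm c) ys = value c ys := by
        refine value_congr fun x hx => ?_
        rw [h1]; exact if_neg fun hz => (h x hz).2 hx
      conv_lhs => rw [Gate.perm, if_pos h, h2, h3, h1]
      funext z
      by_cases hz : z ∈ zs <;> simp [hz]
    · simp [Gate.perm, h]

/-- The gate permutes the computational basis. -/
def Gate.IsClassical : Gate → Prop
  | .had _ => False
  | .cphase _ _ _ _ => False
  | _ => True

theorem Gate.IsClassical.onBasis {g : Gate} (h : g.IsClassical) (c : Config) :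
    g.onBasis c = Finsupp.single (g.perm c) 1 := by
  cases g <;> first | exact h.elim | rfl

theorem Gate.IsClassical.inv {g : Gate} (h : g.IsClassical) : g.inv = g := by
  cases g <;> first | exact h.elim | rfl

/-- Lets all permutation gates be treated by one argument, leaving Hadamard gates and phases as the
only separate cases. -/
theorem Gate.cases_classical {P : Gate → Prop} (h : ∀ g : Gate, g.IsClassical → P g)
    (hh : ∀ i, P (.had i)) (hp : ∀ a b i j, P (.cphase a b i j)) (g : Gate) : P g := by
  cases g <;> first | exact h _ trivial | exact hh _ | exact hp _ _ _ _

theorem sqrt_half_mul_self : ((1 / Real.sqrt 2 : ℝ) : ℂ) * ((1 / Real.sqrt 2 : ℝ) : ℂ) = 1 / 2 := by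
  rw [← Complex.ofReal_mul, div_mul_div_comm, Real.mul_self_sqrt (by norm_num)]
  simp

theorem Gate.inv_op_op (g : Gate) (ψ : State) : g.inv.op (g.op ψ) = ψ := by
  classical
  suffices h : g.inv.op ∘ₗ g.op = LinearMap.id from LinearMap.congr_fun h ψ
  refine Finsupp.lhom_ext' fun c => LinearMap.ext_ring ?_
  simp only [LinearMap.comp_apply, Finsupp.lsingle_apply, LinearMap.id_apply, Gate.op_single,
    one_smul]
  refine Gate.cases_classical (P := fun g => g.inv.op (g.onBasis c) = Finsupp.single c 1)
    (fun g hg => ?_) (fun i => ?_) (fun a b i j => ?_) g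
  · rw [hg.inv, hg.onBasis, Gate.op_single, one_smul, hg.onBasis, g.perm_perm]
  · have e : ∀ b, c i = b → Function.update c i b = c := by
      rintro _ rfl; simp
    simp only [Gate.inv, Gate.onBasis, map_smul, map_add, Gate.op_single, Function.update_idem,
      Function.update_self]
    have := sqrt_half_mul_self
    cases hb : c i <;> ext c' <;>
      simp [Finsupp.single_apply, e _ hb] at this ⊢ <;> split_ifs <;>
        first | ring1 | linear_combination 2 * this
  · simp only [Gate.inv, Gate.onBasis, Gate.op_single]
    cases c i <;> cases c j <;> simp only [Bool.and_true, Bool.and_false, if_true, if_false, one_smul,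
      Bool.false_eq_true]
    rw [Finsupp.smul_single, smul_eq_mul, ← Complex.exp_add]
    congr 1
    convert Complex.exp_zero using 2
    push_cast
    ring

theorem run_inverse_run (Γ : Circuit) (ψ : State) : run (inverse Γ) (run Γ ψ) = ψ := by
  induction Γ generalizing ψ with
  | nil => rfl
  | cons g Γ ih =>
    have : inverse (g :: Γ) = inverse Γ ++ [g.inv] := by simp [inverse]
    rw [this, run_append, run_cons g, ih, run_cons, run_nil, Gate.inv_op_op]

-- Unitarity, stated for matrix entries in the computational basis: the inverse gate is the adjoint.
-- For permutation gates this is the involution property, for the Hadamard gate it is symmetry with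
-- real entries.
open ComplexConjugate in
theorem Gate.onBasis_adjoint (g : Gate) (c c' : Config) :
    g.onBasis c c' = conj (g.inv.onBasis c' c) := by
  classical
  refine Gate.cases_classical (P := fun g => g.onBasis c c' = conj (g.inv.onBasis c' c))
    (fun g hg => ?_) (fun i => ?_) (fun a b i j => ?_) g
  · rw [hg.inv, hg.onBasis, hg.onBasis]
    have : g.perm c = c' ↔ g.perm c' = c :=
      ⟨fun h => h ▸ g.perm_perm c, fun h => h ▸ g.perm_perm c'⟩
    simp only [Finsupp.single_apply, this]
    split_ifs <;> simp
  · have key : ∀ (x y : Config) (b : Bool), Function.update x i b = y ↔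
        y i = b ∧ ∀ z, z ≠ i → x z = y z := by
      intro x y b
      constructor
      · rintro rfl
        exact ⟨by simp, fun z hz => by simp [hz]⟩
      · rintro ⟨h1, h2⟩
        funext z
        by_cases hz : z = i
        · subst hz; simp [h1]
        · simp [hz, h2 z hz]
    have sy : (∀ z, z ≠ i → c z = c' z) ↔ (∀ z, z ≠ i → c' z = c z) :=
      ⟨fun h z hz => (h z hz).symm, fun h z hz => (h z hz).symm⟩
    simp only [Gate.inv, Gate.onBasis, Finsupp.smul_apply, Finsupp.add_apply, Finsupp.single_apply,
      key, sy]
    cases c i <;> cases c' i <;>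
      simp only [true_and, false_and, if_false, reduceCtorEq] <;> split_ifs <;> simp
  · simp only [Gate.inv, Gate.onBasis, Finsupp.single_apply]
    by_cases h : c = c'
    · subst h
      simp only [if_true]
      split_ifs
      · rw [← Complex.exp_conj]
        simp [Complex.conj_ofNat, neg_div]
      · simp
    · simp [h, Ne.symm h]

theorem Gate.op_apply (g : Gate) (ψ : State) (c : Config) :
    g.op ψ c = ψ.sum fun c' a => a * g.onBasis c' c := by
  simp [Gate.op, Finsupp.linearCombination_apply, Finsupp.sum, Finsupp.finsetSum_apply]

open ComplexConjugate in
theorem run_adjoint (Γ : Circuit) (c c' : Config) :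
    run Γ (Finsupp.single c 1) c' = conj (run (inverse Γ) (Finsupp.single c' 1) c) := by
  classical
  induction Γ generalizing c with
  | nil =>
    simp only [inverse, List.map_nil, List.reverse_nil, run_nil, Finsupp.single_apply, eq_comm]
    split_ifs <;> simp
  | cons g Γ ih =>
    have : inverse (g :: Γ) = inverse Γ ++ [g.inv] := by simp [inverse]
    rw [this, run_append, run_cons, run_cons, run_nil, Gate.op_single, one_smul, Gate.op_apply,
      run_apply]
    set φ := run (inverse Γ) (Finsupp.single c' 1)
    -- Both sides are matrix products over intermediate basis vectors, but indexed by different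
    -- supports; on the union of the supports they agree term by term.
    rw [Finsupp.sum_of_support_subset (s := (g.onBasis c).support ∪ φ.support) _
        Finset.subset_union_left _ (by simp),
      Finsupp.sum_of_support_subset (s := (g.onBasis c).support ∪ φ.support) _
        Finset.subset_union_right _ (by simp), map_sum]
    refine Finset.sum_congr rfl fun c1 _ => ?_
    rw [ih, map_mul, ← Gate.onBasis_adjoint, mul_comm]

/-- The diagonal entry at `c` of the circuit followed by its inverse is 1. Expanded over
intermediate basis vectors, each summand is an amplitude times its conjugate by `run_adjoint`. -/
theorem sum_norm_sq_run (Γ : Circuit) (c : Config) :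
    ∑ c' ∈ (run Γ (Finsupp.single c 1)).support, ‖run Γ (Finsupp.single c 1) c'‖ ^ 2 = 1 := by
  have h := congrArg (fun ψ : State => ψ c) (run_inverse_run Γ (Finsupp.single c 1))
  rw [run_apply, Finsupp.single_eq_same] at h
  rw [← Complex.ofReal_inj, Complex.ofReal_sum, Complex.ofReal_one]
  refine Eq.trans ?_ h
  refine Finset.sum_congr rfl fun c' _ => ?_
  have e := congrArg (starRingEnd ℂ) (run_adjoint Γ c c')
  rw [Complex.conj_conj] at e
  dsimp only
  rw [← e, Complex.mul_conj, Complex.normSq_eq_norm_sq]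

/-- A measurement that succeeds with certainty succeeds on the whole support. -/
theorem of_prob_eq_one {Γ : Circuit} {c : Config} {E : Config → Prop}
    (h : prob (run Γ (Finsupp.single c 1)) E = 1) (c' : Config)
    (hc : run Γ (Finsupp.single c 1) c' ≠ 0) : E c' := by
  by_contra hE
  have h1 := sum_norm_sq_run Γ c
  -- The probability of `E` is a sum of terms bounded by those of the total probability. Both sums
  -- are 1, so no term may be lost.
  have h2 := (Finset.sum_eq_sum_iff_of_le fun i _ => by
    split_ifs
    · exact le_rfl
    · positivity).1 (h.trans h1.symm) c' (Finsupp.mem_support_iff.2 hc)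
  rw [if_neg hE] at h2
  exact hc (norm_eq_zero.1 (pow_eq_zero_iff two_ne_zero |>.1 h2.symm))

/-! ### Circuits that use only low addresses -/

/-- The configuration `c` below address `s`, and `h` from there on. -/
def mergeAt (s : ℕ) (h c : Config) : Config := fun z => if z < s then c z else h z

theorem mergeAt_of_lt {s z : ℕ} (h c : Config) (hz : z < s) : mergeAt s h c z = c z := if_pos hz

theorem mergeAt_update {s i : ℕ} (h c : Config) (hi : i < s) (v : Bool) :
    mergeAt s h (Function.update c i v) = Function.update (mergeAt s h c) i v := by
  funext z
  by_cases hz : z = i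
  · subst hz; simp [mergeAt, hi]
  · simp [mergeAt, hz]

theorem value_mergeAt {s : ℕ} (h c : Config) {xs : List ℕ} (hx : ∀ x ∈ xs, x < s) :
    value (mergeAt s h c) xs = value c xs :=
  value_congr fun x hxs => mergeAt_of_lt h c (hx x hxs)

/-- The gate neither reads nor writes qubits from `s` on, so it commutes with overwriting these
qubits by a fixed content. -/
theorem Gate.Below.onBasis_mergeAt {g : Gate} {s : ℕ} (hg : g.Below s) (h c : Config) :
    g.onBasis (mergeAt s h c) = (g.onBasis c).mapDomain (mergeAt s h) := by
  cases g with
  | had i =>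
    simp only [Gate.Below] at hg
    simp [Gate.onBasis, Finsupp.mapDomain_add, Finsupp.mapDomain_single,
      mergeAt_update, hg, mergeAt_of_lt]
  | cphase a b i j =>
    simp [Gate.onBasis, Finsupp.mapDomain_single, mergeAt_of_lt h c hg.1, mergeAt_of_lt h c hg.2]
  | flip i =>
    simp only [Gate.Below] at hg
    simp [Gate.onBasis, Finsupp.mapDomain_single, mergeAt_of_lt h c hg, mergeAt_update, hg]
  | toffoli i j k =>
    simp only [Gate.onBasis, Finsupp.mapDomain_single, mergeAt_of_lt h c hg.1,
      mergeAt_of_lt h c hg.2.1, mergeAt_of_lt h c hg.2.2]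
    split_ifs
    · rw [mergeAt_update _ _ hg.2.2]
    · rfl
  | qread base addr k =>
    have hv := value_lt c addr
    simp only [Gate.onBasis, Finsupp.mapDomain_single, mergeAt_of_lt h c hg.2.1,
      value_mergeAt h c hg.2.2, mergeAt_of_lt h c (hv.trans_le' le_rfl |> fun _ =>
        (show base + value c addr < s by have := hg.1; omega))]
    split_ifs
    · rw [mergeAt_update _ _ hg.2.1]
    · rfl
  | qwrite base addr k =>
    have hv : base + value c addr < s := by
      have := value_lt c addr
      have := hg.1
      omega
    simp only [Gate.onBasis, Finsupp.mapDomain_single, mergeAt_of_lt h c hg.2.1,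
      value_mergeAt h c hg.2.2, mergeAt_of_lt h c hv]
    split_ifs
    · rw [mergeAt_update _ _ hv]
    · rfl
  | arith op xs ys zs =>
    simp only [Gate.onBasis, Finsupp.mapDomain_single, value_mergeAt h c hg.1,
      value_mergeAt h c hg.2.1]
    split_ifs
    · congr 1
      funext z
      by_cases hz : z ∈ zs
      · simp [hz, mergeAt, hg.2.2 z hz]
      · simp [hz, mergeAt]
    · rfl

theorem UsesBelow.run_mapDomain {Γ : Circuit} {s : ℕ} (hΓ : UsesBelow s Γ) (h : Config)
    (ψ : State) : run Γ (ψ.mapDomain (mergeAt s h)) = (run Γ ψ).mapDomain (mergeAt s h) := by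
  induction Γ generalizing ψ with
  | nil => rfl
  | cons g Γ ih =>
    rw [run_cons, run_cons, ← ih fun g' hg' => hΓ g' (by simp [hg'])]
    congr 1
    have : g.op ∘ₗ Finsupp.lmapDomain ℂ ℂ (mergeAt s h) =
        Finsupp.lmapDomain ℂ ℂ (mergeAt s h) ∘ₗ g.op := by
      refine Finsupp.lhom_ext' fun c => LinearMap.ext_ring ?_
      simp [Gate.op_single, (hΓ g (by simp)).onBasis_mergeAt, Finsupp.mapDomain_single]
    exact LinearMap.congr_fun this ψ

/-- A circuit that multiplies a basis vector by a phase does so for all basis vectors that differ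
only on unused qubits. -/
theorem UsesBelow.run_single_of_eqOn {Γ : Circuit} {s : ℕ} (hΓ : UsesBelow s Γ) {c c' : Config}
    {a : ℂ} (h : run Γ (Finsupp.single c 1) = Finsupp.single c a) (hc : ∀ z < s, c' z = c z) :
    run Γ (Finsupp.single c' 1) = Finsupp.single c' a := by
  have e : mergeAt s c' c = c' := by
    funext z
    by_cases hz : z < s
    · rw [mergeAt_of_lt _ _ hz, hc z hz]
    · simp [mergeAt, hz]
  have := hΓ.run_mapDomain c' (Finsupp.single c 1)
  rwa [h, Finsupp.mapDomain_single, Finsupp.mapDomain_single, e] at this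

/-- A bound on the addresses occurring in a gate, computed from its written form. -/
def codeBound (l : List (List ℕ)) : ℕ := (l.map fun x => x.sum + 2 ^ x.length).sum

/-- A bound on the addresses occurring in a circuit, computed from its written form. -/
def circuitBound (l : List (List (List ℕ))) : ℕ := (l.map codeBound).sum

theorem Gate.Below.mono {g : Gate} {s t : ℕ} (h : g.Below s) (hst : s ≤ t) : g.Below t := by
  cases g <;> simp only [Gate.Below] at h ⊢ <;> grind

/-- The sum of a list plus a positive number exceeds each entry; the power of two attached to an
address block also covers all cells reachable by a random access. -/
theorem Gate.below_codeBound (g : Gate) : g.Below (codeBound g.code) := by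
  have key : ∀ (l : List ℕ), ∀ x ∈ l, x < l.sum + 2 ^ l.length := fun l x hx => by
    have h1 := List.single_le_sum (by simp) x hx
    have : 0 < 2 ^ l.length := by positivity
    omega
  cases g with
  | had i => simp only [Gate.Below, codeBound, Gate.code]; simp; omega
  | cphase a b i j => simp only [Gate.Below, codeBound, Gate.code]; simp; omega
  | flip i => simp only [Gate.Below, codeBound, Gate.code]; simp; omega
  | toffoli i j k => simp only [Gate.Below, codeBound, Gate.code]; simp; omega
  | qread base addr k =>
    simp only [Gate.Below, codeBound, Gate.code]; simp
    have := Nat.two_pow_pos addr.length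
    exact ⟨by omega, by omega, fun x hx => by have := key addr x hx; omega⟩
  | qwrite base addr k =>
    simp only [Gate.Below, codeBound, Gate.code]; simp
    have := Nat.two_pow_pos addr.length
    exact ⟨by omega, by omega, fun x hx => by have := key addr x hx; omega⟩
  | arith op xs ys zs =>
    simp only [Gate.Below, codeBound, Gate.code]; simp
    have h1 := Nat.two_pow_pos xs.length
    have h2 := Nat.two_pow_pos ys.length
    have h3 := Nat.two_pow_pos zs.length
    exact ⟨fun x hx => by have := key xs x hx; omega, fun x hx => by have := key ys x hx; omega,
      fun x hx => by have := key zs x hx; omega⟩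

theorem usesBelow_circuitBound (Γ : Circuit) : UsesBelow (circuitBound (Γ.map Gate.code)) Γ := by
  intro g hg
  refine g.below_codeBound.mono ?_
  refine List.single_le_sum (by simp) _ ?_
  exact List.mem_map.2 ⟨_, List.mem_map.2 ⟨g, hg, rfl⟩, rfl⟩

theorem cost_append (Γ Δ : Circuit) : cost (Γ ++ Δ) = cost Γ + cost Δ := by simp [cost]

theorem cost_inverse (Γ : Circuit) : cost (inverse Γ) = cost Γ := by
  have : Gate.cost ∘ Gate.inv = Gate.cost := by
    funext g; cases g <;> rfl
  simp [cost, inverse, this]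

/-! ### Blocks of qubits -/

/-- The block of `m` consecutive qubits from `x` on. -/
def block (x m : ℕ) : List ℕ := (List.range m).map (x + ·)

theorem length_block (x m : ℕ) : (block x m).length = m := by simp [block]

theorem mem_block {x m z : ℕ} : z ∈ block x m ↔ x ≤ z ∧ z < x + m := by
  simp only [block, List.mem_map, List.mem_range]
  exact ⟨fun ⟨a, h, e⟩ => by omega, fun h => ⟨z - x, by omega, by omega⟩⟩

theorem nodup_block (x m : ℕ) : (block x m).Nodup :=
  List.Nodup.map (fun _ _ h => Nat.add_left_cancel h) List.nodup_range

theorem getElem_block {x m t : ℕ} (h : t < (block x m).length) : (block x m)[t] = x + t := by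
  simp [block]

theorem block_succ (x m : ℕ) : block x (m + 1) = block x m ++ [x + m] := by
  simp [block, List.range_succ]

theorem value_append (c : Config) (xs ys : List ℕ) :
    value c (xs ++ ys) = value c xs + 2 ^ xs.length * value c ys := by
  induction xs with
  | nil => simp [value]
  | cons x xs ih => simp only [List.cons_append, value, ih, List.length_cons, pow_succ]; ring

theorem value_map_range (c : Config) (h : ℕ → ℕ) (m : ℕ) :
    value c ((List.range m).map h) = ∑ t ∈ Finset.range m, (c (h t)).toNat * 2 ^ t := by
  induction m with
  | zero => rfl
  | succ m ih =>
    rw [List.range_succ, List.map_append, value_append, ih, Finset.sum_range_succ]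
    simp [value, mul_comm]

theorem testBit_value (c : Config) (xs : List ℕ) (t : ℕ) :
    (value c xs).testBit t = if h : t < xs.length then c xs[t] else false := by
  induction xs generalizing t with
  | nil => simp [value]
  | cons x xs ih =>
    have e : value c (x :: xs) = Nat.bit (c x) (value c xs) := by
      simp only [value, Nat.bit_val]; ring
    rw [e]
    cases t with
    | zero => simp
    | succ t => rw [Nat.testBit_bit_succ, ih]; simp

theorem testBit_value_block {c : Config} {x m t : ℕ} (ht : t < m) :
    (value c (block x m)).testBit t = c (x + t) := by
  rw [testBit_value, dif_pos (by rwa [length_block]), getElem_block]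

theorem value_eq_of_testBit {c : Config} {xs : List ℕ} {v : ℕ} (hv : v < 2 ^ xs.length)
    (h : ∀ t (ht : t < xs.length), c xs[t] = v.testBit t) : value c xs = v := by
  refine Nat.eq_of_testBit_eq fun t => ?_
  rw [testBit_value]
  split_ifs with ht
  · exact h t ht
  · rw [Nat.testBit_lt_two_pow (hv.trans_le (Nat.pow_le_pow_right (by norm_num) (by omega)))]

/-- A concatenation of `k` blocks of `w` qubits holds the number with these base `2 ^ w` digits. -/
theorem value_map_range_mul (c : Config) (h : ℕ → ℕ) (k w : ℕ) :
    value c ((List.range (k * w)).map h) = ∑ i ∈ Finset.range k,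
      value c ((List.range w).map fun t => h (i * w + t)) * 2 ^ (w * i) := by
  induction k with
  | zero => simp [value]
  | succ k ih =>
    rw [Nat.succ_mul, List.range_add, List.map_append, value_append, ih, Finset.sum_range_succ]
    simp [mul_comm w, mul_comm (2 ^ (k * w))]
    rfl

/-! ### Batches of arithmetic gates -/

theorem run_arith (op : ArithOp) (xs ys zs : List ℕ) (c : Config) :
    run [.arith op xs ys zs] (Finsupp.single c 1) =
      Finsupp.single ((Gate.arith op xs ys zs).perm c) 1 := by
  rw [run_cons, run_nil, Gate.op_single, one_smul, Gate.IsClassical.onBasis (by trivial)]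

/-- Arithmetic gates with disjoint targets, none of which is read, can be treated as one. -/
theorem run_arith_batch (op : ArithOp) (xs ys zs : ℕ → List ℕ) (M : ℕ)
    (hsrc : ∀ r < M, ∀ r' < M, ∀ z ∈ zs r, z ∉ xs r' ∧ z ∉ ys r')
    (hdisj : ∀ r < M, ∀ r' < M, ∀ z ∈ zs r, z ∈ zs r' → r = r')
    (hnodup : ∀ r < M, (zs r).Nodup) (c : Config) :
    ∃ c' : Config,
      run ((List.range M).map fun r => .arith op (xs r) (ys r) (zs r)) (Finsupp.single c 1) =
        Finsupp.single c' 1 ∧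
      (∀ z, (∀ r < M, z ∉ zs r) → c' z = c z) ∧
      ∀ r < M, ∀ t (ht : t < (zs r).length), c' (zs r)[t] =
        xor (c (zs r)[t]) ((op.eval (value c (xs r)) (value c (ys r))).testBit t) := by
  induction M with
  | zero => exact ⟨c, rfl, by simp, by simp⟩
  | succ M ih =>
    obtain ⟨c1, h1, h2, h3⟩ := ih (fun r hr r' hr' => hsrc r (by omega) r' (by omega))
      (fun r hr r' hr' => hdisj r (by omega) r' (by omega)) (fun r hr => hnodup r (by omega))
    have hx : value c1 (xs M) = value c (xs M) := value_congr fun x hx =>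
      h2 x fun r hr hz => (hsrc r (by omega) M (by omega) x hz).1 hx
    have hy : value c1 (ys M) = value c (ys M) := value_congr fun x hx =>
      h2 x fun r hr hz => (hsrc r (by omega) M (by omega) x hz).2 hx
    have hp : (Gate.arith op (xs M) (ys M) (zs M)).perm c1 = fun z => if z ∈ zs M then
        xor (c1 z) ((op.eval (value c (xs M)) (value c (ys M))).testBit ((zs M).idxOf z))
        else c1 z := by
      rw [Gate.perm, if_pos (hsrc M (by omega) M (by omega)), hx, hy]
    refine ⟨_, by rw [List.range_succ, List.map_append, run_append, h1, List.map_singleton,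
      run_arith], fun z hz => ?_, fun r hr t ht => ?_⟩
    · rw [hp]
      simp only [hz M (by omega), if_false]
      exact h2 z fun r hr => hz r (by omega)
    · rw [hp]
      by_cases hrM : r = M
      · subst hrM
        simp only [List.getElem_mem, if_true, (hnodup r hr).idxOf_getElem]
        rw [h2]
        exact fun r' hr' hz => absurd (hdisj r' (by omega) r hr _ hz (List.getElem_mem _)) (by omega)
      · have : (zs r)[t] ∉ zs M := fun hz =>
          hrM (hdisj r hr M (by omega) _ (List.getElem_mem _) hz)
        simp only [this, if_false]
        exact h3 r (by omega) t ht

/-! ### Phases -/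

/-- The complex number `exp (2 π i x)`. -/
def cis (x : ℝ) : ℂ := Complex.exp (2 * Real.pi * Complex.I * x)

theorem cis_zero : cis 0 = 1 := by simp [cis]

theorem cis_add (x y : ℝ) : cis (x + y) = cis x * cis y := by
  rw [cis, cis, cis, ← Complex.exp_add]
  congr 1
  push_cast
  ring

theorem cis_natCast (n : ℕ) : cis n = 1 := by
  rw [cis, Complex.exp_eq_one_iff]
  exact ⟨n, by push_cast; ring⟩

theorem cis_neg_natCast (n : ℕ) : cis (-n) = 1 := by
  have := cis_add n (-n)
  rwa [add_neg_cancel, cis_zero, cis_natCast, one_mul, eq_comm] at this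

theorem cis_neg_half : cis (-(1 / 2)) = -1 := by
  rw [cis, ← Complex.exp_neg_pi_mul_I]
  congr 1
  push_cast
  ring

theorem norm_cis (x : ℝ) : ‖cis x‖ = 1 := by
  rw [cis, show 2 * (Real.pi : ℂ) * Complex.I * x = ((2 * Real.pi * x : ℝ) : ℂ) * Complex.I by
    push_cast; ring, Complex.norm_exp_ofReal_mul_I]

theorem cis_sum {ι : Type*} (s : Finset ι) (f : ι → ℝ) : cis (∑ i ∈ s, f i) = ∏ i ∈ s, cis (f i) := by
  classical
  induction s using Finset.induction_on with
  | empty => simp [cis_zero]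
  | insert i s hi ih => rw [Finset.sum_insert hi, Finset.prod_insert hi, cis_add, ih]

/-! ### Diagonal circuits -/

/-- The circuit multiplies each basis vector by a phase. -/
def IsDiag (Γ : Circuit) (φ : Config → ℂ) : Prop :=
  ∀ c, run Γ (Finsupp.single c 1) = Finsupp.single c (φ c)

theorem IsDiag.append {Γ Δ : Circuit} {φ χ : Config → ℂ} (h : IsDiag Γ φ) (h' : IsDiag Δ χ) :
    IsDiag (Γ ++ Δ) fun c => φ c * χ c := fun c => by
  rw [run_append, h, run_single, h', Finsupp.smul_single, smul_eq_mul]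

theorem isDiag_nil : IsDiag [] fun _ => 1 := fun _ => rfl

theorem isDiag_cphase (a : ℤ) (b i j : ℕ) :
    IsDiag [.cphase a b i j] fun c => cis (if c i && c j then (a : ℝ) / b else 0) := fun c => by
  rw [run_cons, run_nil, Gate.op_single, one_smul, Gate.onBasis]
  by_cases h : (c i && c j) = true
  · simp only [h, if_true, cis]
    push_cast
    rfl
  · simp only [h, if_false, cis_zero, Bool.false_eq_true]

theorem isDiag_map_range (a : ℕ → ℤ) (b i j : ℕ → ℕ) (m : ℕ) :
    IsDiag ((List.range m).map fun t => .cphase (a t) (b t) (i t) (j t)) fun c =>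
      cis (∑ t ∈ Finset.range m, if c (i t) && c (j t) then (a t : ℝ) / b t else 0) := by
  induction m with
  | zero => simpa [cis_zero] using isDiag_nil
  | succ m ih =>
    rw [List.range_succ, List.map_append]
    simp only [Finset.sum_range_succ, cis_add]
    exact ih.append (isDiag_cphase _ _ _ _)

/-- Phases that add up to `exp (2 π i x / b)`, where `x` is the value of the block. -/
def phases (x m b : ℕ) : Circuit :=
  (List.range m).map fun t => .cphase ((2 ^ t : ℕ) : ℤ) b (x + t) (x + t)

theorem isDiag_phases (x m b : ℕ) :
    IsDiag (phases x m b) fun c => cis ((value c (block x m) : ℝ) / b) := by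
  intro c
  refine (isDiag_map_range (fun t => ((2 ^ t : ℕ) : ℤ)) (fun _ => b) (x + ·) (x + ·) m c).trans ?_
  dsimp only
  rw [block, value_map_range, Nat.cast_sum, Finset.sum_div]
  refine congrArg (fun y => Finsupp.single c (cis y)) (Finset.sum_congr rfl fun t _ => ?_)
  cases c (x + t) <;> simp

/-! ### Circuits with one path between any two basis vectors -/

/-- The configuration `c'` on `S`, and `c` elsewhere. -/
def mix (S : Set ℕ) (c' c : Config) : Config := by
  classical exact fun z => if z ∈ S then c' z else c z

theorem mix_of_mem {S : Set ℕ} (c' c : Config) {z : ℕ} (hz : z ∈ S) : mix S c' c z = c' z := by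
  simp [mix, hz]

theorem mix_of_notMem {S : Set ℕ} (c' c : Config) {z : ℕ} (hz : z ∉ S) : mix S c' c z = c z := by
  simp [mix, hz]

open Classical in
/-- The circuit modifies only qubits in `S`, with the given transition amplitudes. -/
def PathForm (Γ : Circuit) (S : Set ℕ) (φ : Config → Config → ℂ) : Prop :=
  ∀ c c', run Γ (Finsupp.single c 1) c' = if ∀ z ∉ S, c' z = c z then φ c c' else 0

theorem PathForm.congr {Γ : Circuit} {S : Set ℕ} {φ χ : Config → Config → ℂ} (h : PathForm Γ S φ)
    (e : ∀ c c', (∀ z ∉ S, c' z = c z) → φ c c' = χ c c') : PathForm Γ S χ := fun c c' => by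
  rw [h]
  split_ifs with hc
  · exact e c c' hc
  · rfl

/-- As `S` and `T` are disjoint, a single intermediate configuration can contribute: the qubits in
`S` are already final and all others still initial. The sum over paths collapses to one term. -/
theorem PathForm.append {Γ Δ : Circuit} {S T : Set ℕ} {φ χ : Config → Config → ℂ}
    (h : PathForm Γ S φ) (h' : PathForm Δ T χ) (hST : Disjoint S T) :
    PathForm (Γ ++ Δ) (S ∪ T) fun c c' => φ c (mix S c' c) * χ (mix S c' c) c' := by
  intro c c'
  have hT : ∀ z ∈ S, z ∉ T := fun z hz => Set.disjoint_left.1 hST hz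
  have hmix : ∀ z ∉ S, mix S c' c z = c z := fun z hz => mix_of_notMem _ _ hz
  rw [run_append, run_apply, Finsupp.sum, Finset.sum_eq_single (mix S c' c)]
  · rw [h, h', if_pos hmix]
    by_cases hc : ∀ z ∉ S ∪ T, c' z = c z
    · rw [if_pos hc, if_pos]
      intro z hz
      by_cases hzS : z ∈ S
      · rw [mix_of_mem _ _ hzS]
      · rw [mix_of_notMem _ _ hzS]
        exact hc z (by simp [hz, hzS])
    · rw [if_neg hc, if_neg, mul_zero]
      refine fun h3 => hc fun z hz => ?_
      rw [Set.mem_union, not_or] at hz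
      rw [h3 z hz.2, hmix z hz.1]
  · intro c1 _ hne
    rw [h, h']
    split_ifs with h1 h2
    · refine absurd (funext fun z => ?_) hne
      by_cases hzS : z ∈ S
      · rw [mix_of_mem _ _ hzS, h2 z (hT z hzS)]
      · rw [hmix z hzS, h1 z hzS]
    all_goals simp
  · intro h3
    rw [Finsupp.notMem_support_iff.1 h3, zero_mul]

theorem IsDiag.pathForm {Γ : Circuit} {φ : Config → ℂ} (h : IsDiag Γ φ) :
    PathForm Γ ∅ fun c _ => φ c := fun c c' => by
  have e : c = c' ↔ ∀ z ∉ (∅ : Set ℕ), c' z = c z :=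
    ⟨by rintro rfl; simp, fun h => funext fun z => (h z (by simp)).symm⟩
  classical
  rw [h, Finsupp.single_apply]
  simp only [e]

theorem IsDiag.append_pathForm {Γ Δ : Circuit} {T : Set ℕ} {φ : Config → ℂ}
    {χ : Config → Config → ℂ} (h : IsDiag Γ φ) (h' : PathForm Δ T χ) :
    PathForm (Γ ++ Δ) T fun c c' => φ c * χ c c' := by
  have := h.pathForm.append h' (Set.empty_disjoint T)
  rw [Set.empty_union] at this
  refine this.congr fun c c' _ => ?_
  have e : mix ∅ c' c = c := funext fun z => mix_of_notMem _ _ (by simp)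
  rw [e]

theorem pathForm_had (i : ℕ) : PathForm [.had i] {i} fun c c' =>
    ((1 / Real.sqrt 2 : ℝ) : ℂ) * if c i && c' i then -1 else 1 := by
  intro c c'
  have key : ∀ (b : Bool), Function.update c i b = c' ↔
      c' i = b ∧ ∀ z ∉ ({i} : Set ℕ), c' z = c z := by
    intro b
    constructor
    · rintro rfl
      exact ⟨by simp, fun z hz => by simp [Set.mem_singleton_iff.not.1 hz]⟩
    · rintro ⟨h1, h2⟩
      funext z
      by_cases hz : z = i
      · subst hz; simp [h1]
      · simp [hz, h2 z (by simpa using hz)]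
  classical
  rw [run_cons, run_nil, Gate.op_single, one_smul]
  simp only [Gate.onBasis, Finsupp.smul_apply, Finsupp.add_apply, Finsupp.single_apply, key]
  cases c i <;> cases c' i <;>
    simp only [true_and, false_and, if_false, reduceCtorEq] <;> split_ifs <;> simp_all

theorem pathForm_nil : PathForm [] ∅ fun _ _ => 1 := isDiag_nil.pathForm

/-- Hadamard gates on clean qubits. -/
theorem pathForm_map_had (L : List ℕ) (hL : L.Nodup) : PathForm (L.map .had) {z | z ∈ L}
    fun c c' => ((1 / Real.sqrt 2 : ℝ) : ℂ) ^ L.length *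
      (L.map fun i => if c i && c' i then (-1 : ℂ) else 1).prod := by
  induction L with
  | nil => simpa using pathForm_nil
  | cons i L ih =>
    have hi : i ∉ L := (List.nodup_cons.1 hL).1
    have e : {z | z ∈ i :: L} = {i} ∪ {z | z ∈ L} := by ext z; simp
    rw [e]
    refine ((pathForm_had i).append (ih (List.nodup_cons.1 hL).2) (by simpa using hi)).congr
      fun c c' _ => ?_
    have e2 : (L.map fun j => if mix {i} c' c j && c' j then (-1 : ℂ) else 1) =
        L.map fun j => if c j && c' j then (-1 : ℂ) else 1 :=
      List.map_congr_left fun j hj => by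
        rw [mix_of_notMem _ _ (show j ∉ ({i} : Set ℕ) by rintro rfl; exact hi hj)]
    rw [e2, mix_of_mem _ _ (Set.mem_singleton i), List.map_cons, List.prod_cons, List.length_cons,
      pow_succ]
    ring

/-! ### The inverse quantum Fourier transform modulo a power of two -/

/-- The inverse quantum Fourier transform modulo `2 ^ m`. The result is stored with the most
significant bit first. -/
def qft (x m : ℕ) : Circuit :=
  (List.range m).reverse.flatMap fun j => .had (x + j) ::
    (List.range j).map fun l => .cphase (-1) (2 ^ (j + 1 - l)) (x + j) (x + l)

/-- Induction on the top qubit. Write the input as X + 2^m a and the output as b + 2Y. Their product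
over 2^(m+1) is ab/2 + bX/2^(m+1) + XY/2^m + aY: the Hadamard sign, the controlled phases, the
smaller transform, and an integer that drops out. -/
theorem pathForm_qft (x m : ℕ) : PathForm (qft x m) {z | z ∈ block x m} fun c c' =>
    ((1 / Real.sqrt 2 : ℝ) : ℂ) ^ m *
      cis (-((value c (block x m) : ℝ) * value c' (block x m).reverse / 2 ^ m)) := by
  induction m with
  | zero => simpa [qft, block, value, cis_zero] using pathForm_nil
  | succ m ih =>
    have e : {z | z ∈ block x (m + 1)} = {x + m} ∪ {z | z ∈ block x m} := by
      ext z; simp [block_succ, or_comm]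
    have e2 : qft x (m + 1) = [.had (x + m)] ++ (((List.range m).map fun l =>
        .cphase (-1) (2 ^ (m + 1 - l)) (x + m) (x + l)) ++ qft x m) := by
      simp [qft, List.range_succ]
    have hd : Disjoint {x + m} {z | z ∈ block x m} := by
      rw [Set.disjoint_singleton_left]
      simp [mem_block]
    rw [e, e2]
    refine ((pathForm_had (x + m)).append ((isDiag_map_range (fun _ => -1)
      (fun l => 2 ^ (m + 1 - l)) (fun _ => x + m) (x + ·) m).append_pathForm ih) hd).congr
      fun c c' _ => ?_
    have hm : ∀ z ∈ block x m, mix {x + m} c' c z = c z := fun z hz =>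
      mix_of_notMem _ _ fun h => Set.disjoint_left.1 hd h hz
    -- The Hadamard gate precedes these phases, so the controlling qubit `x + m` already holds its
    -- output bit while the lower qubits still hold input bits.
    have e3 : ∑ l ∈ Finset.range m, (if mix {x + m} c' c (x + m) && mix {x + m} c' c (x + l) then
        (((-1 : ℤ) : ℝ) / ((2 ^ (m + 1 - l) : ℕ) : ℝ)) else 0) =
        -((c' (x + m)).toNat * value c (block x m) / 2 ^ (m + 1)) := by
      rw [block, value_map_range]
      push_cast
      rw [Finset.mul_sum, Finset.sum_div, ← Finset.sum_neg_distrib]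
      refine Finset.sum_congr rfl fun l hl => ?_
      rw [Finset.mem_range] at hl
      rw [mix_of_mem _ _ (Set.mem_singleton _), hm (x + l) (by rw [mem_block]; omega)]
      have : (2 : ℝ) ^ (m + 1) = 2 ^ (m + 1 - l) * 2 ^ l := by
        rw [← pow_add]; congr 1; omega
      cases c' (x + m) <;> cases c (x + l) <;> simp [this]
      field_simp
    have e4 : value c (block x (m + 1)) = value c (block x m) + 2 ^ m * (c (x + m)).toNat := by
      rw [block_succ, value_append, length_block]; simp [value]
    have e5 : value c' (block x (m + 1)).reverse =
        (c' (x + m)).toNat + 2 * value c' (block x m).reverse := by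
      rw [block_succ, List.reverse_append]; rfl
    have e6 : (if c (x + m) && c' (x + m) then (-1 : ℂ) else 1) =
        cis (-((c (x + m)).toNat * (c' (x + m)).toNat / 2)) := by
      cases c (x + m) <;> cases c' (x + m) <;> simp [cis_zero]
      rw [inv_eq_one_div, cis_neg_half]
    rw [e3, value_congr hm, e4, e5, mix_of_mem _ _ (Set.mem_singleton _), e6]
    set X := value c (block x m)
    set Y := value c' (block x m).reverse
    have e7 : -(((X + 2 ^ m * (c (x + m)).toNat : ℕ) : ℝ) *
        (((c' (x + m)).toNat + 2 * Y : ℕ) : ℝ) / 2 ^ (m + 1)) =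
        -((c (x + m)).toNat * (c' (x + m)).toNat / 2) +
        (-((c' (x + m)).toNat * X / 2 ^ (m + 1)) + (-(X * Y / 2 ^ m) +
        -(((c (x + m)).toNat * Y : ℕ) : ℝ))) := by
      push_cast
      rw [pow_succ]
      field_simp
      ring
    rw [e7, cis_add, cis_add, cis_add, cis_neg_natCast, pow_succ]
    ring

/-- Phases and inverse Fourier transforms on disjoint registers. -/
theorem pathForm_qft_registers (x : ℕ → ℕ) (m b M : ℕ)
    (hx : ∀ r < M, ∀ r' < M, ∀ z ∈ block (x r) m, z ∈ block (x r') m → r = r') :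
    PathForm ((List.range M).flatMap fun r => phases (x r) m b ++ qft (x r) m)
      {z | ∃ r < M, z ∈ block (x r) m} fun c c' => ∏ r ∈ Finset.range M,
        (((1 / Real.sqrt 2 : ℝ) : ℂ) ^ m * cis ((value c (block (x r) m) : ℝ) / b -
          (value c (block (x r) m) : ℝ) * value c' (block (x r) m).reverse / 2 ^ m)) := by
  induction M with
  | zero => simpa using pathForm_nil
  | succ M ih =>
    have hd : Disjoint {z | ∃ r < M, z ∈ block (x r) m} {z | z ∈ block (x M) m} := by
      rw [Set.disjoint_left]
      rintro z ⟨r, hr, hz⟩ hz'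
      exact absurd (hx r (by omega) M (by omega) z hz hz') (by omega)
    have e : {z | ∃ r < M + 1, z ∈ block (x r) m} =
        {z | ∃ r < M, z ∈ block (x r) m} ∪ {z | z ∈ block (x M) m} := by
      ext z
      simp only [Set.mem_ofPred_eq, Set.mem_union, Nat.lt_succ_iff_lt_or_eq]
      constructor
      · rintro ⟨r, hr | rfl, hz⟩
        · exact Or.inl ⟨r, hr, hz⟩
        · exact Or.inr hz
      · rintro (⟨r, hr, hz⟩ | hz)
        · exact ⟨r, Or.inl hr, hz⟩
        · exact ⟨M, Or.inr rfl, hz⟩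
    rw [List.range_succ, List.flatMap_append, List.flatMap_singleton, e]
    refine ((ih fun r hr r' hr' => hx r (by omega) r' (by omega)).append
      ((isDiag_phases (x M) m b).append_pathForm (pathForm_qft (x M) m)) hd).congr
      fun c c' _ => ?_
    rw [Finset.prod_range_succ]
    congr 1
    · refine Finset.prod_congr rfl fun r hr => ?_
      rw [value_congr (c := mix _ c' c) (c' := c') fun z hz => mix_of_mem _ _
        (show z ∈ {z | ∃ r < M, z ∈ block (x r) m} from
          ⟨r, Finset.mem_range.1 hr, List.mem_reverse.1 hz⟩)]
    · rw [value_congr (c := mix _ c' c) (c' := c) fun z hz => mix_of_notMem _ _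
        fun h => Set.disjoint_left.1 hd h hz, sub_eq_add_neg, cis_add]
      ring

/-- The state produced by a circuit in path form, as a sum over the contents of the modified
qubits. -/
theorem PathForm.run_eq_sum {Γ : Circuit} {S : Set ℕ} {φ : Config → Config → ℂ}
    (h : PathForm Γ S φ) {ι : Type*} [Fintype ι] [DecidableEq ι] {addr : ι → ℕ}
    (hinj : Function.Injective addr) (hS : S = Set.range addr) (c : Config) :
    run Γ (Finsupp.single c 1) = ∑ f : ι → Bool,
      Finsupp.single (Function.extend addr f c) (φ c (Function.extend addr f c)) := by
  classical
  ext c'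
  rw [h, Finsupp.finsetSum_apply]
  simp only [Finsupp.single_apply]
  have key : ∀ f : ι → Bool, Function.extend addr f c = c' →
      f = (c' ∘ addr) ∧ ∀ z ∉ S, c' z = c z := by
    rintro f rfl
    refine ⟨funext fun i => (hinj.extend_apply _ _ _).symm, fun z hz => ?_⟩
    exact Function.extend_apply' _ _ _ fun ⟨i, hi⟩ => hz (hS ▸ ⟨i, hi⟩)
  split_ifs with hc
  · have e : Function.extend addr (c' ∘ addr) c = c' := by
      funext z
      by_cases hz : z ∈ S
      · obtain ⟨i, rfl⟩ := hS ▸ hz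
        rw [hinj.extend_apply]; rfl
      · rw [Function.extend_apply' _ _ _ fun ⟨i, hi⟩ => hz (hS ▸ ⟨i, hi⟩), hc z hz]
    rw [Finset.sum_eq_single (c' ∘ addr)]
    · rw [if_pos e, e]
    · exact fun f _ hf => if_neg fun h' => hf (key f h').1
    · simp
  · exact (Finset.sum_eq_zero fun f _ => if_neg fun h' => hc (key f h').2).symm

/-! ### Amplitudes of phase estimation -/

/-- The amplitude of `y` when the phase `θ` is estimated modulo `N`. -/
def estAmp (N : ℕ) (θ : ℝ) (y : ℕ) : ℂ :=
  (N : ℂ)⁻¹ * ∑ x ∈ Finset.range N, cis (x * (θ - y / N))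

theorem cis_nat_mul (x : ℕ) (δ : ℝ) : cis (x * δ) = cis δ ^ x := by
  rw [cis, cis, ← Complex.exp_nat_mul]
  congr 1
  push_cast
  ring

theorem norm_cis_sub_one (δ : ℝ) : ‖cis δ - 1‖ = 2 * |Real.sin (Real.pi * δ)| := by
  rw [cis, show 2 * (Real.pi : ℂ) * Complex.I * δ = Complex.I * ((2 * (Real.pi * δ) : ℝ) : ℂ) by
    push_cast; ring, Complex.norm_exp_I_mul_ofReal_sub_one]
  rw [mul_div_cancel_left₀ _ two_ne_zero, norm_mul]
  simp

/-- The hypotheses keep `δ` at distance at least `h` from the integers 0 and ±1; the chord has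
length 2|sin πδ|, and Jordan's inequality sin(πx) ≥ 2x on [0, 1/2] applies to |δ| or to 1 - |δ|. -/
theorem le_norm_cis_sub_one {h δ : ℝ} (h0 : 0 ≤ h) (h1 : h ≤ |δ|) (h2 : |δ| ≤ 1 - h) :
    4 * h ≤ ‖cis δ - 1‖ := by
  have hpi := Real.pi_pos
  have key : ∀ x : ℝ, h ≤ x → x ≤ 1 / 2 → 2 * h ≤ Real.sin (Real.pi * x) := fun x hx hx' => by
    have := Real.mul_le_sin (x := Real.pi * x) (by nlinarith) (by nlinarith)
    have e : 2 / Real.pi * (Real.pi * x) = 2 * x := by field_simp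
    linarith
  have habs : |Real.sin (Real.pi * δ)| = |Real.sin (Real.pi * |δ|)| := by
    rcases abs_choice δ with e | e <;> rw [e]
    rw [mul_neg, Real.sin_neg, abs_neg]
  have : 2 * h ≤ |Real.sin (Real.pi * |δ|)| := by
    refine le_trans ?_ (le_abs_self _)
    rcases le_total |δ| (1 / 2) with h3 | h3
    · exact key _ h1 h3
    · rw [← Real.sin_pi_sub, show Real.pi - Real.pi * |δ| = Real.pi * (1 - |δ|) by ring]
      exact key _ (by linarith) (by linarith)
  rw [norm_cis_sub_one, habs]
  linarith

/-- A geometric sum: the numerator has norm at most 2, the denominator at least 4h. The bound does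
not depend on `N`. -/
theorem norm_sum_cis_le {N : ℕ} {h δ : ℝ} (h0 : 0 < h) (h1 : h ≤ |δ|) (h2 : |δ| ≤ 1 - h) :
    ‖∑ x ∈ Finset.range N, cis (x * δ)‖ ≤ (2 * h)⁻¹ := by
  have hpos : 4 * h ≤ ‖cis δ - 1‖ := le_norm_cis_sub_one h0.le h1 h2
  have hne : cis δ ≠ 1 := fun e => by
    rw [e, sub_self, norm_zero] at hpos
    linarith
  simp only [cis_nat_mul]
  rw [geom_sum_eq hne, norm_div]
  have : ‖cis δ ^ N - 1‖ ≤ 2 := by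
    refine (norm_sub_le _ _).trans ?_
    rw [norm_pow, norm_cis]
    norm_num
  rw [div_le_iff₀ (by linarith)]
  calc _ ≤ (2 : ℝ) := this
    _ = (2 * h)⁻¹ * (4 * h) := by field_simp; norm_num
    _ ≤ _ := by gcongr

theorem sum_cis_eq {N : ℕ} (hN : 0 < N) {x x' : ℕ} (hx : x < N) (hx' : x' < N) :
    ∑ y ∈ Finset.range N, cis (y * (((x' : ℝ) - x) / N)) = if x = x' then (N : ℂ) else 0 := by
  have hN' : (N : ℝ) ≠ 0 := by positivity
  split_ifs with h
  · simp [h, cis_zero]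
  · simp only [cis_nat_mul]
    have hne : cis (((x' : ℝ) - x) / N) ≠ 1 := by
      rw [cis, Ne, Complex.exp_eq_one_iff]
      rintro ⟨k, hk⟩
      rw [mul_comm (k : ℂ)] at hk
      have h3 := mul_left_cancel₀ Complex.two_pi_I_ne_zero hk
      have h4 : ((x' : ℝ) - x) / N = k := by exact_mod_cast h3
      rw [div_eq_iff hN'] at h4
      have h5 : (x' : ℤ) - x = k * N := by exact_mod_cast h4
      -- The difference of two residues in [0, N) has absolute value below `N`, so the only multiple
      -- of `N` it can equal is 0.
      have h6 : k = 0 := by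
        by_contra hk0
        rcases lt_or_gt_of_ne hk0 with hk1 | hk1
        · nlinarith
        · nlinarith
      rw [h6] at h5
      omega
    rw [geom_sum_eq hne, ← cis_nat_mul, mul_div_cancel₀ _ hN']
    have : cis ((x' : ℝ) - x) = 1 := by
      rw [sub_eq_add_neg, cis_add, cis_natCast, cis_neg_natCast, one_mul]
    rw [this]
    simp

theorem conj_cis (x : ℝ) : (starRingEnd ℂ) (cis x) = cis (-x) := by
  rw [cis, cis, ← Complex.exp_conj]
  simp [Complex.conj_ofNat]

/-- Parseval: expanding the squares and summing over `y` first leaves only the diagonal terms, by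
`sum_cis_eq`. -/
theorem sum_norm_sq_estAmp {N : ℕ} (hN : 0 < N) (θ : ℝ) :
    ∑ y ∈ Finset.range N, ‖estAmp N θ y‖ ^ 2 = 1 := by
  have hN' : (N : ℂ) ≠ 0 := by exact_mod_cast hN.ne'
  rw [← Complex.ofReal_inj, Complex.ofReal_sum]
  simp_rw [← Complex.normSq_eq_norm_sq, ← Complex.mul_conj, estAmp, map_mul, map_sum, conj_cis,
    mul_mul_mul_comm, Finset.sum_mul_sum, ← cis_add, ← Finset.mul_sum]
  rw [Finset.sum_comm]
  have : ∀ x ∈ Finset.range N, ∑ y ∈ Finset.range N, ∑ x' ∈ Finset.range N,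
      cis (x * (θ - y / N) + -(x' * (θ - y / N))) = N := fun x hx => by
    rw [Finset.sum_comm]
    have : ∀ x' ∈ Finset.range N, ∑ y ∈ Finset.range N,
        cis (x * (θ - y / N) + -(x' * (θ - y / N))) = if x = x' then (N : ℂ) else 0 :=
      fun x' hx' => by
        rw [← mul_one (ite _ _ _)]
        have e : ∀ y : ℕ, cis (x * (θ - y / N) + -(x' * (θ - y / N))) =
            cis (y * (((x' : ℝ) - x) / N)) * cis ((x - x') * θ) := fun y => by
          rw [← cis_add]; congr 1; ring
        simp_rw [e, ← Finset.sum_mul]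
        rw [sum_cis_eq hN (Finset.mem_range.1 hx) (Finset.mem_range.1 hx')]
        split_ifs with h
        · simp [h, cis_zero]
        · simp
    rw [Finset.sum_congr rfl this, Finset.sum_ite_eq, if_pos hx]
  rw [Finset.sum_congr rfl this]
  simp only [Finset.sum_const, Finset.card_range, nsmul_eq_mul, map_inv₀, map_natCast]
  field_simp
  simp

/-- The frequency is the midpoint of [s/p, (s+1)/p), and a wrong reading means that y/N lies outside
this interval. So the two differ by at least h = 1/(2p); and by at most 1 - h, since the frequency
lies in [h, 1 - h] and y/N in [0, 1). The geometric sum is then at most 1/(2h) = p. -/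
theorem norm_estAmp_le {N p s y : ℕ} (hs : s < p) (hy : y < N) (hne : y * p / N ≠ s) :
    ‖estAmp N ((s + 1 / 2) / p) y‖ ≤ p / N := by
  have hN : (0 : ℝ) < N := by exact_mod_cast (Nat.zero_le y).trans_lt hy
  have hp : (0 : ℝ) < p := by exact_mod_cast (Nat.zero_le s).trans_lt hs
  have hs' : (s : ℝ) + 1 ≤ p := by exact_mod_cast hs
  have hy' : (y : ℝ) < N := by exact_mod_cast hy
  set θ : ℝ := (s + 1 / 2) / p
  have hθ : θ * p = s + 1 / 2 := by simp only [θ]; field_simp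
  set h : ℝ := 1 / (2 * p)
  have hh : h * p = 1 / 2 := by simp only [h]; field_simp
  have hh0 : 0 < h := by positivity
  set v : ℝ := y / N
  have hv : v * N = y := by simp only [v]; field_simp
  have hv0 : 0 ≤ v := by positivity
  have hv1 : v < 1 := by rw [div_lt_one hN]; exact hy'
  have hθ1 : h ≤ θ := by
    refine le_of_mul_le_mul_right ?_ hp
    rw [hh, hθ]; linarith [(Nat.cast_nonneg s : (0 : ℝ) ≤ s)]
  have hθ2 : θ ≤ 1 - h := by
    refine le_of_mul_le_mul_right ?_ hp
    rw [sub_mul, hh, hθ]; linarith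
  have h2 : |θ - v| ≤ 1 - h := abs_le.2 ⟨by linarith, by linarith⟩
  have h1 : h ≤ |θ - v| := by
    rcases lt_or_gt_of_ne hne with hlt | hgt
    · rw [Nat.div_lt_iff_lt_mul (by exact_mod_cast hN)] at hlt
      have h3 : (y : ℝ) * p < s * N := by exact_mod_cast hlt
      have h4 : v * p < s := by
        refine lt_of_mul_lt_mul_right ?_ hN.le
        calc v * p * N = v * N * p := by ring
          _ < s * N := by rw [hv]; exact h3
      refine le_trans ?_ (le_abs_self _)
      refine le_of_mul_le_mul_right ?_ hp
      rw [sub_mul, hh, hθ]; linarith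
    · have h3 : (s + 1) * N ≤ y * p := (Nat.le_div_iff_mul_le (by exact_mod_cast hN)).1 hgt
      have h3' : ((s : ℝ) + 1) * N ≤ y * p := by exact_mod_cast h3
      have h4 : (s : ℝ) + 1 ≤ v * p := by
        refine le_of_mul_le_mul_right ?_ hN
        calc _ ≤ (y : ℝ) * p := h3'
          _ = v * p * N := by rw [← hv]; ring
      refine le_trans ?_ (neg_le_abs _)
      refine le_of_mul_le_mul_right ?_ hp
      rw [neg_sub, sub_mul, hh, hθ]; linarith
  rw [estAmp, norm_mul, norm_inv, Complex.norm_natCast, inv_mul_eq_div]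
  gcongr
  refine (norm_sum_cis_le hh0 h1 h2).trans_eq ?_
  simp only [h]
  field_simp

/-- At most `N` wrong readings, each of probability at most (p/N)², are removed from total
probability 1. The crude count suffices because `N` will be a large power of n. -/
theorem le_sum_norm_sq_estAmp {N p s : ℕ} (hN : 0 < N) (hs : s < p) :
    1 - (p : ℝ) ^ 2 / N ≤
      ∑ y ∈ Finset.range N, if y * p / N = s then ‖estAmp N ((s + 1 / 2) / p) y‖ ^ 2 else 0 := by
  have h1 : ∑ y ∈ Finset.range N, ‖estAmp N ((s + 1 / 2) / p) y‖ ^ 2 ≤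
      ∑ y ∈ Finset.range N, ((if y * p / N = s then ‖estAmp N ((s + 1 / 2) / p) y‖ ^ 2 else 0) +
        ((p : ℝ) / N) ^ 2) := by
    refine Finset.sum_le_sum fun y hy => ?_
    split_ifs with h
    · linarith [sq_nonneg ((p : ℝ) / N)]
    · rw [zero_add]
      gcongr
      exact norm_estAmp_le hs (Finset.mem_range.1 hy) h
  rw [sum_norm_sq_estAmp hN, Finset.sum_add_distrib, Finset.sum_const, Finset.card_range,
    nsmul_eq_mul] at h1
  have hN' : (N : ℝ) ≠ 0 := by positivity
  have e : (N : ℝ) * ((p : ℝ) / N) ^ 2 = (p : ℝ) ^ 2 / N := by field_simp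
  linarith

/-! ### Sums over the contents of many registers -/

theorem sum_ofBits {R : Type*} [AddCommMonoid R] (m : ℕ) (F : ℕ → R) :
    ∑ f : Fin m → Bool, F (Nat.ofBits f) = ∑ x ∈ Finset.range (2 ^ m), F x := by
  refine Finset.sum_nbij' (fun f => Nat.ofBits f) (fun x t => x.testBit t) ?_ ?_ ?_ ?_ ?_
  · exact fun f _ => Finset.mem_range.2 (Nat.ofBits_lt_two_pow f)
  · simp
  · exact fun f _ => funext fun t => by simp
  · intro x hx
    refine Nat.eq_of_testBit_eq fun t => ?_
    by_cases ht : t < m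
    · rw [Nat.testBit_ofBits_lt _ _ ht]
    · rw [Nat.testBit_ofBits_ge _ _ (by omega), Nat.testBit_lt_two_pow]
      exact (Finset.mem_range.1 hx).trans_le (Nat.pow_le_pow_right (by norm_num) (by omega))
  · simp

/-- Distributivity: the joint content of the registers is an independent choice for each of them.
This expresses that the state is a product state. -/
theorem sum_registers {R : Type*} [CommSemiring R] (M m : ℕ) (F : Fin M → ℕ → R) :
    ∑ f : Fin M × Fin m → Bool, ∏ r, F r (Nat.ofBits fun t => f (r, t)) =
      ∏ r, ∑ x ∈ Finset.range (2 ^ m), F r x := by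
  simp_rw [← sum_ofBits m]
  rw [Finset.prod_univ_sum, Fintype.piFinset_univ]
  exact Fintype.sum_equiv (Equiv.curry (Fin M) (Fin m) Bool) _ _ fun f => rfl

/-- The version for results of `qft`, which are stored with the most significant bit first. -/
theorem sum_registers_rev {R : Type*} [CommSemiring R] (M m : ℕ) (F : Fin M → ℕ → R) :
    ∑ f : Fin M × Fin m → Bool, ∏ r, F r (Nat.ofBits fun t => f (r, t.rev)) =
      ∏ r, ∑ x ∈ Finset.range (2 ^ m), F r x := by
  rw [← sum_registers]
  exact Fintype.sum_equiv
    (Equiv.arrowCongr (Equiv.prodCongr (Equiv.refl (Fin M)) Fin.revPerm) (Equiv.refl Bool)) _ _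
    fun f => rfl

/-- Phase estimation in many registers at once succeeds with high probability. -/
theorem le_sum_registers {M m p : ℕ} {s : Fin M → ℕ} (hs : ∀ r, s r < p)
    (hp : p ^ 2 ≤ 2 ^ m) :
    1 - (M : ℝ) * ((p : ℝ) ^ 2 / 2 ^ m) ≤ ∑ g : Fin M × Fin m → Bool,
      if ∀ r, (Nat.ofBits fun t => g (r, t.rev)) * p / 2 ^ m = s r then
        ‖∏ r, estAmp (2 ^ m) ((s r + 1 / 2) / p) (Nat.ofBits fun t => g (r, t.rev))‖ ^ 2
      else 0 := by
  have hp' : (p : ℝ) ^ 2 / 2 ^ m ≤ 1 := by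
    rw [div_le_one (by positivity)]
    exact_mod_cast hp
  have e : ∀ g : Fin M × Fin m → Bool,
      (if ∀ r, (Nat.ofBits fun t => g (r, t.rev)) * p / 2 ^ m = s r then
        ‖∏ r, estAmp (2 ^ m) ((s r + 1 / 2) / p) (Nat.ofBits fun t => g (r, t.rev))‖ ^ 2
      else 0) = ∏ r, (fun (r : Fin M) (y : ℕ) => if y * p / 2 ^ m = s r then
        ‖estAmp (2 ^ m) ((s r + 1 / 2) / p) y‖ ^ 2 else 0) r
          (Nat.ofBits fun t => g (r, t.rev)) := fun g => by
    split_ifs with h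
    · rw [norm_prod, ← Finset.prod_pow]
      exact Finset.prod_congr rfl fun r _ => (if_pos (h r)).symm
    · push Not at h
      obtain ⟨r, hr⟩ := h
      exact (Finset.prod_eq_zero (Finset.mem_univ r) (if_neg hr)).symm
  rw [Finset.sum_congr rfl fun g _ => e g, sum_registers_rev M m fun r y =>
    if y * p / 2 ^ m = s r then ‖estAmp (2 ^ m) ((s r + 1 / 2) / p) y‖ ^ 2 else 0]
  -- Success probabilities multiply over the registers, and Bernoulli's inequality bounds the power
  -- from below.
  calc 1 - (M : ℝ) * ((p : ℝ) ^ 2 / 2 ^ m) = 1 + (M : ℝ) * (-((p : ℝ) ^ 2 / 2 ^ m)) := by ring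
    _ ≤ (1 + -((p : ℝ) ^ 2 / 2 ^ m)) ^ M := one_add_mul_le_pow (by linarith) M
    _ = ∏ _r : Fin M, (1 - (p : ℝ) ^ 2 / 2 ^ m) := by simp [sub_eq_add_neg]
    _ ≤ _ := by
        refine Finset.prod_le_prod (fun r _ => by linarith) fun r _ => ?_
        have := le_sum_norm_sq_estAmp (N := 2 ^ m) (by positivity) (hs r)
        push_cast at this
        exact this

/-! ### Digits of convolutions -/

theorem digit_eq {B : ℕ} {D : ℕ → ℕ} {k : ℕ} (hD : ∀ j < k, D j < B) (T : ℕ) {j : ℕ} (hj : j < k) :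
    (∑ i ∈ Finset.range k, D i * B ^ i + B ^ k * T) / B ^ j % B = D j := by
  induction k generalizing D j with
  | zero => omega
  | succ k ih =>
    have hB : 0 < B := (Nat.zero_le _).trans_lt (hD 0 (by omega))
    have e : ∑ i ∈ Finset.range (k + 1), D i * B ^ i + B ^ (k + 1) * T =
        D 0 + B * (∑ i ∈ Finset.range k, D (i + 1) * B ^ i + B ^ k * T) := by
      rw [Finset.sum_range_succ', mul_add, Finset.mul_sum]
      have : ∀ i, D (i + 1) * B ^ (i + 1) = B * (D (i + 1) * B ^ i) := fun i => by ring
      simp only [this]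
      ring
    rw [e]
    cases j with
    | zero => rw [pow_zero, Nat.div_one, Nat.add_mul_mod_self_left, Nat.mod_eq_of_lt (hD 0 hj)]
    | succ j =>
      rw [pow_succ', ← Nat.div_div_eq_div_mul, Nat.add_mul_div_left _ _ hB,
        Nat.div_eq_of_lt (hD 0 (by omega)), zero_add]
      exact ih (D := fun i => D (i + 1)) (fun j hj => hD (j + 1) (by omega)) (by omega)

/-- The lower half of the digits of a product is the convolution of the digits, if there is no
carry. -/
theorem digit_mul {B k : ℕ} {x f : ℕ → ℕ} (hf : ∀ u, k < u → f u = 0) {j : ℕ} (hj : j < k)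
    (hB : ∀ j < k, ∑ i ∈ Finset.range k, x i * f (k + i - j) < B) :
    ((∑ i ∈ Finset.range k, x i * B ^ i) * ∑ u ∈ Finset.range k, f (k - u) * B ^ u) / B ^ j % B =
      ∑ i ∈ Finset.range k, x i * f (k + i - j) := by
  -- One summand of the first factor shifts the reversed sequence `f` by `i` places. Positions below
  -- `i` carry `f` beyond `k`, hence 0; positions from `k` on are collected in a multiple of `B ^
  -- k`, which does not affect the lower digits.
  have h1 : ∀ i ∈ Finset.range k, x i * B ^ i * ∑ u ∈ Finset.range k, f (k - u) * B ^ u =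
      ∑ j ∈ Finset.range k, x i * f (k + i - j) * B ^ j +
        B ^ k * (x i * ∑ u ∈ Finset.range i, f (i - u) * B ^ u) := by
    intro i _
    have h2 : ∑ j ∈ Finset.range (i + k), f (k + i - j) * B ^ j =
        B ^ i * ∑ u ∈ Finset.range k, f (k - u) * B ^ u := by
      rw [Finset.sum_range_add, Finset.sum_eq_zero, zero_add, Finset.mul_sum]
      · refine Finset.sum_congr rfl fun u _ => ?_
        rw [show k + i - (i + u) = k - u by omega]; ring
      · intro j hj
        rw [Finset.mem_range] at hj
        rw [hf _ (by omega), zero_mul]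
    have h3 : ∑ j ∈ Finset.range (k + i), f (k + i - j) * B ^ j =
        ∑ j ∈ Finset.range k, f (k + i - j) * B ^ j +
          B ^ k * ∑ u ∈ Finset.range i, f (i - u) * B ^ u := by
      rw [Finset.sum_range_add, Finset.mul_sum]
      congr 1
      refine Finset.sum_congr rfl fun u _ => ?_
      rw [show k + i - (k + u) = i - u by omega]; ring
    rw [mul_assoc, ← h2, add_comm i k, h3, mul_add, Finset.mul_sum]
    congr 1
    · exact Finset.sum_congr rfl fun j _ => by ring
    · ring
  rw [Finset.sum_mul, Finset.sum_congr rfl h1, Finset.sum_add_distrib, Finset.sum_comm,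
    ← Finset.mul_sum]
  simp only [← Finset.sum_mul]
  exact digit_eq (D := fun j => ∑ i ∈ Finset.range k, x i * f (k + i - j)) hB _ hj

namespace Inst

/-! ### Coordinates of field elements -/

/-- The coefficients of the defining polynomial, including the leading one. -/
def fcoef (I : Inst) (u : ℕ) : ℕ := (I.2.2 ++ [1]).getD u 0

theorem fcoef_lt {I : Inst} {u : ℕ} (h : u < I.deg) : I.fcoef u = I.2.2[u] := by
  simp [fcoef, List.getD_eq_getElem?_getD, List.getElem?_append_left h, h]

theorem fcoef_deg (I : Inst) : I.fcoef I.deg = 1 := by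
  simp [fcoef]

theorem fcoef_of_lt {I : Inst} {u : ℕ} (h : I.deg < u) : I.fcoef u = 0 := by
  rw [fcoef, List.getD_eq_default]
  simpa using h

theorem natDegree_poly (I : Inst) [Nontrivial (ZMod I.char)] : I.poly.natDegree = I.deg := by
  rw [poly, natDegree_add_eq_left_of_degree_lt, natDegree_X_pow]
  rw [degree_X_pow]
  exact degree_sum_fin_lt _

theorem coeff_poly (I : Inst) (u : ℕ) : I.poly.coeff u = (I.fcoef u : ZMod I.char) := by
  rw [poly, coeff_add, coeff_X_pow, finsetSum_coeff]
  simp only [coeff_C_mul, coeff_X_pow, mul_ite, mul_one, mul_zero]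
  rcases lt_trichotomy u I.deg with h | h | h
  · rw [if_neg h.ne, zero_add, Finset.sum_eq_single (⟨u, h⟩ : Fin I.deg)]
    · rw [fcoef_lt h]; simp
    · intro b _ hb
      exact if_neg fun e => hb (Fin.ext e.symm)
    · simp
  · rw [if_pos h, h, fcoef_deg, Finset.sum_eq_zero, add_zero, Nat.cast_one]
    intro b _
    exact if_neg (b.2.ne')
  · rw [if_neg h.ne', fcoef_of_lt h, Finset.sum_eq_zero, add_zero, Nat.cast_zero]
    intro b _
    exact if_neg (by have := b.2; omega)

/-- The coefficient of `X ^ l` of a field element. -/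
def coeffZ (I : Inst) (l : ℕ) : I.Fq →ₗ[ZMod I.char] ZMod I.char :=
  (lcoeff (ZMod I.char) l).comp (AdjoinRoot.modByMonicHom I.poly_monic)

theorem coeffZ_natCast_mul {I : Inst} (l a : ℕ) (x : I.Fq) :
    I.coeffZ l (a * x) = a * I.coeffZ l x := by
  rw [← nsmul_eq_mul, map_nsmul, nsmul_eq_mul]

theorem coord_eq (I : Inst) (x : I.Fq) (l : ℕ) : I.coord x l = (I.coeffZ l x).val := rfl

theorem coeffZ_mk {I : Inst} [Nontrivial (ZMod I.char)] {g : (ZMod I.char)[X]}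
    (hg : g.degree < I.deg) (l : ℕ) : I.coeffZ l (AdjoinRoot.mk I.poly g) = g.coeff l := by
  simp only [coeffZ, LinearMap.comp_apply, AdjoinRoot.modByMonicHom_mk, lcoeff_apply]
  rw [(modByMonic_eq_self_iff I.poly_monic).2]
  rwa [degree_eq_natDegree I.poly_monic.ne_zero, natDegree_poly]

theorem exists_rep (I : Inst) [Nontrivial (ZMod I.char)] (x : I.Fq) :
    ∃ g : (ZMod I.char)[X], g.degree < I.deg ∧ x = AdjoinRoot.mk I.poly g := by
  refine ⟨AdjoinRoot.modByMonicHom I.poly_monic x, ?_,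
    (AdjoinRoot.mk_leftInverse I.poly_monic x).symm⟩
  obtain ⟨g, rfl⟩ := AdjoinRoot.mk_surjective x
  rw [AdjoinRoot.modByMonicHom_mk]
  have := degree_modByMonic_lt g I.poly_monic
  rwa [degree_eq_natDegree I.poly_monic.ne_zero, natDegree_poly] at this

/-- Multiplying a reduced representative by X raises the degree to at most `deg`, so subtracting one
multiple of the monic defining polynomial reduces it again. -/
theorem coeffZ_root_mul {I : Inst} [Nontrivial (ZMod I.char)] (x : I.Fq) {l : ℕ}
    (hl : l + 1 < I.deg) : I.coeffZ (l + 1) (AdjoinRoot.root I.poly * x) =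
      I.coeffZ l x - I.fcoef (l + 1) * I.coeffZ (I.deg - 1) x := by
  obtain ⟨g, hg, rfl⟩ := I.exists_rep x
  have e : AdjoinRoot.root I.poly * AdjoinRoot.mk I.poly g =
      AdjoinRoot.mk I.poly (X * g - C (g.coeff (I.deg - 1)) * I.poly) := by
    rw [map_sub, map_mul, map_mul, AdjoinRoot.mk_self, mul_zero, sub_zero, AdjoinRoot.mk_X]
  rw [e, coeffZ_mk, coeffZ_mk hg, coeffZ_mk hg, coeff_sub, coeff_C_mul, coeff_X_mul, coeff_poly,
    mul_comm]
  rw [degree_lt_iff_coeff_zero]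
  intro j hj
  obtain ⟨j, rfl⟩ : ∃ i, j = i + 1 := ⟨j - 1, by omega⟩
  rw [coeff_sub, coeff_C_mul, coeff_X_mul, coeff_poly]
  rcases hj.eq_or_lt with h | h
  · rw [← h, fcoef_deg, h, Nat.add_sub_cancel, Nat.cast_one, mul_one, sub_self]
  · rw [fcoef_of_lt h, Nat.cast_zero, mul_zero, sub_zero]
    exact (degree_lt_iff_coeff_zero _ _).1 hg j (by omega)

/-- The dual of the power basis with respect to the last coefficient. -/
theorem coeffZ_mul_dual {I : Inst} [Nontrivial (ZMod I.char)] (x : I.Fq) {i : ℕ} (hi : i < I.deg) :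
    I.coeffZ (I.deg - 1) (x * ∑ t ∈ Finset.range I.deg,
      (I.fcoef (i + 1 + t) : I.Fq) * AdjoinRoot.root I.poly ^ t) = I.coeffZ i x := by
  -- Downward induction from the top index, where the dual element is 1.
  obtain ⟨j, rfl⟩ : ∃ j, i = I.deg - 1 - j := ⟨I.deg - 1 - i, by omega⟩
  have hd : I.deg = (I.deg - 1) + 1 := by omega
  clear hi
  induction j generalizing x with
  | zero =>
    rw [hd, Finset.sum_range_succ', Finset.sum_eq_zero]
    · rw [Nat.add_sub_cancel, Nat.sub_zero, add_zero, ← hd, fcoef_deg]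
      simp
    · intro t _
      rw [fcoef_of_lt (by omega), Nat.cast_zero, zero_mul]
  | succ j ih =>
    -- Here truncated subtraction makes the old and the new index both 0, so there is nothing new to
    -- prove.
    by_cases hj : I.deg - 1 ≤ j
    · have := ih x
      rwa [show I.deg - 1 - j = I.deg - 1 - (j + 1) by omega] at this
    · have hi : I.deg - 1 - j = I.deg - 1 - (j + 1) + 1 := by omega
      set i := I.deg - 1 - (j + 1)
      -- The dual elements satisfy the Horner recursion δ_i = X δ_{i+1} + f_{i+1}. The correction
      -- f_{i+1} cancels the reduction term of `coeffZ_root_mul`.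
      have e : ∑ t ∈ Finset.range I.deg, (I.fcoef (i + 1 + t) : I.Fq) *
          AdjoinRoot.root I.poly ^ t = AdjoinRoot.root I.poly * (∑ t ∈ Finset.range I.deg,
            (I.fcoef (i + 1 + 1 + t) : I.Fq) * AdjoinRoot.root I.poly ^ t) + I.fcoef (i + 1) := by
        rw [hd, Finset.sum_range_succ', Finset.sum_range_succ _ (I.deg - 1),
          fcoef_of_lt (u := i + 1 + 1 + (I.deg - 1)) (by omega), Nat.cast_zero, zero_mul, add_zero,
          add_zero, Finset.mul_sum, pow_zero, mul_one]
        congr 1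
        refine Finset.sum_congr rfl fun t _ => ?_
        rw [show i + 1 + (t + 1) = i + 1 + 1 + t by omega]
        ring
      rw [e, mul_add, map_add, ← mul_assoc, mul_comm x, ← hi, ih, hi, coeffZ_root_mul _ (by omega)]
      rw [mul_comm x, coeffZ_natCast_mul, sub_add_cancel]

/-- The field element that is assembled from the contents `x` of the registers of an entry. -/
def assemble (I : Inst) (x : ℕ → ℕ) : I.Fq :=
  ∑ t ∈ Finset.range I.deg, ((∑ i ∈ Finset.range I.deg, x i * I.fcoef (i + 1 + t) : ℕ) : I.Fq) *
    AdjoinRoot.root I.poly ^ t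

/-- The defining sum is already reduced modulo the polynomial, so its coefficients need only a
reduction modulo p. This is what the circuit writes into the query matrix. -/
theorem coord_assemble {I : Inst} [Nontrivial (ZMod I.char)] (x : ℕ → ℕ) {l : ℕ} (hl : l < I.deg) :
    I.coord (I.assemble x) l = (∑ i ∈ Finset.range I.deg, x i * I.fcoef (i + 1 + l)) % I.char := by
  have e : I.assemble x = AdjoinRoot.mk I.poly (∑ t ∈ Finset.range I.deg,
      C ((∑ i ∈ Finset.range I.deg, x i * I.fcoef (i + 1 + t) : ℕ) : ZMod I.char) * X ^ t) := by
    rw [assemble, map_sum]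
    refine Finset.sum_congr rfl fun t _ => ?_
    rw [map_mul, map_pow, AdjoinRoot.mk_X, C_eq_natCast, map_natCast]
  rw [coord_eq, e, coeffZ_mk, finsetSum_coeff]
  · simp only [coeff_C_mul, coeff_X_pow, mul_ite, mul_one, mul_zero]
    rw [Finset.sum_ite_eq, if_pos (Finset.mem_range.2 hl), ZMod.val_natCast]
  · rw [degree_lt_iff_coeff_zero]
    intro j hj
    rw [finsetSum_coeff]
    simp only [coeff_C_mul, coeff_X_pow, mul_ite, mul_one, mul_zero]
    rw [Finset.sum_ite_eq, if_neg (by simpa using hj)]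

/-- After exchanging the sums, `assemble x` is the combination Σ x_i δ_i of the dual basis, and
pairing with δ_i extracts coefficient `i` of `y`. -/
theorem coeffZ_mul_assemble {I : Inst} [Nontrivial (ZMod I.char)] (y : I.Fq) (x : ℕ → ℕ) :
    I.coeffZ (I.deg - 1) (y * I.assemble x) =
      ∑ i ∈ Finset.range I.deg, (x i : ZMod I.char) * I.coeffZ i y := by
  have e : y * I.assemble x = ∑ i ∈ Finset.range I.deg, (x i : I.Fq) *
      (y * ∑ t ∈ Finset.range I.deg, (I.fcoef (i + 1 + t) : I.Fq) *
        AdjoinRoot.root I.poly ^ t) := by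
    rw [assemble, Finset.mul_sum]
    simp only [Nat.cast_sum, Nat.cast_mul, Finset.sum_mul, Finset.mul_sum]
    rw [Finset.sum_comm]
    exact Finset.sum_congr rfl fun _ _ => Finset.sum_congr rfl fun _ _ => by ring
  rw [e, map_sum]
  refine Finset.sum_congr rfl fun i hi => ?_
  rw [coeffZ_natCast_mul, coeffZ_mul_dual _ (Finset.mem_range.1 hi)]

/-! ### Consequences of admissibility -/

theorem Admissible.neZero {c : ℕ} {I : Inst} (h : I.Admissible c) : NeZero I.char :=
  ⟨h.prime.ne_zero⟩

theorem Admissible.nontrivial {c : ℕ} {I : Inst} (h : I.Admissible c) :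
    Nontrivial (ZMod I.char) :=
  ZMod.nontrivial_iff.2 h.prime.ne_one

theorem Admissible.deg_pos {c : ℕ} {I : Inst} (h : I.Admissible c) : 0 < I.deg := by
  have := h.nontrivial
  rw [Nat.pos_iff_ne_zero]
  intro h0
  refine h.irreducible.not_isUnit ?_
  rw [eq_one_of_monic_natDegree_zero I.poly_monic (by rw [natDegree_poly, h0])]
  exact isUnit_one

theorem Admissible.two_le_size {c : ℕ} {I : Inst} (h : I.Admissible c) : 2 ≤ I.size := by
  have h1 : 2 ≤ I.char ^ I.deg :=
    h.prime.two_le.trans (Nat.le_self_pow h.deg_pos.ne' _)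
  by_contra! h2
  have : I.size ^ c ≤ 1 := (Nat.pow_le_pow_left (by omega : I.size ≤ 1) c).trans_eq (one_pow c)
  have := h.bound
  omega

theorem char_le (I : Inst) : I.char ≤ 2 ^ I.digitBits := Nat.le_pow_clog (by norm_num) _

theorem Admissible.coord_lt {c : ℕ} {I : Inst} (h : I.Admissible c) (x : I.Fq) (l : ℕ) :
    I.coord x l < I.char :=
  have := h.neZero
  ZMod.val_lt _

theorem Admissible.digitBits_pos {c : ℕ} {I : Inst} (h : I.Admissible c) : 0 < I.digitBits :=
  Nat.clog_pos (by norm_num) h.prime.two_le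

theorem Admissible.fcoef_lt_two_pow {c : ℕ} {I : Inst} (h : I.Admissible c) (u : ℕ) :
    I.fcoef u < 2 ^ I.digitBits := by
  rcases lt_trichotomy u I.deg with hu | rfl | hu
  · rw [fcoef_lt hu]
    exact (h.reduced _ (List.getElem_mem _)).trans_le I.char_le
  · rw [fcoef_deg]
    exact Nat.one_lt_two_pow h.digitBits_pos.ne'
  · rw [fcoef_of_lt hu]
    positivity

/-! ### Phases of field elements -/

theorem phase_eq (I : Inst) (x : I.Fq) :
    I.phase x = cis ((I.coord x (I.deg - 1) : ℝ) / I.char) := by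
  rw [phase, cis]
  push_cast
  rfl

theorem cis_mod_div {p : ℕ} (hp : p ≠ 0) (a : ℕ) :
    cis (((a % p : ℕ) : ℝ) / p) = cis ((a : ℝ) / p) := by
  conv_rhs => rw [← Nat.mod_add_div a p]
  have hp' : (p : ℝ) ≠ 0 := by exact_mod_cast hp
  rw [Nat.cast_add, Nat.cast_mul, add_div, mul_div_cancel_left₀ _ hp', cis_add, cis_natCast,
    mul_one]

/-- The phase factors over the individual contents `x e i`; this is why the query keeps the Fourier
registers unentangled. -/
theorem Admissible.phase_sum_mul_assemble {c : ℕ} {I : Inst} (h : I.Admissible c) {ι : Type*}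
    (s : Finset ι) (y : ι → I.Fq) (x : ι → ℕ → ℕ) :
    I.phase (∑ e ∈ s, y e * I.assemble (x e)) =
      ∏ e ∈ s, ∏ i ∈ Finset.range I.deg, cis ((x e i : ℝ) * I.coord (y e) i / I.char) := by
  have := h.nontrivial
  have := h.neZero
  have e : I.coeffZ (I.deg - 1) (∑ e ∈ s, y e * I.assemble (x e)) =
      ((∑ e ∈ s, ∑ i ∈ Finset.range I.deg, x e i * I.coord (y e) i : ℕ) : ZMod I.char) := by
    rw [map_sum]
    push_cast
    refine Finset.sum_congr rfl fun e _ => ?_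
    rw [coeffZ_mul_assemble]
    refine Finset.sum_congr rfl fun i _ => ?_
    rw [coord_eq, ZMod.natCast_zmod_val]
  rw [phase_eq, coord_eq, e, ZMod.val_natCast, cis_mod_div h.prime.ne_zero]
  push_cast
  simp only [Finset.sum_div, cis_sum]

/-! ### Memory contents -/

theorem matConfig_eq_false {I : Inst} {base : ℕ} {M : I.Mat} {z : ℕ}
    (hz : z < base ∨ base + I.matBits ≤ z) : I.matConfig base M z = false := by
  rw [matConfig, decide_eq_false_iff_not]
  rintro ⟨i, j, t, ht, rfl, -⟩
  rw [entryAddr, matBits] at hz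
  have h1 : (i : ℕ) * I.size + j < I.size * I.size := by nlinarith [i.2, j.2]
  have h2 : ((i : ℕ) * I.size + j + 1) * I.fieldBits ≤ I.size * I.size * I.fieldBits := by gcongr; omega
  rw [add_mul, one_mul] at h2
  omega

theorem entryAddr_add_inj {I : Inst} {base : ℕ} {i j i' j' : Fin I.size} {t t' : ℕ}
    (ht : t < I.fieldBits) (ht' : t' < I.fieldBits)
    (h : I.entryAddr base i j + t = I.entryAddr base i' j' + t') : i = i' ∧ j = j' ∧ t = t' := by
  rw [entryAddr, entryAddr, add_assoc, add_assoc, Nat.add_right_inj] at h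
  have h1 := congrArg (· / I.fieldBits) h
  have h2 := congrArg (· % I.fieldBits) h
  have hF : 0 < I.fieldBits := by omega
  simp only [mul_comm _ I.fieldBits, Nat.mul_add_div hF, Nat.mul_add_mod, Nat.div_eq_of_lt ht,
    Nat.div_eq_of_lt ht', Nat.mod_eq_of_lt ht, Nat.mod_eq_of_lt ht', add_zero] at h1 h2
  have h3 := congrArg (· / I.size) h1
  have h4 := congrArg (· % I.size) h1
  have hn : 0 < I.size := i.pos
  simp only [mul_comm _ I.size, Nat.mul_add_div hn, Nat.mul_add_mod, Nat.div_eq_of_lt j.2,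
    Nat.div_eq_of_lt j'.2, Nat.mod_eq_of_lt j.2, Nat.mod_eq_of_lt j'.2, add_zero] at h3 h4
  exact ⟨Fin.ext h3, Fin.ext h4, h2⟩

theorem holdsMat_matConfig (I : Inst) (base : ℕ) (M : I.Mat) :
    I.HoldsMat base M (I.matConfig base M) := by
  intro i j t ht
  rw [matConfig, Bool.eq_iff_iff, decide_eq_true_iff]
  constructor
  · rintro ⟨i', j', t', ht', h, hb⟩
    obtain ⟨rfl, rfl, rfl⟩ := entryAddr_add_inj ht ht' h
    exact hb
  · exact fun hb => ⟨i, j, t, ht, rfl, hb⟩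

theorem HoldsMat.eqOn {I : Inst} {base : ℕ} {M : I.Mat} {c c' : Config} (h : I.HoldsMat base M c)
    (h' : I.HoldsMat base M c') {z : ℕ} (h1 : base ≤ z) (h2 : z < base + I.matBits) :
    c z = c' z := by
  obtain ⟨y, rfl⟩ := Nat.exists_eq_add_of_le h1
  have hy : y < I.size * I.size * I.fieldBits := by
    rw [matBits] at h2; omega
  have hF : 0 < I.fieldBits := Nat.pos_of_ne_zero fun e => by simp [e] at hy
  have he : y / I.fieldBits < I.size * I.size := (Nat.div_lt_iff_lt_mul hF).2 hy
  have hn : 0 < I.size := Nat.pos_of_ne_zero fun e => by simp [e] at he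
  have ht := Nat.mod_lt y hF
  have e : base + y = I.entryAddr base ⟨y / I.fieldBits / I.size, (Nat.div_lt_iff_lt_mul hn).2 he⟩
      ⟨y / I.fieldBits % I.size, Nat.mod_lt _ hn⟩ + y % I.fieldBits := by
    rw [entryAddr]
    dsimp only
    rw [mul_comm _ I.size, Nat.div_add_mod, mul_comm _ I.fieldBits, add_assoc, Nat.div_add_mod]
  rw [e, h _ _ _ ht, h' _ _ _ ht]

theorem input₂_eq_false {I : Inst} {A B : I.Mat} {z : ℕ} (hz : 2 * I.matBits ≤ z) :
    I.input₂ A B z = false := by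
  rw [input₂, matConfig_eq_false (by omega), matConfig_eq_false (by omega)]; rfl

theorem input₃_eq_input₂ {I : Inst} {A B C : I.Mat} {z : ℕ} (hz : z < 2 * I.matBits) :
    I.input₃ A B C z = I.input₂ A B z := by
  rw [input₃, matConfig_eq_false (Or.inl hz), Bool.or_false]

theorem input₃_eq_false {I : Inst} {A B C : I.Mat} {z : ℕ} (hz : 3 * I.matBits ≤ z) :
    I.input₃ A B C z = false := by
  rw [input₃, input₂_eq_false (by omega), matConfig_eq_false (by omega)]; rfl

theorem holdsMat_input₃ (I : Inst) (A B C : I.Mat) :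
    I.HoldsMat (2 * I.matBits) C (I.input₃ A B C) := by
  intro i j t ht
  rw [← holdsMat_matConfig I (2 * I.matBits) C i j t ht, input₃, input₂_eq_false, Bool.false_or]
  rw [entryAddr]
  omega

/-! ### From the trace to a phase oracle -/

theorem IsDiag_run_apply {Γ : Circuit} {φ : Config → ℂ} (h : IsDiag Γ φ) (ψ : State) (c : Config) :
    run Γ ψ c = ψ c * φ c := by
  classical
  rw [run_apply]
  simp only [h _, Finsupp.single_apply]
  rw [Finsupp.sum, Finset.sum_eq_single c]
  · simp
  · intro c' _ hc'
    simp [hc']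
  · intro h'
    simp [Finsupp.notMem_support_iff.1 h']

/-- Phases for a field element stored behind three matrices. -/
def phaseCircuit (I : Inst) : Circuit :=
  phases (3 * I.matBits + (I.deg - 1) * I.digitBits) I.digitBits I.char

theorem Admissible.phaseCircuit_spec {c : ℕ} {I : Inst} (h : I.Admissible c) {x : I.Fq}
    {z : Config} (hz : I.Holds (3 * I.matBits) x z) :
    cis ((value z (block (3 * I.matBits + (I.deg - 1) * I.digitBits) I.digitBits) : ℝ) / I.char) =
      I.phase x := by
  have e : value z (block (3 * I.matBits + (I.deg - 1) * I.digitBits) I.digitBits) =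
      I.coord x (I.deg - 1) := by
    refine value_eq_of_testBit ?_ fun t ht => ?_
    · rw [length_block]
      exact (h.coord_lt _ _).trans_le I.char_le
    · rw [length_block] at ht
      have hb := h.digitBits_pos
      rw [getElem_block, add_assoc, hz, bit, mul_comm, Nat.mul_add_div hb, Nat.mul_add_mod,
        Nat.div_eq_of_lt ht, Nat.mod_eq_of_lt ht, add_zero]
      rw [fieldBits]
      calc (I.deg - 1) * I.digitBits + t < (I.deg - 1) * I.digitBits + I.digitBits := by omega
        _ = (I.deg - 1 + 1) * I.digitBits := by ring
        _ = I.deg * I.digitBits := by rw [Nat.sub_add_cancel h.deg_pos]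
  rw [e, phase_eq]

theorem trace_mul_eq_matInner {n : ℕ} {R : Type*} [CommRing R] (X C : Matrix (Fin n) (Fin n) R) :
    Matrix.trace (X * C) = matInner X C.transpose := by
  simp [Matrix.trace, Matrix.mul_apply, matInner]

/-- Every basis vector in the output of `U` holds the trace, whatever garbage surrounds it. The
phase circuit therefore multiplies the whole state by one scalar, and the inverse restores the
input. -/
theorem Admissible.isPhaseOracle_of_computesTrace {c : ℕ} {I : Inst} (h : I.Admissible c)
    {U : Circuit} (hU : I.ComputesTrace U) :
    I.IsPhaseOracle (U ++ I.phaseCircuit ++ inverse U) := by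
  intro A B C
  have e : run I.phaseCircuit (run U (Finsupp.single (I.input₃ A B C) 1)) =
      I.phase (matInner (A * B) C.transpose) • run U (Finsupp.single (I.input₃ A B C) 1) := by
    ext z
    rw [phaseCircuit, IsDiag_run_apply (isDiag_phases _ _ _), Finsupp.smul_apply, smul_eq_mul]
    by_cases hz : run U (Finsupp.single (I.input₃ A B C) 1) z = 0
    · simp [hz]
    · rw [h.phaseCircuit_spec (of_prob_eq_one (hU A B C) z hz), trace_mul_eq_matInner, mul_comm]
  rw [run_append, run_append, e, run_smul, run_inverse_run, Finsupp.smul_single, smul_eq_mul,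
    mul_one]

end Inst

/-! ### The exact algorithm -/

theorem matInner_add_left {n : ℕ} {R : Type*} [CommRing R] (X Y Z : Matrix (Fin n) (Fin n) R) :
    matInner (X + Y) Z = matInner X Z + matInner Y Z := by
  simp [matInner, add_mul, Finset.sum_add_distrib]

/-- Pairing with `D` and applying `χ` is an additive character of the matrix space. It is nontrivial
for D ≠ 0, because matrices supported at a nonzero entry of `D` realise every value of the pairing.
-/
theorem sum_char_matInner {F : Type} [Field F] [Fintype F] {n : ℕ} {χ : AddChar F ℂ} (hχ : χ ≠ 1)
    (D : Matrix (Fin n) (Fin n) F) [Decidable (D = 0)] :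
    ∑ X : Matrix (Fin n) (Fin n) F, χ (matInner X D) =
      if D = 0 then ((Fintype.card F : ℂ)) ^ (n * n) else 0 := by
  classical
  split_ifs with h
  · subst h
    have : Fintype.card (Matrix (Fin n) (Fin n) F) = Fintype.card F ^ (n * n) := by
      refine (Fintype.card_fun (α := Fin n) (β := Fin n → F)).trans ?_
      rw [Fintype.card_fun, ← pow_mul, Fintype.card_fin]
    simp [matInner, this]
  · let ψ : AddChar (Matrix (Fin n) (Fin n) F) ℂ :=
      { toFun := fun X => χ (matInner X D)
        map_zero_eq_one' := by simp [matInner]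
        map_add_eq_mul' := fun X Y => by rw [matInner_add_left, AddChar.map_add_eq_mul] }
    have hψ : ψ ≠ 1 := by
      intro e
      refine hχ (DFunLike.ext _ _ fun a => ?_)
      obtain ⟨i, j, hij⟩ : ∃ i j, D i j ≠ 0 := by
        by_contra! h'
        exact h (Matrix.ext h')
      have h1 := DFunLike.congr_fun e (Matrix.single i j (a / D i j))
      have h2 : matInner (Matrix.single i j (a / D i j)) D = a := by
        rw [matInner, Finset.sum_eq_single i, Finset.sum_eq_single j]
        · rw [Matrix.single_apply_same, div_mul_cancel₀ _ hij]
        · intro j' _ hj'; simp [hj'.symm]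
        · simp
        · intro i' _ hi'; simp [hi'.symm]
        · simp
      rw [← h2]
      exact h1
    exact AddChar.sum_eq_zero_of_ne_one hψ

/-- The first transform gives the uniform state. The query and the inverse transform then combine to
the character sum of Mᵀ - Y, which vanishes unless Y = Mᵀ. -/
theorem matQFT_query {F : Type} [Field F] [Fintype F] {χ : AddChar F ℂ} (hχ : χ ≠ 1) (n : ℕ)
    (M : Matrix (Fin n) (Fin n) F) :
    matQFT χ⁻¹ (fun C => χ (matInner M C.transpose) * matQFT χ (ket 0) C) = ket M.transpose := by
  classical
  have h0 : ∀ C : Matrix (Fin n) (Fin n) F, matQFT χ (ket 0) C =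
      ((1 / Real.sqrt ((Fintype.card F : ℝ) ^ (n * n)) : ℝ) : ℂ) := fun C => by
    rw [matQFT, Finset.sum_eq_single 0]
    · simp [ket, matInner]
    · intro X _ hX; simp [ket, hX]
    · simp
  have hq : (Fintype.card F : ℂ) ^ (n * n) ≠ 0 := by
    have : Fintype.card F ≠ 0 := Fintype.card_ne_zero
    positivity
  funext Y
  simp only [h0]
  rw [matQFT, ket]
  have e : ∀ X : Matrix (Fin n) (Fin n) F, χ⁻¹ (matInner X Y) * (χ (matInner M X.transpose) *
      ((1 / Real.sqrt ((Fintype.card F : ℝ) ^ (n * n)) : ℝ) : ℂ)) =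
      χ (matInner X (M.transpose - Y)) *
        ((1 / Real.sqrt ((Fintype.card F : ℝ) ^ (n * n)) : ℝ) : ℂ) := fun X => by
    rw [← mul_assoc, AddChar.inv_apply, ← AddChar.map_add_eq_mul]
    congr 2
    simp only [matInner, Matrix.sub_apply, Matrix.transpose_apply, mul_sub,
      Finset.sum_sub_distrib]
    rw [neg_add_eq_sub, Finset.sum_comm]
    congr 1
    exact Finset.sum_congr rfl fun _ _ => Finset.sum_congr rfl fun _ _ => mul_comm _ _
  rw [Finset.sum_congr rfl fun X _ => e X, ← Finset.sum_mul, sum_char_matInner hχ]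
  by_cases h : Y = M.transpose
  · rw [if_pos (sub_eq_zero.2 h.symm), if_pos h, mul_left_comm, ← Complex.ofReal_mul, div_mul_div_comm,
      Real.mul_self_sqrt (by positivity)]
    push_cast
    field_simp
  · rw [if_neg (sub_ne_zero.2 (Ne.symm h)), if_neg h, zero_mul, mul_zero]

namespace Inst

/-! ### The circuits before and after the query -/

/-- Number of qubits reserved for a register of `m` qubits or a digit of a convolution. -/
def width (I : Inst) (m : ℕ) : ℕ := m + I.digitBits + I.deg + 1

/-- Number of registers: one for each coefficient of each matrix entry. -/
def regs (I : Inst) : ℕ := I.size * I.size * I.deg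

/-- The first ancilla; it always holds `0`, and the next one holds `1`. -/
def anc (I : Inst) (s : ℕ) : ℕ := s + 3 * I.matBits

/-- The first qubit of the `r`-th Fourier register. -/
def xReg (I : Inst) (m s r : ℕ) : ℕ := I.anc s + 2 + r * I.width m

/-- The first qubit of the `r`-th work register. -/
def zReg (I : Inst) (m s r : ℕ) : ℕ := I.anc s + 2 + I.regs * I.width m + r * I.width m

/-- A block that holds the number `v`. -/
def constBlock (I : Inst) (s v len : ℕ) : List ℕ :=
  (List.range len).map fun t => if v / 2 ^ t % 2 = 1 then I.anc s + 1 else I.anc s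

/-- A block that holds the coefficients of the defining polynomial, in decreasing order. -/
def polyBlock (I : Inst) (m s : ℕ) : List ℕ :=
  (List.range (I.deg * I.width m)).map fun t =>
    if I.fcoef (I.deg - t / I.width m) / 2 ^ (t % I.width m) % 2 = 1 then I.anc s + 1 else I.anc s

/-- The first qubit of the `r`-th coefficient of the third matrix. -/
def cReg (I : Inst) (r : ℕ) : ℕ := 2 * I.matBits + r * I.digitBits

/-- The position of a coefficient in the transposed matrix. -/
def transposeIdx (I : Inst) (r : ℕ) : ℕ :=
  ((r / I.deg % I.size) * I.size + r / I.deg / I.size) * I.deg + r % I.deg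

/-- Convolutions of the registers with the coefficients of the defining polynomial. -/
def mulGates (I : Inst) (m s : ℕ) : Circuit :=
  (List.range (I.size * I.size)).map fun e =>
    .arith .mul (block (I.xReg m s (e * I.deg)) (I.deg * I.width m)) (I.polyBlock m s)
      (block (I.zReg m s (e * I.deg)) (I.deg * I.width m))

/-- Reduction of the convolutions modulo the characteristic. -/
def modGates (I : Inst) (m s : ℕ) : Circuit :=
  (List.range I.regs).map fun r =>
    .arith .mod (block (I.zReg m s (r / I.deg * I.deg + (I.deg - 1 - r % I.deg))) (I.width m))
      (I.constBlock s I.char (I.digitBits + 1)) (block (I.cReg r) I.digitBits)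

/-- Computation of the matrix `C` of the query. -/
def prep (I : Inst) (m s : ℕ) : Circuit := I.mulGates m s ++ I.modGates m s

/-- The qubits of the Fourier registers. -/
def xQubits (I : Inst) (m s : ℕ) : List ℕ :=
  (List.range I.regs).flatMap fun r => block (I.xReg m s r) m

/-- The circuit before the query. -/
def before (I : Inst) (m s : ℕ) : Circuit :=
  [.flip (I.anc s + 1)] ++ (I.xQubits m s).map .had ++ I.prep m s

/-- The inverse Fourier transforms. -/
def fourier (I : Inst) (m s : ℕ) : Circuit :=
  (List.range I.regs).flatMap fun r =>
    phases (I.xReg m s r) m (2 * I.char) ++ qft (I.xReg m s r) m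

/-- Rounding of the results of the inverse Fourier transforms. -/
def outGates (I : Inst) (m s : ℕ) : Circuit :=
  (List.range I.regs).map fun r =>
    .arith .mul (block (I.xReg m s r) m).reverse (I.constBlock s I.char (I.digitBits + 1))
      (block (I.zReg m s r) m ++ block (I.cReg (I.transposeIdx r)) I.digitBits)

/-- The circuit after the query. -/
def after (I : Inst) (m s : ℕ) : Circuit :=
  inverse (I.prep m s) ++ I.fourier m s ++ I.outGates m s

/-! ### Addresses -/

theorem stride_inj {a w r r' m m' z : ℕ} (hm : m ≤ w) (hm' : m' ≤ w)
    (h : z ∈ block (a + r * w) m) (h' : z ∈ block (a + r' * w) m') : r = r' := by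
  rw [mem_block] at h h'
  rcases lt_trichotomy r r' with hlt | rfl | hlt
  · have : (r + 1) * w ≤ r' * w := Nat.mul_le_mul_right _ hlt
    rw [add_mul] at this; omega
  · rfl
  · have : (r' + 1) * w ≤ r * w := Nat.mul_le_mul_right _ hlt
    rw [add_mul] at this; omega

theorem stride_lt {r R w t : ℕ} (hr : r < R) (ht : t < w) : r * w + t < R * w := by
  have : (r + 1) * w ≤ R * w := Nat.mul_le_mul_right _ hr
  rw [add_mul] at this; omega

theorem matBits_eq (I : Inst) : I.matBits = I.regs * I.digitBits := by
  rw [matBits, fieldBits, regs, mul_assoc]; ring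

theorem le_width (I : Inst) (m : ℕ) : m ≤ I.width m := by rw [width]; omega

theorem lt_of_mem_cReg {I : Inst} {r z : ℕ} (hr : r < I.regs) (h : z ∈ block (I.cReg r) I.digitBits) :
    2 * I.matBits ≤ z ∧ z < 3 * I.matBits := by
  rw [mem_block, cReg] at h
  have h1 : (r + 1) * I.digitBits ≤ I.regs * I.digitBits := Nat.mul_le_mul_right _ hr
  rw [add_mul, ← matBits_eq] at h1
  omega

theorem zReg_le_of_mem {I : Inst} {m s r n z : ℕ} (h : z ∈ block (I.zReg m s r) n) :
    I.zReg m s 0 ≤ z := by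
  rw [mem_block] at h
  rw [zReg] at h ⊢
  omega

theorem xReg_add_lt {I : Inst} {m s r t : ℕ} (hr : r < I.regs) (ht : t < I.width m) :
    I.xReg m s r + t < I.zReg m s 0 := by
  have := stride_lt hr ht
  rw [xReg, zReg]
  omega

theorem anc_lt_xReg (I : Inst) (m s r : ℕ) : I.anc s + 1 < I.xReg m s r := by rw [xReg]; omega

theorem mem_constBlock {I : Inst} {s v len z : ℕ} (h : z ∈ I.constBlock s v len) :
    z = I.anc s ∨ z = I.anc s + 1 := by
  obtain ⟨t, -, rfl⟩ := List.mem_map.1 h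
  split_ifs <;> simp

theorem mem_polyBlock {I : Inst} {m s z : ℕ} (h : z ∈ I.polyBlock m s) :
    z = I.anc s ∨ z = I.anc s + 1 := by
  obtain ⟨t, -, rfl⟩ := List.mem_map.1 h
  split_ifs <;> simp

/-! ### The memory before and after the query -/

/-- The memory holds `A`, `B`, the ancillas, arbitrary contents of the Fourier registers, and is `0`
elsewhere. -/
structure Ready (I : Inst) (m s : ℕ) (A B : I.Mat) (c : Config) : Prop where
  input : ∀ z < 2 * I.matBits, c z = I.input₂ A B z
  clean : ∀ z, 2 * I.matBits ≤ z → z ≤ I.anc s → c z = false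
  one : c (I.anc s + 1) = true
  pad : ∀ r < I.regs, ∀ t, m ≤ t → t < I.width m → c (I.xReg m s r + t) = false
  work : ∀ z, I.zReg m s 0 ≤ z → c z = false

theorem testBit_eq (v t : ℕ) : v.testBit t = decide (v / 2 ^ t % 2 = 1) :=
  Nat.testBit_eq_decide_div_mod_eq

/-- Constants enter an arithmetic gate through its source list: it may repeat addresses, so one
qubit holding 0 and one holding 1 suffice to spell any number. -/
theorem value_const {c : Config} {a v len : ℕ} (h0 : c a = false) (h1 : c (a + 1) = true)
    (hv : v < 2 ^ len) :
    value c ((List.range len).map fun t => if v / 2 ^ t % 2 = 1 then a + 1 else a) = v := by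
  refine value_eq_of_testBit (by simpa using hv) fun t ht => ?_
  rw [testBit_eq, List.getElem_map, List.getElem_range]
  split_ifs with h <;> simp [h, h0, h1]

namespace Ready

variable {I : Inst} {m s : ℕ} {A B : I.Mat} {c : Config}

theorem value_constBlock (h : I.Ready m s A B c) {v len : ℕ} (hv : v < 2 ^ len) :
    value c (I.constBlock s v len) = v :=
  value_const (h.clean _ (by rw [anc]; omega) le_rfl) h.one hv

theorem value_char (h : I.Ready m s A B c) :
    value c (I.constBlock s I.char (I.digitBits + 1)) = I.char :=
  h.value_constBlock (by have := I.char_le; have := Nat.two_pow_pos I.digitBits; omega)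

theorem value_polyBlock {b : ℕ} (hI : I.Admissible b) (h : I.Ready m s A B c) :
    value c (I.polyBlock m s) =
      ∑ u ∈ Finset.range I.deg, I.fcoef (I.deg - u) * (2 ^ I.width m) ^ u := by
  rw [polyBlock, value_map_range_mul]
  refine Finset.sum_congr rfl fun u _ => ?_
  rw [← pow_mul]
  congr 1
  have hw : 0 < I.width m := by rw [width]; omega
  have e : ((List.range (I.width m)).map fun t =>
      if I.fcoef (I.deg - (u * I.width m + t) / I.width m) /
        2 ^ ((u * I.width m + t) % I.width m) % 2 = 1 then I.anc s + 1 else I.anc s) =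
      (List.range (I.width m)).map fun t =>
        if I.fcoef (I.deg - u) / 2 ^ t % 2 = 1 then I.anc s + 1 else I.anc s := by
    refine List.map_congr_left fun t ht => ?_
    have ht := List.mem_range.1 ht
    rw [mul_comm u, Nat.mul_add_div hw, Nat.mul_add_mod, Nat.div_eq_of_lt ht, Nat.mod_eq_of_lt ht,
      add_zero]
  rw [e]
  refine value_const (h.clean _ (by rw [anc]; omega) le_rfl) h.one
    ((hI.fcoef_lt_two_pow _).trans_le (Nat.pow_le_pow_right (by norm_num) ?_))
  rw [width]; omega

theorem value_xReg (h : I.Ready m s A B c) {r : ℕ} (hr : r < I.regs) :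
    value c (block (I.xReg m s r) (I.width m)) = value c (block (I.xReg m s r) m) := by
  have hlt := value_lt c (block (I.xReg m s r) m)
  refine value_eq_of_testBit (hlt.trans_le (Nat.pow_le_pow_right (by norm_num) ?_))
    fun t ht => ?_
  · rw [length_block, length_block]; exact I.le_width m
  · rw [length_block] at ht
    rw [getElem_block]
    by_cases htm : t < m
    · rw [testBit_value_block htm]
    · rw [testBit_value, dif_neg (by rwa [length_block]), h.pad r hr t (by omega) ht]

theorem value_xReg_entry (h : I.Ready m s A B c) {e : ℕ} (he : e < I.size * I.size) :
    value c (block (I.xReg m s (e * I.deg)) (I.deg * I.width m)) =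
      ∑ i ∈ Finset.range I.deg,
        value c (block (I.xReg m s (e * I.deg + i)) m) * (2 ^ I.width m) ^ i := by
  rw [block, value_map_range_mul]
  refine Finset.sum_congr rfl fun i hi => ?_
  rw [← h.value_xReg (stride_lt he (Finset.mem_range.1 hi)), ← pow_mul]
  congr 3
  funext t
  rw [xReg, xReg, add_mul]
  omega

/-- The digits of the convolutions. -/
def conv (I : Inst) (m s : ℕ) (c : Config) (e j : ℕ) : ℕ :=
  ∑ i ∈ Finset.range I.deg,
    value c (block (I.xReg m s (e * I.deg + i)) m) * I.fcoef (I.deg + i - j)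

/-- The reason for the choice of `width`: `deg` products of an `m`-bit and a `digitBits`-bit number
are added, and `deg + 1` further bits absorb the factor `deg`. Hence the Kronecker product has no
carries. -/
theorem conv_lt {b : ℕ} (hI : I.Admissible b) (e j : ℕ) : conv I m s c e j < 2 ^ I.width m := by
  have h1 : conv I m s c e j ≤ ∑ i ∈ Finset.range I.deg, 2 ^ m * 2 ^ I.digitBits := by
    refine Finset.sum_le_sum fun i _ => ?_
    have h2 := value_lt c (block (I.xReg m s (e * I.deg + i)) m)
    rw [length_block] at h2
    exact Nat.mul_le_mul h2.le (hI.fcoef_lt_two_pow _).le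
  rw [Finset.sum_const, Finset.card_range, smul_eq_mul] at h1
  have h3 : I.deg < 2 ^ (I.deg + 1) :=
    Nat.lt_two_pow_self.trans (Nat.pow_lt_pow_right (by norm_num) (by omega))
  calc _ ≤ I.deg * (2 ^ m * 2 ^ I.digitBits) := h1
    _ < 2 ^ (I.deg + 1) * (2 ^ m * 2 ^ I.digitBits) := by gcongr
    _ = 2 ^ I.width m := by
      rw [← pow_add, ← pow_add, width]; congr 1; ring

/-- Only addresses below `s` matter, since the query circuit sees nothing else; the ancillas and
registers lie above. -/
theorem run_prep {b : ℕ} (hI : I.Admissible b) (h : I.Ready m s A B c) :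
    ∃ c' : Config, run (I.prep m s) (Finsupp.single c 1) = Finsupp.single c' 1 ∧
      ∀ z < s, c' z = I.input₃ A B (Matrix.of fun i j : Fin I.size => I.assemble fun l =>
        value c (block (I.xReg m s ((i * I.size + j) * I.deg + l)) m)) z := by
  obtain ⟨c1, h1, h2, h3⟩ := run_arith_batch .mul
    (fun e => block (I.xReg m s (e * I.deg)) (I.deg * I.width m)) (fun _ => I.polyBlock m s)
    (fun e => block (I.zReg m s (e * I.deg)) (I.deg * I.width m)) (I.size * I.size)
    (by
      intro e he e' he' z hz
      have hz' := zReg_le_of_mem hz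
      constructor
      · intro hx
        rw [mem_block] at hx
        have := stride_lt he' (show I.deg * I.width m - 1 < I.deg * I.width m by omega)
        rw [xReg, mul_assoc] at hx
        rw [zReg, regs, mul_assoc] at hz'
        omega
      · intro hp
        have := anc_lt_xReg I m s 0
        have := mem_polyBlock hp
        rw [zReg] at hz'
        omega)
    (by
      intro e he e' he' z hz hz'
      rw [zReg, mul_assoc] at hz hz'
      exact stride_inj le_rfl le_rfl hz hz')
    (fun e _ => nodup_block _ _) c
  obtain ⟨c2, h4, h5, h6⟩ := run_arith_batch .mod
    (fun r => block (I.zReg m s (r / I.deg * I.deg + (I.deg - 1 - r % I.deg))) (I.width m))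
    (fun _ => I.constBlock s I.char (I.digitBits + 1)) (fun r => block (I.cReg r) I.digitBits)
    I.regs
    (by
      intro r hr r' hr' z hz
      have hz' := lt_of_mem_cReg hr hz
      constructor
      · intro hx
        have := zReg_le_of_mem hx
        rw [zReg, anc] at this
        omega
      · intro hp
        have := mem_constBlock hp
        rw [anc] at this
        omega)
    (fun r hr r' hr' z hz hz' => stride_inj le_rfl le_rfl hz hz')
    (fun e _ => nodup_block _ _) c1
  refine ⟨c2, by rw [prep, run_append, mulGates, h1, modGates, h4], ?_⟩
  have low : ∀ z, z < I.zReg m s 0 → c1 z = c z := fun z hz =>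
    h2 z fun e _ hz' => absurd (zReg_le_of_mem hz') (by omega)
  have hanc : I.anc s + 1 < I.zReg m s 0 := by rw [zReg]; omega
  have hchar : value c1 (I.constBlock s I.char (I.digitBits + 1)) = I.char := by
    refine (value_congr fun z hz => low z ?_).trans h.value_char
    have := mem_constBlock hz
    omega
  have hconv : ∀ e < I.size * I.size, ∀ j < I.deg,
      value c1 (block (I.zReg m s (e * I.deg + j)) (I.width m)) = conv I m s c e j := by
    intro e he j hj
    have hd := digit_mul (B := 2 ^ I.width m) (k := I.deg)
      (x := fun i => value c (block (I.xReg m s (e * I.deg + i)) m)) (f := I.fcoef)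
      (fun u hu => fcoef_of_lt hu) hj (fun j _ => conv_lt hI e j)
    rw [← h.value_xReg_entry he, ← h.value_polyBlock hI] at hd
    refine value_eq_of_testBit ?_ fun t ht => ?_
    · rw [length_block]; exact conv_lt hI e j
    · rw [length_block] at ht
      have hjt : j * I.width m + t < I.deg * I.width m := stride_lt hj ht
      -- The work register was clean, so it now holds the product truncated to `deg` digits, which
      -- are exactly the digits described by `digit_mul`.
      have h7 := h3 e he (j * I.width m + t) (by rw [length_block]; exact hjt)
      rw [getElem_block] at h7
      rw [getElem_block, show I.zReg m s (e * I.deg + j) + t =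
        I.zReg m s (e * I.deg) + (j * I.width m + t) by rw [zReg, zReg]; ring, h7,
        h.work _ (by rw [zReg, zReg]; omega), Bool.false_xor, ArithOp.eval, conv, ← hd, ← pow_mul,
        Nat.testBit_mod_two_pow, Nat.testBit_div_two_pow, decide_eq_true ht, Bool.true_and,
        mul_comm j, add_comm t]
  intro z hz
  by_cases hz2 : z < 2 * I.matBits
  · rw [input₃_eq_input₂ hz2, h5, low, h.input z hz2]
    · rw [zReg, anc]; omega
    · intro r hr hz'
      have := lt_of_mem_cReg hr hz'
      omega
  by_cases hz3 : 3 * I.matBits ≤ z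
  · rw [input₃_eq_false hz3, h5, low, h.clean z (by omega) (by rw [anc]; omega)]
    · rw [zReg, anc]; omega
    · intro r hr hz'
      have := lt_of_mem_cReg hr hz'
      omega
  refine HoldsMat.eqOn (fun i j t ht => ?_) (I.holdsMat_input₃ A B _) (by omega) (by omega)
  have hb := hI.digitBits_pos
  have hl : t / I.digitBits < I.deg := (Nat.div_lt_iff_lt_mul hb).2 ht
  have he : (i : ℕ) * I.size + j < I.size * I.size := stride_lt i.2 j.2
  have htm := Nat.mod_lt t hb
  have hk := hI.deg_pos
  obtain ⟨l, hl_def⟩ : ∃ l, l = t / I.digitBits := ⟨_, rfl⟩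
  rw [← hl_def] at hl
  have hkl : I.deg - 1 - l < I.deg := by clear hl_def; omega
  have h7 := h6 ((i * I.size + j) * I.deg + l) (stride_lt he hl) (t % I.digitBits)
    (by rw [length_block]; exact htm)
  rw [getElem_block, hchar, mul_comm _ I.deg, Nat.mul_add_div hk, Nat.mul_add_mod,
    Nat.div_eq_of_lt hl, Nat.mod_eq_of_lt hl, add_zero, mul_comm I.deg,
    hconv _ he _ hkl] at h7
  have hcr : I.cReg ((i * I.size + j) * I.deg + l) + t % I.digitBits =
      I.entryAddr (2 * I.matBits) i j + t := by
    rw [cReg, entryAddr, fieldBits, add_mul, add_assoc, add_assoc, hl_def,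
      Nat.div_add_mod', mul_assoc]
    omega
  have := hI.nontrivial
  have hle : 2 * I.matBits ≤ I.entryAddr (2 * I.matBits) i j + t := by rw [entryAddr]; omega
  have hlt : I.entryAddr (2 * I.matBits) i j + t < 3 * I.matBits := by
    have := stride_lt he ht
    rw [entryAddr, show 3 * I.matBits = 2 * I.matBits + I.size * I.size * I.fieldBits by
      rw [matBits]; ring]
    omega
  rw [hcr] at h7
  rw [h7, low _ (by rw [zReg, anc]; omega), h.clean _ hle (by rw [anc]; omega), Bool.false_xor, bit,
    ← hl_def, Matrix.of_apply, coord_assemble _ hl, ArithOp.eval, conv]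
  congr 2
  refine Finset.sum_congr rfl fun x _ => ?_
  -- Digit `deg - 1 - l` of the convolution is the sum that defines coefficient `l` of `assemble`:
  -- the reversed reading order in `modGates` compensates the reversed order in `polyBlock`.
  rw [show I.deg + x - (I.deg - 1 - l) = x + 1 + l by clear hl_def; omega]

end Ready

end Inst

/-! ### The phase produced by the query and the reading of the result -/

namespace Inst

theorem div_div_lt {I : Inst} {r : ℕ} (hr : r < I.regs) : r / I.deg / I.size < I.size := by
  have hk : 0 < I.deg := Nat.pos_of_ne_zero fun e => by simp [regs, e] at hr
  have hn : 0 < I.size := Nat.pos_of_ne_zero fun e => by simp [regs, e] at hr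
  rw [Nat.div_lt_iff_lt_mul hn, Nat.div_lt_iff_lt_mul hk]
  exact hr

theorem div_mod_lt {I : Inst} {r : ℕ} (hr : r < I.regs) : r / I.deg % I.size < I.size :=
  Nat.mod_lt _ (Nat.pos_of_ne_zero fun e => by simp [regs, e] at hr)

/-- The coefficients of the entries of the transposed matrix, one for each register. -/
def target (I : Inst) (M : I.Mat) (r : ℕ) : ℕ :=
  if h : r < I.regs then
    I.coord (M ⟨r / I.deg % I.size, div_mod_lt h⟩ ⟨r / I.deg / I.size, div_div_lt h⟩) (r % I.deg)
  else 0

theorem target_mk {I : Inst} (M : I.Mat) {i j : Fin I.size} {l : ℕ} (hl : l < I.deg) :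
    I.target M ((i * I.size + j) * I.deg + l) = I.coord (M j i) l := by
  have hk : 0 < I.deg := by omega
  have hn : 0 < I.size := i.pos
  have h1 : ((i * I.size + j) * I.deg + l) / I.deg = i * I.size + j := by
    rw [mul_comm _ I.deg, Nat.mul_add_div hk, Nat.div_eq_of_lt hl, add_zero]
  have h2 : ((i * I.size + j) * I.deg + l) % I.deg = l := by
    rw [mul_comm _ I.deg, Nat.mul_add_mod, Nat.mod_eq_of_lt hl]
  have h3 : (i * I.size + j) / I.size = i := by
    rw [mul_comm _ I.size, Nat.mul_add_div hn, Nat.div_eq_of_lt j.2, add_zero]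
  have h4 : (i * I.size + j) % I.size = j := by
    rw [mul_comm _ I.size, Nat.mul_add_mod, Nat.mod_eq_of_lt j.2]
  have hlt : (i * I.size + j) * I.deg + l < I.regs := stride_lt (stride_lt i.2 j.2) hl
  rw [target, dif_pos hlt]
  simp only [h1, h2, h3, h4]

theorem Admissible.target_lt {b : ℕ} {I : Inst} (hI : I.Admissible b) (M : I.Mat) {r : ℕ}
    (hr : r < I.regs) : I.target M r < I.char := by
  rw [target, dif_pos hr]
  exact hI.coord_lt _ _

theorem prod_regs {R : Type*} [CommMonoid R] (I : Inst) (F : ℕ → R) :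
    ∏ r : Fin I.regs, F r =
      ∏ i : Fin I.size, ∏ j : Fin I.size, ∏ l : Fin I.deg, F ((i * I.size + j) * I.deg + l) := by
  have h1 : ∀ (a b : ℕ) (G : ℕ → R), ∏ r : Fin (a * b), G r =
      ∏ e : Fin a, ∏ l : Fin b, G (e * b + l) := fun a b G => by
    rw [← Fintype.prod_prod_type']
    refine (Fintype.prod_equiv finProdFinEquiv _ _ fun x => ?_).symm
    rw [finProdFinEquiv_apply_val]
    congr 1
    ring
  rw [regs, h1, h1 _ _ fun e => ∏ l : Fin I.deg, F (e * I.deg + l)]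

namespace Ready

variable {I : Inst} {m s : ℕ} {A B : I.Mat} {c : Config}

/-- The query multiplies each content of the Fourier registers by a phase that is linear in the
entries of the product. -/
theorem run_query {b : ℕ} (hI : I.Admissible b) (h : I.Ready m s A B c) {O : Circuit}
    (hO : UsesBelow s O) (hphase : I.IsPhaseOracle O) :
    run (I.prep m s ++ O ++ inverse (I.prep m s)) (Finsupp.single c 1) =
      Finsupp.single c (∏ r : Fin I.regs,
        cis ((value c (block (I.xReg m s r) m) : ℝ) * I.target (A * B) r / I.char)) := by
  obtain ⟨c', h1, h2⟩ := h.run_prep hI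
  set C : I.Mat := Matrix.of fun i j : Fin I.size => I.assemble fun l =>
    value c (block (I.xReg m s ((i * I.size + j) * I.deg + l)) m) with hC
  -- The oracle is specified only on clean inputs. The present memory agrees with such an input
  -- below `s`, and the oracle cannot see the rest.
  have h3 := hO.run_single_of_eqOn (hphase A B C) h2
  rw [run_append, run_append, h1, h3, run_single, ← h1, run_inverse_run, Finsupp.smul_single,
    smul_eq_mul, mul_one]
  congr 1
  -- The entry (i, j) of C is paired with the entry (j, i) of the product, so the registers learn
  -- the transpose; `transposeIdx` corrects this on output.
  have e : matInner (A * B) C.transpose = ∑ p : Fin I.size × Fin I.size,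
      (A * B) p.2 p.1 * I.assemble fun l =>
        value c (block (I.xReg m s ((p.1 * I.size + p.2) * I.deg + l)) m) := by
    rw [matInner, Finset.sum_comm, ← Fintype.sum_prod_type']
    rfl
  rw [e, hI.phase_sum_mul_assemble, Fintype.prod_prod_type]
  rw [I.prod_regs fun r => cis ((value c (block (I.xReg m s r) m) : ℝ) *
    I.target (A * B) r / I.char)]
  refine Finset.prod_congr rfl fun i _ => Finset.prod_congr rfl fun j _ => ?_
  rw [Finset.prod_range]
  exact Finset.prod_congr rfl fun l _ => by rw [target_mk (A * B) l.2]

theorem _root_.QuantumMM.Inst.transposeIdx_eq {I : Inst} {i j : Fin I.size} {l : ℕ}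
    (hl : l < I.deg) :
    I.transposeIdx ((i * I.size + j) * I.deg + l) = (j * I.size + i) * I.deg + l := by
  have hk : 0 < I.deg := by omega
  have hn : 0 < I.size := i.pos
  rw [transposeIdx, mul_comm (i * I.size + j : ℕ), Nat.mul_add_div hk, Nat.mul_add_mod,
    Nat.div_eq_of_lt hl, Nat.mod_eq_of_lt hl, add_zero, mul_comm (i : ℕ), Nat.mul_add_div hn,
    Nat.mul_add_mod, Nat.div_eq_of_lt j.2, Nat.mod_eq_of_lt j.2, add_zero]

theorem _root_.QuantumMM.Inst.exists_idx {I : Inst} {r : ℕ} (hr : r < I.regs) :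
    ∃ (i j : Fin I.size) (l : ℕ), l < I.deg ∧ r = (i * I.size + j) * I.deg + l := by
  have hk : 0 < I.deg := Nat.pos_of_ne_zero fun e => by simp [regs, e] at hr
  refine ⟨⟨r / I.deg / I.size, div_div_lt hr⟩, ⟨r / I.deg % I.size, div_mod_lt hr⟩, r % I.deg,
    Nat.mod_lt _ hk, ?_⟩
  dsimp only
  rw [Nat.div_add_mod', Nat.div_add_mod']

theorem _root_.QuantumMM.Inst.transposeIdx_lt {I : Inst} {r : ℕ} (hr : r < I.regs) :
    I.transposeIdx r < I.regs := by
  obtain ⟨i, j, l, hl, rfl⟩ := exists_idx hr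
  rw [transposeIdx_eq hl]
  exact stride_lt (stride_lt j.2 i.2) hl

theorem _root_.QuantumMM.Inst.transposeIdx_transposeIdx {I : Inst} {r : ℕ} (hr : r < I.regs) :
    I.transposeIdx (I.transposeIdx r) = r := by
  obtain ⟨i, j, l, hl, rfl⟩ := exists_idx hr
  rw [transposeIdx_eq hl, transposeIdx_eq hl]

/-- Dividing by 2^m is a matter of placement: the low `m` bits of y · p go to a work register and
the following bits to the output. The Fourier registers are unchanged, which later keeps different
readings distinct. -/
theorem run_outGates {b : ℕ} (hI : I.Admissible b) (h : I.Ready m s A B c) :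
    ∃ c' : Config, run (I.outGates m s) (Finsupp.single c 1) = Finsupp.single c' 1 ∧
      (∀ r < I.regs, ∀ t < m, c' (I.xReg m s r + t) = c (I.xReg m s r + t)) ∧
      ∀ M : I.Mat, (∀ r : Fin I.regs,
          value c (block (I.xReg m s r) m).reverse * I.char / 2 ^ m = I.target M r) →
        I.HoldsMat (2 * I.matBits) M c' := by
  have hz : ∀ r, ∀ z ∈ block (I.zReg m s r) m, I.zReg m s 0 ≤ z := fun r z => zReg_le_of_mem
  have hzanc : 3 * I.matBits + 1 < I.zReg m s 0 := by rw [zReg, anc]; omega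
  have hanc : I.anc s + 1 < I.zReg m s 0 := by rw [zReg]; omega
  obtain ⟨c', h1, h2, h3⟩ := run_arith_batch .mul
    (fun r => (block (I.xReg m s r) m).reverse)
    (fun _ => I.constBlock s I.char (I.digitBits + 1))
    (fun r => block (I.zReg m s r) m ++ block (I.cReg (I.transposeIdx r)) I.digitBits) I.regs
    (by
      intro r hr r' hr' z hzz
      have hx : ∀ z ∈ (block (I.xReg m s r') m).reverse,
          I.anc s + 1 < z ∧ z < I.zReg m s 0 := fun z hx => by
        rw [List.mem_reverse, mem_block] at hx
        have h4 := anc_lt_xReg I m s r'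
        have h5 := xReg_add_lt (m := m) (s := s) hr' (t := z - I.xReg m s r')
          (by have := I.le_width m; omega)
        omega
      rcases List.mem_append.1 hzz with hzz | hzz
      · have := hz r z hzz
        exact ⟨fun hx' => by have := hx z hx'; omega,
          fun hc => by have := mem_constBlock hc; omega⟩
      · have := lt_of_mem_cReg (transposeIdx_lt hr) hzz
        have h6 : 3 * I.matBits ≤ I.anc s := by rw [anc]; omega
        exact ⟨fun hx' => by have := hx z hx'; omega,
          fun hc => by have := mem_constBlock hc; omega⟩)
    (by
      intro r hr r' hr' z hzz hzz'
      rcases List.mem_append.1 hzz with h4 | h4 <;> rcases List.mem_append.1 hzz' with h5 | h5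
      · rw [zReg] at h4 h5
        exact stride_inj (I.le_width m) (I.le_width m) h4 h5
      · have := hz _ _ h4
        have := lt_of_mem_cReg (transposeIdx_lt hr') h5
        omega
      · have := hz _ _ h5
        have := lt_of_mem_cReg (transposeIdx_lt hr) h4
        omega
      · rw [cReg] at h4 h5
        -- Transposition of indices is an involution, so different registers write to different
        -- output blocks.
        rw [← transposeIdx_transposeIdx hr, stride_inj le_rfl le_rfl h4 h5,
          transposeIdx_transposeIdx hr'])
    (fun r hr => (nodup_block _ _).append (nodup_block _ _) fun z h4 h5 => by
      have := hz _ _ h4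
      have := lt_of_mem_cReg (transposeIdx_lt hr) h5
      omega) c
  refine ⟨c', h1, fun r hr t ht => h2 _ fun r' hr' hzz => ?_, fun M hM i j t ht => ?_⟩
  · have h4 := xReg_add_lt (m := m) (s := s) hr (ht.trans_le (I.le_width m))
    rcases List.mem_append.1 hzz with hzz | hzz
    · have := hz _ _ hzz
      omega
    · have := lt_of_mem_cReg (transposeIdx_lt hr') hzz
      have := anc_lt_xReg I m s r
      have h6 : 3 * I.matBits ≤ I.anc s := by rw [anc]; omega
      omega
  · have hb := hI.digitBits_pos
    have hl : t / I.digitBits < I.deg := (Nat.div_lt_iff_lt_mul hb).2 ht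
    have htm := Nat.mod_lt t hb
    have hr : (j * I.size + i) * I.deg + t / I.digitBits < I.regs :=
      stride_lt (stride_lt j.2 i.2) hl
    -- The offset `m` skips the discarded low bits. The register consulted is the transposed one,
    -- (j, i).
    have h7 := h3 _ hr (m + t % I.digitBits)
      (by rw [List.length_append, length_block, length_block]; omega)
    have hM' := hM ⟨_, hr⟩
    rw [target_mk M hl] at hM'
    rw [List.getElem_append_right (by rw [length_block]; omega), getElem_block, length_block,
      Nat.add_sub_cancel_left, transposeIdx_eq hl, h.value_char, ArithOp.eval, add_comm m,
      ← Nat.testBit_div_two_pow, hM'] at h7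
    have hcr : I.cReg ((i * I.size + j) * I.deg + t / I.digitBits) + t % I.digitBits =
        I.entryAddr (2 * I.matBits) i j + t := by
      rw [cReg, entryAddr, fieldBits, add_mul, add_assoc, add_assoc, Nat.div_add_mod', mul_assoc, add_assoc]
    have hlt : I.entryAddr (2 * I.matBits) i j + t < 3 * I.matBits := by
      have := stride_lt (stride_lt i.2 j.2) ht
      rw [entryAddr, show 3 * I.matBits = 2 * I.matBits + I.size * I.size * I.fieldBits by
        rw [matBits]; ring]
      omega
    rw [hcr, h.clean _ (by rw [entryAddr]; omega) (by rw [anc]; omega), Bool.false_xor] at h7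
    rw [h7, bit]

end Ready

end Inst

/-! ### Success probability -/

/-- Distinct basis vectors do not interfere, so the probabilities of the listed outcomes simply add
up. -/
theorem le_prob_sum {ι : Type*} [Fintype ι] {κ : ι → Config} (hκ : Function.Injective κ)
    (a : ι → ℂ) {E : Config → Prop} {P : ι → Prop} [DecidablePred P] (h : ∀ g, P g → E (κ g)) :
    (∑ g, if P g then ‖a g‖ ^ 2 else 0) ≤ prob (∑ g, Finsupp.single (κ g) (a g)) E := by
  classical
  set ψ : State := ∑ g, Finsupp.single (κ g) (a g)
  have h1 : ∀ g, ψ (κ g) = a g := fun g => by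
    simp only [ψ, Finsupp.finsetSum_apply, Finsupp.single_apply, hκ.eq_iff]
    simp
  have h2 : ψ.support ⊆ Finset.univ.image κ := fun c hc => by
    rw [Finsupp.mem_support_iff] at hc
    simp only [ψ, Finsupp.finsetSum_apply, Finsupp.single_apply] at hc
    obtain ⟨g, -, hg⟩ := Finset.exists_ne_zero_of_sum_ne_zero hc
    exact Finset.mem_image.2 ⟨g, Finset.mem_univ g, by by_contra h; simp [h] at hg⟩
  rw [prob, Finset.sum_subset h2 fun c _ hc => by simp [Finsupp.notMem_support_iff.1 hc],
    Finset.sum_image fun g _ g' _ e => hκ e]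
  refine Finset.sum_le_sum fun g _ => ?_
  rw [h1]
  by_cases hP : P g
  · rw [if_pos hP, if_pos (h g hP)]
  · rw [if_neg hP]
    split_ifs <;> positivity

namespace Inst

/-- The address of a qubit of a Fourier register. -/
def xAddr (I : Inst) (m s : ℕ) (i : Fin I.regs × Fin m) : ℕ := I.xReg m s i.1 + i.2

theorem xAddr_injective (I : Inst) (m s : ℕ) : Function.Injective (I.xAddr m s) := by
  rintro ⟨r, t⟩ ⟨r', t'⟩ h
  simp only [xAddr] at h
  have h1 : (r : ℕ) = r' := stride_inj (a := I.anc s + 2) (z := I.xReg m s r + t)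
    (I.le_width m) (I.le_width m) (mem_block.2 ⟨by rw [xReg]; omega, by rw [xReg]; omega⟩)
    (mem_block.2 ⟨by rw [h, xReg]; omega, by rw [h, xReg]; omega⟩)
  have h2 : r = r' := Fin.ext h1
  subst h2
  have : (t : ℕ) = t' := by omega
  rw [Fin.ext this]

theorem range_xAddr (I : Inst) (m s : ℕ) :
    Set.range (I.xAddr m s) = {z | ∃ r < I.regs, z ∈ block (I.xReg m s r) m} := by
  ext z
  simp only [Set.mem_range, Prod.exists, Set.mem_ofPred_eq, mem_block, xAddr]
  constructor
  · rintro ⟨r, t, rfl⟩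
    exact ⟨r, r.2, by omega, by omega⟩
  · rintro ⟨r, hr, h1, h2⟩
    exact ⟨⟨r, hr⟩, ⟨z - I.xReg m s r, by omega⟩, by dsimp only; omega⟩

theorem nodup_xQubits (I : Inst) (m s : ℕ) : (I.xQubits m s).Nodup := by
  rw [xQubits, List.nodup_flatMap]
  refine ⟨fun r _ => nodup_block _ _, List.nodup_range.imp ?_⟩
  intro r r' hne z h h'
  exact hne (stride_inj (I.le_width m) (I.le_width m) h h')

theorem mem_xQubits {I : Inst} {m s z : ℕ} :
    z ∈ I.xQubits m s ↔ ∃ r < I.regs, z ∈ block (I.xReg m s r) m := by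
  simp [xQubits]

theorem length_xQubits (I : Inst) (m s : ℕ) : (I.xQubits m s).length = I.regs * m := by
  simp [xQubits, List.length_flatMap, length_block]

/-- The initial memory with given contents of the Fourier registers. -/
def initial (I : Inst) (m s : ℕ) (A B : I.Mat) (f : Fin I.regs × Fin m → Bool) : Config :=
  Function.extend (I.xAddr m s) f (Function.update (I.input₂ A B) (I.anc s + 1) true)

theorem initial_xReg {I : Inst} {m s : ℕ} {A B : I.Mat} {f : Fin I.regs × Fin m → Bool}
    (r : Fin I.regs) {t : ℕ} (ht : t < m) :
    I.initial m s A B f (I.xReg m s r + t) = f (r, ⟨t, ht⟩) :=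
  (I.xAddr_injective m s).extend_apply f _ (r, ⟨t, ht⟩)

theorem initial_of_ne {I : Inst} {m s : ℕ} {A B : I.Mat} {f : Fin I.regs × Fin m → Bool} {z : ℕ}
    (hz : ∀ r < I.regs, z ∉ block (I.xReg m s r) m) :
    I.initial m s A B f z = Function.update (I.input₂ A B) (I.anc s + 1) true z := by
  refine Function.extend_apply' _ _ _ ?_
  rintro ⟨⟨r, t⟩, rfl⟩
  exact hz r r.2 (mem_block.2 ⟨Nat.le_add_right _ _, by rw [xAddr]; exact Nat.add_lt_add_left t.2 _⟩)

theorem value_initial {I : Inst} {m s : ℕ} {A B : I.Mat} (f : Fin I.regs × Fin m → Bool)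
    (r : Fin I.regs) :
    value (I.initial m s A B f) (block (I.xReg m s r) m) = Nat.ofBits fun t => f (r, t) := by
  refine value_eq_of_testBit ?_ fun t ht => ?_
  · rw [length_block]; exact Nat.ofBits_lt_two_pow _
  · rw [length_block] at ht
    rw [getElem_block, initial_xReg r ht, Nat.testBit_ofBits_lt _ _ ht]

theorem value_initial_reverse {I : Inst} {m s : ℕ} {A B : I.Mat} (f : Fin I.regs × Fin m → Bool)
    (r : Fin I.regs) : value (I.initial m s A B f) (block (I.xReg m s r) m).reverse =
      Nat.ofBits fun t => f (r, t.rev) := by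
  refine value_eq_of_testBit ?_ fun t ht => ?_
  · rw [List.length_reverse, length_block]; exact Nat.ofBits_lt_two_pow _
  · rw [List.length_reverse, length_block] at ht
    rw [List.getElem_reverse, getElem_block, length_block, initial_xReg r (by omega),
      Nat.testBit_ofBits_lt _ _ ht]
    congr 2
    ext
    simp only [Fin.val_rev]
    omega

theorem ready_initial (I : Inst) (m s : ℕ) (A B : I.Mat) (f : Fin I.regs × Fin m → Bool) :
    I.Ready m s A B (I.initial m s A B f) := by
  have low : ∀ z, z ≤ I.anc s + 1 → ∀ r < I.regs, z ∉ block (I.xReg m s r) m :=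
    fun z hz r _ h => by
      have := anc_lt_xReg I m s r
      rw [mem_block] at h
      omega
  have h3 : 3 * I.matBits ≤ I.anc s := by rw [anc]; omega
  refine ⟨fun z hz => ?_, fun z hz hz' => ?_, ?_, fun r hr t ht ht' => ?_, fun z hz => ?_⟩
  · rw [initial_of_ne (low z (by omega)), Function.update_of_ne (by omega)]
  · rw [initial_of_ne (low z (by omega)), Function.update_of_ne (by omega), input₂_eq_false hz]
  · rw [initial_of_ne (low _ le_rfl), Function.update_self]
  · have := anc_lt_xReg I m s r
    rw [initial_of_ne, Function.update_of_ne (by omega), input₂_eq_false (by omega)]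
    intro r' hr' h
    have e : r = r' := stride_inj (a := I.anc s + 2) (z := I.xReg m s r + t) le_rfl (I.le_width m)
      (mem_block.2 ⟨by rw [xReg]; omega, by rw [xReg]; omega⟩) h
    rw [← e, mem_block] at h
    omega
  · have h4 : I.anc s + 1 < I.zReg m s 0 := by rw [zReg]; omega
    rw [initial_of_ne, Function.update_of_ne (by omega), input₂_eq_false (by omega)]
    intro r hr h
    rw [mem_block] at h
    have := xReg_add_lt (m := m) (s := s) hr (t := z - I.xReg m s r)
      (by have := I.le_width m; omega)
    omega

theorem extend_extend {ι : Type*} {addr : ι → ℕ} (h : Function.Injective addr) (f g : ι → Bool)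
    (c : Config) :
    Function.extend addr g (Function.extend addr f c) = Function.extend addr g c := by
  funext z
  by_cases hz : ∃ i, addr i = z
  · obtain ⟨i, rfl⟩ := hz
    rw [h.extend_apply, h.extend_apply]
  · rw [Function.extend_apply' _ _ _ hz, Function.extend_apply' _ _ _ hz,
      Function.extend_apply' _ _ _ hz]

theorem run_hadamards (I : Inst) (m s : ℕ) (A B : I.Mat) :
    run ([.flip (I.anc s + 1)] ++ (I.xQubits m s).map .had) (Finsupp.single (I.input₂ A B) 1) =
      ∑ f : Fin I.regs × Fin m → Bool, Finsupp.single (I.initial m s A B f)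
        (((1 / Real.sqrt 2 : ℝ) : ℂ) ^ (I.regs * m)) := by
  set c := Function.update (I.input₂ A B) (I.anc s + 1) true with hc
  have h3 : 3 * I.matBits ≤ I.anc s := by rw [anc]; omega
  have h1 : run [.flip (I.anc s + 1)] (Finsupp.single (I.input₂ A B) 1) = Finsupp.single c 1 := by
    rw [run_cons, run_nil, Gate.op_single, one_smul, Gate.onBasis, input₂_eq_false (by omega)]
    rfl
  have hS : {z | z ∈ I.xQubits m s} = Set.range (I.xAddr m s) := by
    rw [range_xAddr]; ext z; exact mem_xQubits
  rw [run_append, h1, (pathForm_map_had _ (I.nodup_xQubits m s)).run_eq_sum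
    (I.xAddr_injective m s) hS]
  refine Finset.sum_congr rfl fun f _ => ?_
  have h2 : ∀ z ∈ I.xQubits m s, c z = false := fun z hz => by
    obtain ⟨r, hr, hz⟩ := mem_xQubits.1 hz
    have := anc_lt_xReg I m s r
    rw [mem_block] at hz
    rw [hc, Function.update_of_ne (by omega), input₂_eq_false (by omega)]
  -- The registers hold 0 before the Hadamard gates, so no sign occurs.
  rw [List.prod_eq_one, mul_one, length_xQubits, initial]
  intro a ha
  obtain ⟨z, hz, rfl⟩ := List.mem_map.1 ha
  simp [h2 z hz]

theorem run_fourier (I : Inst) (m s : ℕ) (A B : I.Mat) (f : Fin I.regs × Fin m → Bool) :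
    run (I.fourier m s) (Finsupp.single (I.initial m s A B f) 1) =
      ∑ g : Fin I.regs × Fin m → Bool, Finsupp.single (I.initial m s A B g)
        (∏ r, (((1 / Real.sqrt 2 : ℝ) : ℂ) ^ m *
          cis ((Nat.ofBits fun t => f (r, t)) / (2 * I.char : ℕ) -
            (Nat.ofBits fun t => f (r, t)) * (Nat.ofBits fun t => g (r, t.rev)) / 2 ^ m))) := by
  rw [fourier, (pathForm_qft_registers (I.xReg m s) m (2 * I.char) I.regs
    (fun r _ r' _ z h h' => stride_inj (I.le_width m) (I.le_width m) h h')).run_eq_sum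
    (I.xAddr_injective m s) (I.range_xAddr m s).symm]
  refine Finset.sum_congr rfl fun g _ => ?_
  have e : Function.extend (I.xAddr m s) g (I.initial m s A B f) = I.initial m s A B g :=
    extend_extend (I.xAddr_injective m s) f g _
  rw [e, Finset.prod_range]
  simp only [value_initial, value_initial_reverse]

/-- One factor comes from the Hadamard gates and one from the Fourier transform; together they are
the normalisation in `estAmp`. -/
theorem inv_sqrt_two_pow (m : ℕ) : ((1 / Real.sqrt 2 : ℝ) : ℂ) ^ m *
    ((1 / Real.sqrt 2 : ℝ) : ℂ) ^ m = (((2 ^ m : ℕ) : ℂ))⁻¹ := by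
  rw [← mul_pow, sqrt_half_mul_self]
  push_cast
  rw [one_div, inv_pow]

/-- The state after the inverse Fourier transforms. -/
theorem Admissible.run_until_fourier {b : ℕ} {I : Inst} (hI : I.Admissible b) {m s : ℕ} {O : Circuit}
    (hO : UsesBelow s O) (hphase : I.IsPhaseOracle O) (A B : I.Mat) :
    run (I.before m s ++ O ++ (inverse (I.prep m s) ++ I.fourier m s))
        (Finsupp.single (I.input₂ A B) 1) =
      ∑ g : Fin I.regs × Fin m → Bool, Finsupp.single (I.initial m s A B g)
        (∏ r : Fin I.regs, estAmp (2 ^ m) ((I.target (A * B) r + 1 / 2) / I.char)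
          (Nat.ofBits fun t => g (r, t.rev))) := by
  have e : I.before m s ++ O ++ (inverse (I.prep m s) ++ I.fourier m s) =
      ([.flip (I.anc s + 1)] ++ (I.xQubits m s).map .had) ++
        ((I.prep m s ++ O ++ inverse (I.prep m s)) ++ I.fourier m s) := by
    simp [before]
  have hp : (I.char : ℝ) ≠ 0 := by exact_mod_cast hI.prime.ne_zero
  rw [e, run_append, run_hadamards, run_sum]
  have h1 : ∀ f : Fin I.regs × Fin m → Bool,
      run ((I.prep m s ++ O ++ inverse (I.prep m s)) ++ I.fourier m s)
        (Finsupp.single (I.initial m s A B f) (((1 / Real.sqrt 2 : ℝ) : ℂ) ^ (I.regs * m))) =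
      ∑ g : Fin I.regs × Fin m → Bool, Finsupp.single (I.initial m s A B g)
        (∏ r : Fin I.regs, ((((2 ^ m : ℕ) : ℂ))⁻¹ * cis ((Nat.ofBits fun t => f (r, t) : ℕ) *
          ((I.target (A * B) r + 1 / 2) / I.char -
            (Nat.ofBits fun t => g (r, t.rev) : ℕ) / (2 ^ m : ℕ))))) := fun f => by
    rw [run_append, run_single, (I.ready_initial m s A B f).run_query hI hO hphase,
      Finsupp.smul_single, run_single, run_fourier, Finset.smul_sum]
    refine Finset.sum_congr rfl fun g _ => ?_
    rw [Finsupp.smul_single, smul_eq_mul, smul_eq_mul, mul_comm I.regs, pow_mul,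
      ← Fin.prod_const I.regs, ← Finset.prod_mul_distrib, ← Finset.prod_mul_distrib]
    congr 1
    refine Finset.prod_congr rfl fun r _ => ?_
    -- The query contributes x s / p and the extra phases contribute x / (2p), which add up to the
    -- midpoint frequency (s + 1/2)/p.
    rw [value_initial, ← inv_sqrt_two_pow, mul_mul_mul_comm, ← cis_add]
    congr 2
    push_cast
    field_simp
    ring
  -- For a fixed output `g` all inputs `f` interfere; the sum over `f` factors into one geometric
  -- sum per register.
  rw [Finset.sum_congr rfl fun f _ => h1 f, Finset.sum_comm]
  refine Finset.sum_congr rfl fun g _ => ?_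
  rw [← Finsupp.single_finsetSum]
  congr 1
  rw [sum_registers I.regs m fun r x => (((2 ^ m : ℕ) : ℂ))⁻¹ * cis ((x : ℝ) *
      ((I.target (A * B) r + 1 / 2) / I.char - (Nat.ofBits fun t => g (r, t.rev) : ℕ) /
        (2 ^ m : ℕ)))]
  refine Finset.prod_congr rfl fun r _ => ?_
  rw [estAmp, Finset.mul_sum]

/-- One query to a phase oracle suffices to compute the product. -/
theorem Admissible.le_prob {b : ℕ} {I : Inst} (hI : I.Admissible b) {m s : ℕ}
    (hm : I.char ^ 2 ≤ 2 ^ m) {O : Circuit} (hO : UsesBelow s O) (hphase : I.IsPhaseOracle O)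
    (A B : I.Mat) :
    1 - (I.regs : ℝ) * ((I.char : ℝ) ^ 2 / 2 ^ m) ≤
      prob (run (I.before m s ++ O ++ I.after m s) (Finsupp.single (I.input₂ A B) 1))
        (I.HoldsMat (2 * I.matBits) (A * B)) := by
  choose κ h1 h2 h3 using fun g : Fin I.regs × Fin m → Bool =>
    (I.ready_initial m s A B g).run_outGates hI
  -- The reading can be recovered from the final memory, because the Fourier registers survive the
  -- output gates.
  have hκ : Function.Injective κ := fun g g' e => by
    funext ⟨r, t⟩
    rw [← initial_xReg (A := A) (B := B) (s := s) (f := g) r t.2, ← h2 g r r.2 t t.2, e,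
      h2 g' r r.2 t t.2, initial_xReg r t.2]
  have e : I.before m s ++ O ++ I.after m s =
      (I.before m s ++ O ++ (inverse (I.prep m s) ++ I.fourier m s)) ++ I.outGates m s := by
    simp [after]
  rw [e, run_append, hI.run_until_fourier hO hphase, run_sum,
    Finset.sum_congr rfl fun g _ => by rw [run_single, h1, Finsupp.smul_single, smul_eq_mul, mul_one]]
  refine (le_sum_registers (s := fun r : Fin I.regs => I.target (A * B) r)
    (fun r => hI.target_lt _ r.2) hm).trans
    (le_prob_sum hκ _ fun g hg => h3 g (A * B) fun r => ?_)
  rw [value_initial_reverse, hg r]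

end Inst

/-! ### Running time and choice of the precision -/

theorem cost_map_range_le {M B : ℕ} {f : ℕ → Gate} (h : ∀ r < M, (f r).cost ≤ B) :
    cost ((List.range M).map f) ≤ M * B := by
  rw [cost, List.map_map]
  refine (List.sum_le_card_nsmul _ B ?_).trans_eq (by simp)
  intro x hx
  obtain ⟨r, hr, rfl⟩ := List.mem_map.1 hx
  exact h r (List.mem_range.1 hr)

theorem cost_flatMap_le {L : List ℕ} {B : ℕ} {f : ℕ → Circuit} (h : ∀ r ∈ L, cost (f r) ≤ B) :
    cost (L.flatMap f) ≤ L.length * B := by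
  induction L with
  | nil => simp [cost]
  | cons r L ih =>
    rw [List.flatMap_cons, cost_append, List.length_cons, add_mul, one_mul, add_comm]
    exact add_le_add (ih fun r hr => h r (by simp [hr])) (h r (by simp))

theorem cost_phases_le (x m b : ℕ) : cost (phases x m b) ≤ m := by
  exact (cost_map_range_le (B := 1) fun _ _ => le_rfl).trans_eq (mul_one m)

theorem cost_qft_le (x m : ℕ) : cost (qft x m) ≤ m * m := by
  refine (cost_flatMap_le (B := m) fun j hj => ?_).trans_eq (by simp)
  have hj : j < m := by simpa using hj
  have := cost_map_range_le (M := j) (B := 1)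
    (f := fun l => .cphase (-1) (2 ^ (j + 1 - l)) (x + j) (x + l)) fun _ _ => le_rfl
  rw [← List.singleton_append, cost_append]
  have h1 : cost [.had (x + j)] = 1 := rfl
  omega

theorem cost_map_had (L : List ℕ) : cost (L.map .had) = L.length := by
  rw [cost, List.map_map]
  induction L with
  | nil => rfl
  | cons i L ih =>
    rw [List.map_cons, List.sum_cons, ih, List.length_cons]
    simp [Gate.cost, add_comm]

namespace Inst

variable {I : Inst} {m s Q : ℕ}

theorem cost_mulGates_le (hk : I.deg ≤ Q) (hw : I.width m ≤ 4 * Q) (hQ : 1 ≤ Q) :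
    cost (I.mulGates m s) ≤ I.size ^ 2 * (145 * Q ^ 4) := by
  rw [sq]
  refine cost_map_range_le fun e _ => ?_
  simp only [Gate.cost, length_block, polyBlock, List.length_map, List.length_range]
  have h1 : I.deg * I.width m ≤ Q * (4 * Q) := Nat.mul_le_mul hk hw
  -- Three blocks of at most 4Q² qubits each: 145 = 1 + 12².
  calc 1 + (I.deg * I.width m + I.deg * I.width m + I.deg * I.width m) ^ 2
      ≤ 1 ^ 4 + (Q * (4 * Q) + Q * (4 * Q) + Q * (4 * Q)) ^ 2 := by rw [one_pow]; gcongr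
    _ ≤ Q ^ 4 + (Q * (4 * Q) + Q * (4 * Q) + Q * (4 * Q)) ^ 2 := by gcongr
    _ = 145 * Q ^ 4 := by ring

theorem regs_le (hk : I.deg ≤ Q) : I.regs ≤ I.size ^ 2 * Q := by
  rw [regs, sq]; gcongr

theorem cost_modGates_le (hk : I.deg ≤ Q) (hw : I.width m ≤ 4 * Q) (hb : I.digitBits ≤ Q)
    (hQ : 1 ≤ Q) : cost (I.modGates m s) ≤ I.size ^ 2 * (50 * Q ^ 4) := by
  have h1 : cost (I.modGates m s) ≤ I.regs * (50 * Q ^ 2) := by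
    refine cost_map_range_le fun r _ => ?_
    simp only [Gate.cost, length_block, constBlock, List.length_map, List.length_range]
    -- This explains 50 = 1 + 7²; the factor `Q` in the number of registers is absorbed by the step
    -- from Q³ to Q⁴.
    have : I.width m + (I.digitBits + 1) + I.digitBits ≤ 7 * Q := by omega
    calc 1 + (I.width m + (I.digitBits + 1) + I.digitBits) ^ 2 ≤ 1 ^ 2 + (7 * Q) ^ 2 := by
          rw [one_pow]; gcongr
      _ ≤ Q ^ 2 + (7 * Q) ^ 2 := by gcongr
      _ = 50 * Q ^ 2 := by ring
  calc _ ≤ I.size ^ 2 * Q * (50 * Q ^ 2) := h1.trans (Nat.mul_le_mul_right _ (regs_le hk))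
    _ = I.size ^ 2 * (50 * Q ^ 3) := by ring
    _ ≤ _ := by gcongr; omega

theorem cost_before_le (hn : 1 ≤ I.size) (hk : I.deg ≤ Q) (hw : I.width m ≤ 4 * Q)
    (hb : I.digitBits ≤ Q) (hm : m ≤ Q) (hQ : 1 ≤ Q) :
    cost (I.before m s) ≤ I.size ^ 2 * (197 * Q ^ 4) := by
  have h1 := cost_mulGates_le (s := s) hk hw hQ
  have h2 := cost_modGates_le (s := s) hk hw hb hQ
  have h3 : I.regs * m ≤ I.size ^ 2 * Q ^ 4 := by
    calc I.regs * m ≤ I.size ^ 2 * Q * Q := Nat.mul_le_mul (regs_le hk) hm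
      _ = I.size ^ 2 * Q ^ 2 := by ring
      _ ≤ _ := by gcongr; omega
  have h4 : 1 ≤ I.size ^ 2 * Q ^ 4 := Nat.one_le_iff_ne_zero.2 (by positivity)
  rw [before, cost_append, cost_append, prep, cost_append, cost_map_had, length_xQubits]
  have h5 : cost [.flip (I.anc s + 1)] = 1 := rfl
  rw [h5]
  calc _ ≤ I.size ^ 2 * Q ^ 4 + I.size ^ 2 * Q ^ 4 +
        (I.size ^ 2 * (145 * Q ^ 4) + I.size ^ 2 * (50 * Q ^ 4)) := by gcongr
    _ = _ := by ring

theorem cost_after_le (hk : I.deg ≤ Q) (hw : I.width m ≤ 4 * Q) (hb : I.digitBits ≤ Q)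
    (hm : m ≤ Q) (hQ : 1 ≤ Q) : cost (I.after m s) ≤ I.size ^ 2 * (223 * Q ^ 4) := by
  have h1 := cost_mulGates_le (s := s) hk hw hQ
  have h2 := cost_modGates_le (s := s) hk hw hb hQ
  have h3 : cost (I.fourier m s) ≤ I.size ^ 2 * (2 * Q ^ 4) := by
    refine (cost_flatMap_le (B := Q + Q * Q) fun r _ => ?_).trans ?_
    · rw [cost_append]
      exact add_le_add ((cost_phases_le _ _ _).trans hm)
        ((cost_qft_le _ _).trans (Nat.mul_le_mul hm hm))
    · rw [List.length_range]
      calc I.regs * (Q + Q * Q) ≤ I.size ^ 2 * Q * (Q * Q + Q * Q) := by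
            refine Nat.mul_le_mul (regs_le hk) ?_
            gcongr
            exact Nat.le_mul_of_pos_left _ hQ
        _ = I.size ^ 2 * (2 * Q ^ 3) := by ring
        _ ≤ _ := by gcongr; omega
  have h4 : cost (I.outGates m s) ≤ I.size ^ 2 * (26 * Q ^ 4) := by
    have h5 : cost (I.outGates m s) ≤ I.regs * (26 * Q ^ 2) := by
      refine cost_map_range_le fun r _ => ?_
      simp only [Gate.cost, length_block, constBlock, List.length_map, List.length_range,
        List.length_reverse, List.length_append]
      have : m + (I.digitBits + 1) + (m + I.digitBits) ≤ 5 * Q := by omega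
      calc 1 + (m + (I.digitBits + 1) + (m + I.digitBits)) ^ 2 ≤ 1 ^ 2 + (5 * Q) ^ 2 := by
            rw [one_pow]; gcongr
        _ ≤ Q ^ 2 + (5 * Q) ^ 2 := by gcongr
        _ = 26 * Q ^ 2 := by ring
    calc _ ≤ I.size ^ 2 * Q * (26 * Q ^ 2) := h5.trans (Nat.mul_le_mul_right _ (regs_le hk))
      _ = I.size ^ 2 * (26 * Q ^ 3) := by ring
      _ ≤ _ := by gcongr; omega
  rw [after, cost_append, cost_append, cost_inverse, prep, cost_append]
  calc _ ≤ I.size ^ 2 * (145 * Q ^ 4) + I.size ^ 2 * (50 * Q ^ 4) + I.size ^ 2 * (2 * Q ^ 4) +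
        I.size ^ 2 * (26 * Q ^ 4) := by gcongr
    _ = _ := by ring

/-- The number of qubits of a Fourier register. -/
def precision (c d : ℕ) (I : Inst) : ℕ := Nat.clog 2 I.size * (2 + 3 * c + d)

theorem pow_le_two_pow_precision (c d : ℕ) (I : Inst) :
    I.size ^ (2 + 3 * c + d) ≤ 2 ^ precision c d I := by
  rw [precision, pow_mul]
  exact Nat.pow_le_pow_left (Nat.le_pow_clog (by norm_num) _) _

namespace Admissible

variable {c : ℕ}

theorem deg_le (h : I.Admissible c) : I.deg ≤ I.size ^ c :=
  (Nat.lt_two_pow_self.le.trans (Nat.pow_le_pow_left h.prime.two_le _)).trans h.bound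

theorem char_le_pow (h : I.Admissible c) : I.char ≤ I.size ^ c :=
  (Nat.le_self_pow h.deg_pos.ne' _).trans h.bound

theorem char_sq_le (h : I.Admissible c) (d : ℕ) : I.char ^ 2 ≤ 2 ^ precision c d I := by
  refine le_trans ?_ (pow_le_two_pow_precision c d I)
  calc I.char ^ 2 ≤ (I.size ^ c) ^ 2 := Nat.pow_le_pow_left h.char_le_pow 2
    _ = I.size ^ (2 * c) := by rw [← pow_mul, mul_comm]
    _ ≤ _ := Nat.pow_le_pow_right (by have := h.two_le_size; omega) (by omega)

/-- The exponent 2 + 3c + d in `precision` is made for this: n² for the entries, n^c for the degree,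
n^(2c) for p², and n^d for the desired error. -/
theorem failure_le (h : I.Admissible c) (d : ℕ) :
    (I.regs : ℝ) * ((I.char : ℝ) ^ 2 / 2 ^ precision c d I) ≤ 1 / (I.size : ℝ) ^ d := by
  have hn : (0 : ℝ) < I.size := by exact_mod_cast (by have := h.two_le_size; omega : 0 < I.size)
  rw [← mul_div_assoc, div_le_div_iff₀ (by positivity) (by positivity), one_mul]
  have : I.regs * I.char ^ 2 * I.size ^ d ≤ 2 ^ precision c d I := by
    refine le_trans ?_ (pow_le_two_pow_precision c d I)
    calc I.regs * I.char ^ 2 * I.size ^ d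
        ≤ (I.size * I.size * I.size ^ c) * (I.size ^ c) ^ 2 * I.size ^ d := by
          rw [regs]
          gcongr
          · exact h.deg_le
          · exact h.char_le_pow
      _ = I.size ^ (2 + 3 * c + d) := by ring
  exact_mod_cast this

theorem cost_le (h : I.Admissible c) (d s : ℕ) :
    cost (I.before (precision c d I) s) + cost I.phaseCircuit +
      cost (I.after (precision c d I) s) ≤
      421 * (2 * (2 + 3 * c + d)) ^ 4 * I.size ^ 2 * Nat.log 2 I.size ^ 4 := by
  have hn := h.two_le_size
  set L := Nat.clog 2 I.size with hL
  -- This is `precision c d I` itself; it also dominates the degree and the number of bits of p, so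
  -- one quantity bounds all block sizes.
  set Q := L * (2 + 3 * c + d) with hQ
  have hL1 : 1 ≤ L := Nat.clog_pos (by norm_num) hn
  have hlog : 1 ≤ Nat.log 2 I.size := Nat.log_pos (by norm_num) hn
  have hL2 : L ≤ 2 * Nat.log 2 I.size := by
    have : L ≤ Nat.log 2 I.size + 1 :=
      Nat.clog_le_of_le_pow (Nat.lt_pow_succ_log_self (by norm_num) _).le
    omega
  have hpow : I.size ^ c ≤ 2 ^ (L * c) := by
    rw [pow_mul]
    exact Nat.pow_le_pow_left (Nat.le_pow_clog (by norm_num) _) _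
  have hLQ : L * c ≤ Q := Nat.mul_le_mul_left _ (by omega)
  have hQ2 : 2 ≤ Q := le_trans (by omega : 2 ≤ 1 * (2 + 3 * c + d)) (Nat.mul_le_mul_right _ hL1)
  -- The degree is logarithmic in n: 2^k ≤ q ≤ n^c ≤ 2^(Lc).
  have hk : I.deg ≤ Q := by
    refine le_trans ?_ hLQ
    refine (Nat.pow_le_pow_iff_right (a := 2) (by norm_num)).1 ?_
    exact ((Nat.pow_le_pow_left h.prime.two_le _).trans h.bound).trans hpow
  have hb : I.digitBits ≤ Q :=
    (Nat.clog_le_of_le_pow (h.char_le_pow.trans hpow)).trans hLQ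
  have hw : I.width Q ≤ 4 * Q := by rw [width]; omega
  have h1 := cost_before_le (s := s) (by omega) hk hw hb le_rfl (by omega)
  have h2 := cost_after_le (s := s) hk hw hb le_rfl (by omega)
  have h3 : cost I.phaseCircuit ≤ I.size ^ 2 * (1 * Q ^ 4) := by
    refine (cost_phases_le _ _ _).trans (hb.trans ?_)
    rw [one_mul]
    exact (Nat.le_self_pow (by norm_num) _).trans (Nat.le_mul_of_pos_left _ (by positivity))
  calc _ ≤ I.size ^ 2 * (197 * Q ^ 4) + I.size ^ 2 * (1 * Q ^ 4) + I.size ^ 2 * (223 * Q ^ 4) :=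
        add_le_add (add_le_add h1 h3) h2
    _ = 421 * I.size ^ 2 * Q ^ 4 := by ring
    _ ≤ 421 * I.size ^ 2 * (2 * Nat.log 2 I.size * (2 + 3 * c + d)) ^ 4 := by
        gcongr
        exact Nat.mul_le_mul_right _ hL2
    _ = _ := by ring

end Admissible

end Inst

/-! ### Primitive recursive functions -/

namespace Prim

variable {α β γ : Type} [Primcodable α] [Primcodable β] [Primcodable γ]

theorem add {f g : α → ℕ} (hf : Primrec f) (hg : Primrec g) : Primrec fun a => f a + g a :=
  Primrec.nat_add.comp hf hg

theorem sub {f g : α → ℕ} (hf : Primrec f) (hg : Primrec g) : Primrec fun a => f a - g a :=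
  Primrec.nat_sub.comp hf hg

theorem mul {f g : α → ℕ} (hf : Primrec f) (hg : Primrec g) : Primrec fun a => f a * g a :=
  Primrec.nat_mul.comp hf hg

theorem div {f g : α → ℕ} (hf : Primrec f) (hg : Primrec g) : Primrec fun a => f a / g a :=
  Primrec.nat_div.comp hf hg

theorem mod {f g : α → ℕ} (hf : Primrec f) (hg : Primrec g) : Primrec fun a => f a % g a :=
  Primrec.nat_mod.comp hf hg

theorem pow {f g : α → ℕ} (hf : Primrec f) (hg : Primrec g) : Primrec fun a => f a ^ g a :=
  Primrec₂.comp (Primrec₂.unpaired'.1 Nat.Primrec.pow) hf hg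

theorem fst {f : α → β × γ} (hf : Primrec f) : Primrec fun a => (f a).1 := Primrec.fst.comp hf

theorem snd {f : α → β × γ} (hf : Primrec f) : Primrec fun a => (f a).2 := Primrec.snd.comp hf

theorem length {f : α → List β} (hf : Primrec f) : Primrec fun a => (f a).length :=
  Primrec.list_length.comp hf

theorem cons {f : α → β} {g : α → List β} (hf : Primrec f) (hg : Primrec g) :
    Primrec fun a => f a :: g a := Primrec.list_cons.comp hf hg

theorem append {f g : α → List β} (hf : Primrec f) (hg : Primrec g) :
    Primrec fun a => f a ++ g a := Primrec.list_append.comp hf hg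

theorem reverse {f : α → List β} (hf : Primrec f) : Primrec fun a => (f a).reverse :=
  Primrec.list_reverse.comp hf

theorem getD {f : α → List β} {g : α → ℕ} (d : β) (hf : Primrec f) (hg : Primrec g) :
    Primrec fun a => (f a).getD (g a) d := (Primrec.list_getD d).comp hf hg

theorem range {f : α → ℕ} (hf : Primrec f) : Primrec fun a => List.range (f a) :=
  Primrec.list_range.comp hf

theorem map {f : α → List β} {g : α → β → γ} (hf : Primrec f)
    (hg : Primrec fun q : α × β => g q.1 q.2) : Primrec fun a => (f a).map (g a) :=
  Primrec.list_map hf hg.to₂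

theorem flatMap {f : α → List β} {g : α → β → List γ} (hf : Primrec f)
    (hg : Primrec fun q : α × β => g q.1 q.2) : Primrec fun a => (f a).flatMap (g a) :=
  Primrec.list_flatMap hf hg.to₂

theorem ite_eq [DecidableEq β] {f g : α → β} {u v : α → γ} (hf : Primrec f) (hg : Primrec g)
    (hu : Primrec u) (hv : Primrec v) : Primrec fun a => if f a = g a then u a else v a :=
  Primrec.ite (Primrec.eq.comp hf hg) hu hv

theorem sum {f : α → List ℕ} (hf : Primrec f) : Primrec fun a => (f a).sum :=
  Primrec.list_foldr hf (Primrec.const 0)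
    (Primrec.nat_add.comp (Primrec.fst.comp Primrec.snd) (Primrec.snd.comp Primrec.snd)).to₂

/-- For positive `t`, the condition 2^(t-1) < a says that `t` is at most the rounded-up logarithm of
`a`, so a search bounded by `a` finds it. If no positive `t` qualifies, the search returns 0, as it
should. -/
theorem clog {f : α → ℕ} (hf : Primrec f) : Primrec fun a => Nat.clog 2 (f a) := by
  have h : PrimrecRel fun (a : α) t => 2 ^ (t - 1) < f a :=
    Primrec.nat_lt.comp (pow (Primrec.const 2) (sub Primrec.snd (Primrec.const 1)))
      (hf.comp Primrec.fst)
  refine (Primrec.nat_findGreatest hf h).of_eq fun a => ?_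
  rw [Nat.findGreatest_eq_iff]
  refine ⟨Nat.clog_le_of_le_pow Nat.lt_two_pow_self.le, fun h0 => ?_, fun t ht _ hlt => ?_⟩
  · by_contra! h1
    have := Nat.clog_le_of_le_pow h1
    omega
  · have h1 : f a ≤ 2 ^ (t - 1) := (Nat.le_pow_clog (by norm_num) _).trans
      (Nat.pow_le_pow_right (by norm_num) (by omega))
    omega

end Prim

/-! ### Uniformity of the circuits -/

/-- A primitive recursive family of circuits. -/
def PrimCircuit {α : Type} [Primcodable α] (fam : α → Circuit) : Prop :=
  Primrec fun a => (fam a).map Gate.code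

namespace PrimCircuit

variable {α : Type} [Primcodable α] {F G : α → Circuit}

theorem append (hF : PrimCircuit F) (hG : PrimCircuit G) : PrimCircuit fun a => F a ++ G a :=
  (Prim.append hF hG).of_eq fun a => by rw [List.map_append]

theorem singleton {g : α → Gate} (hg : Primrec fun a => (g a).code) :
    PrimCircuit fun a => [g a] :=
  (Prim.cons hg (Primrec.const [])).of_eq fun _ => rfl

theorem cons {g : α → Gate} (hg : Primrec fun a => (g a).code) (hF : PrimCircuit F) :
    PrimCircuit fun a => g a :: F a :=
  (Prim.cons hg hF).of_eq fun _ => rfl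

theorem map {f : α → List ℕ} {g : α → ℕ → Gate} (hf : Primrec f)
    (hg : Primrec fun q : α × ℕ => (g q.1 q.2).code) : PrimCircuit fun a => (f a).map (g a) :=
  (Prim.map (g := fun a r => (g a r).code) hf hg).of_eq fun a => by rw [List.map_map]; rfl

theorem flatMap {f : α → List ℕ} {g : α → ℕ → Circuit} (hf : Primrec f)
    (hg : PrimCircuit fun q : α × ℕ => g q.1 q.2) : PrimCircuit fun a => (f a).flatMap (g a) :=
  (Prim.flatMap (g := fun a r => (g a r).map Gate.code) hf hg).of_eq fun a => by
    rw [List.map_flatMap]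

end PrimCircuit

/-- The written form of the inverse of a gate. -/
def invCode (l : List (List ℕ)) : List (List ℕ) :=
  if l.getD 0 [] = [1] then
    [[1], [(l.getD 1 []).getD 1 0, (l.getD 1 []).getD 0 0, (l.getD 1 []).getD 2 0,
      (l.getD 1 []).getD 3 0, (l.getD 1 []).getD 4 0]]
  else l

/-- Only gates with tag 1, the controlled phases, change. Their numerator is written as positive and
negative part, so negation swaps two entries. -/
theorem code_inv (g : Gate) : g.inv.code = invCode g.code := by
  cases g <;> simp [Gate.inv, Gate.code, invCode]

theorem primrec_invCode : Primrec invCode := by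
  have h1 : Primrec fun l : List (List ℕ) => l.getD 1 [] := Prim.getD [] Primrec.id (Primrec.const 1)
  have h2 : ∀ i, Primrec fun l : List (List ℕ) => (l.getD 1 []).getD i 0 :=
    fun i => Prim.getD 0 h1 (Primrec.const i)
  refine Prim.ite_eq (Prim.getD [] Primrec.id (Primrec.const 0)) (Primrec.const [1]) ?_ Primrec.id
  exact Prim.cons (Primrec.const [1]) (Prim.cons (Prim.cons (h2 1) (Prim.cons (h2 0)
    (Prim.cons (h2 2) (Prim.cons (h2 3) (Prim.cons (h2 4) (Primrec.const [])))))) (Primrec.const []))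

/-- The written form of the inverse of a circuit. -/
def invCircuitCode (l : List (List (List ℕ))) : List (List (List ℕ)) := (l.map invCode).reverse

theorem code_inverse (Γ : Circuit) :
    (inverse Γ).map Gate.code = invCircuitCode (Γ.map Gate.code) := by
  simp only [inverse, invCircuitCode, List.map_reverse, List.map_map]
  congr 2
  funext g
  exact code_inv g

theorem primrec_invCircuitCode : Primrec invCircuitCode :=
  Prim.reverse (Prim.map Primrec.id (primrec_invCode.comp Primrec.snd))

theorem PrimCircuit.inverse {α : Type} [Primcodable α] {F : α → Circuit} (hF : PrimCircuit F) :
    PrimCircuit fun a => inverse (F a) :=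
  (primrec_invCircuitCode.comp hF).of_eq fun _ => (code_inverse _).symm

theorem primrec_circuitBound : Primrec circuitBound := by
  have h : Primrec codeBound :=
    Prim.sum (Prim.map Primrec.id (Prim.add (Prim.sum Primrec.snd)
      (Prim.pow (Primrec.const 2) (Prim.length Primrec.snd))))
  exact Prim.sum (Prim.map Primrec.id (h.comp Primrec.snd))

section

variable {α : Type} [Primcodable α]

theorem primrec_block {x m : α → ℕ} (hx : Primrec x) (hm : Primrec m) :
    Primrec fun a => block (x a) (m a) :=
  Prim.map (Prim.range hm) (Prim.add (hx.comp Primrec.fst) Primrec.snd)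

theorem primCircuit_phases {x m b : α → ℕ} (hx : Primrec x) (hm : Primrec m) (hb : Primrec b) :
    PrimCircuit fun a => phases (x a) (m a) (b a) := by
  refine PrimCircuit.map (Prim.range hm) ?_
  have h1 : Primrec fun q : α × ℕ => x q.1 + q.2 := Prim.add (hx.comp Primrec.fst) Primrec.snd
  refine (Prim.cons (Primrec.const [1]) (Prim.cons (Prim.cons
    (Prim.pow (Primrec.const 2) Primrec.snd) (Prim.cons (Primrec.const 0)
    (Prim.cons (hb.comp Primrec.fst) (Prim.cons h1 (Prim.cons h1 (Primrec.const []))))))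
    (Primrec.const []))).of_eq fun q => ?_
  rw [Gate.code, Int.toNat_natCast, Int.toNat_neg_natCast]

theorem primCircuit_qft {x m : α → ℕ} (hx : Primrec x) (hm : Primrec m) :
    PrimCircuit fun a => qft (x a) (m a) := by
  refine PrimCircuit.flatMap (Prim.reverse (Prim.range hm)) ?_
  have h1 : Primrec fun q : α × ℕ => x q.1 + q.2 := Prim.add (hx.comp Primrec.fst) Primrec.snd
  refine PrimCircuit.cons
    (Prim.cons (Primrec.const [0]) (Prim.cons (Prim.cons h1 (Primrec.const [])) (Primrec.const [])))
    (PrimCircuit.map (Prim.range Primrec.snd) ?_)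
  have h2 : Primrec fun q : (α × ℕ) × ℕ => x q.1.1 + q.2 :=
    Prim.add (hx.comp (Primrec.fst.comp Primrec.fst)) Primrec.snd
  exact Prim.cons (Primrec.const [1]) (Prim.cons (Prim.cons (Primrec.const 0)
    (Prim.cons (Primrec.const 1) (Prim.cons (Prim.pow (Primrec.const 2)
      (Prim.sub (Prim.add (Prim.snd Primrec.fst) (Primrec.const 1)) Primrec.snd))
      (Prim.cons (h1.comp Primrec.fst) (Prim.cons h2 (Primrec.const []))))))
    (Primrec.const []))

theorem primrec_arith {x y z : α → List ℕ} (op : ArithOp) (hx : Primrec x) (hy : Primrec y)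
    (hz : Primrec z) : Primrec fun a => (Gate.arith op (x a) (y a) (z a)).code :=
  Prim.cons (Primrec.const [6]) (Prim.cons (Primrec.const [op.code])
    (Prim.cons hx (Prim.cons hy (Prim.cons hz (Primrec.const [])))))

namespace Inst

variable {I : α → Inst} {m s r : α → ℕ}

theorem primrec_size (hI : Primrec I) : Primrec fun a => (I a).size := Prim.fst hI

theorem primrec_char (hI : Primrec I) : Primrec fun a => (I a).char := Prim.fst (Prim.snd hI)

theorem primrec_deg (hI : Primrec I) : Primrec fun a => (I a).deg :=
  Prim.length (Prim.snd (Prim.snd hI))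

theorem primrec_digitBits (hI : Primrec I) : Primrec fun a => (I a).digitBits :=
  Prim.clog (primrec_char hI)

theorem primrec_matBits (hI : Primrec I) : Primrec fun a => (I a).matBits :=
  Prim.mul (Prim.mul (primrec_size hI) (primrec_size hI))
    (Prim.mul (primrec_deg hI) (primrec_digitBits hI))

theorem primrec_fcoef (hI : Primrec I) (hr : Primrec r) : Primrec fun a => (I a).fcoef (r a) :=
  Prim.getD 0 (Prim.append (Prim.snd (Prim.snd hI)) (Primrec.const [1])) hr

theorem primrec_width (hI : Primrec I) (hm : Primrec m) : Primrec fun a => (I a).width (m a) :=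
  Prim.add (Prim.add (Prim.add hm (primrec_digitBits hI)) (primrec_deg hI)) (Primrec.const 1)

theorem primrec_regs (hI : Primrec I) : Primrec fun a => (I a).regs :=
  Prim.mul (Prim.mul (primrec_size hI) (primrec_size hI)) (primrec_deg hI)

theorem primrec_anc (hI : Primrec I) (hs : Primrec s) : Primrec fun a => (I a).anc (s a) :=
  Prim.add hs (Prim.mul (Primrec.const 3) (primrec_matBits hI))

theorem primrec_xReg (hI : Primrec I) (hm : Primrec m) (hs : Primrec s) (hr : Primrec r) :
    Primrec fun a => (I a).xReg (m a) (s a) (r a) :=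
  Prim.add (Prim.add (primrec_anc hI hs) (Primrec.const 2)) (Prim.mul hr (primrec_width hI hm))

theorem primrec_zReg (hI : Primrec I) (hm : Primrec m) (hs : Primrec s) (hr : Primrec r) :
    Primrec fun a => (I a).zReg (m a) (s a) (r a) :=
  Prim.add (Prim.add (Prim.add (primrec_anc hI hs) (Primrec.const 2))
    (Prim.mul (primrec_regs hI) (primrec_width hI hm))) (Prim.mul hr (primrec_width hI hm))

theorem primrec_cReg (hI : Primrec I) (hr : Primrec r) : Primrec fun a => (I a).cReg (r a) :=
  Prim.add (Prim.mul (Primrec.const 2) (primrec_matBits hI)) (Prim.mul hr (primrec_digitBits hI))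

theorem primrec_transposeIdx (hI : Primrec I) (hr : Primrec r) :
    Primrec fun a => (I a).transposeIdx (r a) := by
  have h1 := Prim.div hr (primrec_deg hI)
  exact Prim.add (Prim.mul (Prim.add (Prim.mul (Prim.mod h1 (primrec_size hI)) (primrec_size hI))
    (Prim.div h1 (primrec_size hI))) (primrec_deg hI)) (Prim.mod hr (primrec_deg hI))

/-- Writing a bit of a number with the ancillas. -/
theorem primrec_bitAddr {v t : α → ℕ} (hI : Primrec I) (hs : Primrec s) (hv : Primrec v)
    (ht : Primrec t) : Primrec fun a =>
      if v a / 2 ^ t a % 2 = 1 then (I a).anc (s a) + 1 else (I a).anc (s a) :=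
  Prim.ite_eq (Prim.mod (Prim.div hv (Prim.pow (Primrec.const 2) ht)) (Primrec.const 2))
    (Primrec.const 1) (Prim.add (primrec_anc hI hs) (Primrec.const 1)) (primrec_anc hI hs)

theorem primrec_charBlock (hI : Primrec I) (hs : Primrec s) :
    Primrec fun a => (I a).constBlock (s a) (I a).char ((I a).digitBits + 1) :=
  Prim.map (Prim.range (Prim.add (primrec_digitBits hI) (Primrec.const 1)))
    (primrec_bitAddr (hI.comp Primrec.fst) (hs.comp Primrec.fst)
      ((primrec_char hI).comp Primrec.fst) Primrec.snd)

theorem primrec_polyBlock (hI : Primrec I) (hm : Primrec m) (hs : Primrec s) :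
    Primrec fun a => (I a).polyBlock (m a) (s a) := by
  have hI' : Primrec fun q : α × ℕ => I q.1 := hI.comp Primrec.fst
  have hw : Primrec fun q : α × ℕ => (I q.1).width (m q.1) :=
    primrec_width hI' (hm.comp Primrec.fst)
  exact Prim.map (Prim.range (Prim.mul (primrec_deg hI) (primrec_width hI hm)))
    (primrec_bitAddr hI' (hs.comp Primrec.fst)
      (primrec_fcoef hI' (Prim.sub (primrec_deg hI') (Prim.div Primrec.snd hw)))
      (Prim.mod Primrec.snd hw))

theorem primCircuit_prep (hI : Primrec I) (hm : Primrec m) (hs : Primrec s) :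
    PrimCircuit fun a => (I a).prep (m a) (s a) := by
  have hI' : Primrec fun q : α × ℕ => I q.1 := hI.comp Primrec.fst
  have hm' : Primrec fun q : α × ℕ => m q.1 := hm.comp Primrec.fst
  have hs' : Primrec fun q : α × ℕ => s q.1 := hs.comp Primrec.fst
  have hr : Primrec fun q : α × ℕ => q.2 := Primrec.snd
  have hk := primrec_deg hI'
  have hw := primrec_width hI' hm'
  refine PrimCircuit.append ?_ ?_
  · refine PrimCircuit.map (Prim.range (Prim.mul (primrec_size hI) (primrec_size hI))) ?_
    exact primrec_arith .mul
      (primrec_block (primrec_xReg hI' hm' hs' (Prim.mul hr hk)) (Prim.mul hk hw))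
      (primrec_polyBlock hI' hm' hs')
      (primrec_block (primrec_zReg hI' hm' hs' (Prim.mul hr hk)) (Prim.mul hk hw))
  · refine PrimCircuit.map (Prim.range (primrec_regs hI)) ?_
    exact primrec_arith .mod
      (primrec_block (primrec_zReg hI' hm' hs' (Prim.add (Prim.mul (Prim.div hr hk) hk)
        (Prim.sub (Prim.sub hk (Primrec.const 1)) (Prim.mod hr hk)))) hw)
      (primrec_charBlock hI' hs')
      (primrec_block (primrec_cReg hI' hr) (primrec_digitBits hI'))

theorem primCircuit_before (hI : Primrec I) (hm : Primrec m) (hs : Primrec s) :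
    PrimCircuit fun a => (I a).before (m a) (s a) := by
  have hI' : Primrec fun q : α × ℕ => I q.1 := hI.comp Primrec.fst
  have hm' : Primrec fun q : α × ℕ => m q.1 := hm.comp Primrec.fst
  have hs' : Primrec fun q : α × ℕ => s q.1 := hs.comp Primrec.fst
  refine PrimCircuit.append (PrimCircuit.append (PrimCircuit.singleton ?_)
    (PrimCircuit.map ?_ ?_)) (primCircuit_prep hI hm hs)
  · exact Prim.cons (Primrec.const [2]) (Prim.cons (Prim.cons
      (Prim.add (primrec_anc hI hs) (Primrec.const 1)) (Primrec.const [])) (Primrec.const []))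
  · exact Prim.flatMap (Prim.range (primrec_regs hI))
      (primrec_block (primrec_xReg hI' hm' hs' Primrec.snd) hm')
  · exact Prim.cons (Primrec.const [0]) (Prim.cons (Prim.cons Primrec.snd (Primrec.const []))
      (Primrec.const []))

theorem primCircuit_after (hI : Primrec I) (hm : Primrec m) (hs : Primrec s) :
    PrimCircuit fun a => (I a).after (m a) (s a) := by
  have hI' : Primrec fun q : α × ℕ => I q.1 := hI.comp Primrec.fst
  have hm' : Primrec fun q : α × ℕ => m q.1 := hm.comp Primrec.fst
  have hs' : Primrec fun q : α × ℕ => s q.1 := hs.comp Primrec.fst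
  have hr : Primrec fun q : α × ℕ => q.2 := Primrec.snd
  have hx := primrec_xReg hI' hm' hs' hr
  refine PrimCircuit.append (PrimCircuit.append (primCircuit_prep hI hm hs).inverse ?_) ?_
  · refine PrimCircuit.flatMap (Prim.range (primrec_regs hI)) (PrimCircuit.append ?_ ?_)
    · exact primCircuit_phases hx hm' (Prim.mul (Primrec.const 2) (primrec_char hI'))
    · exact primCircuit_qft hx hm'
  · refine PrimCircuit.map (Prim.range (primrec_regs hI)) ?_
    exact primrec_arith .mul (Prim.reverse (primrec_block hx hm')) (primrec_charBlock hI' hs')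
      (Prim.append (primrec_block (primrec_zReg hI' hm' hs' hr) hm')
        (primrec_block (primrec_cReg hI' (primrec_transposeIdx hI' hr)) (primrec_digitBits hI')))

theorem primCircuit_phaseCircuit (hI : Primrec I) : PrimCircuit fun a => (I a).phaseCircuit :=
  primCircuit_phases (Prim.add (Prim.mul (Primrec.const 3) (primrec_matBits hI))
    (Prim.mul (Prim.sub (primrec_deg hI) (Primrec.const 1)) (primrec_digitBits hI)))
    (primrec_digitBits hI) (primrec_char hI)

theorem primrec_precision (c d : ℕ) (hI : Primrec I) : Primrec fun a => precision c d (I a) :=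
  Prim.mul (Prim.clog (primrec_size hI)) (Primrec.const _)

end Inst

end

/-! ### Uniform families -/

theorem PrimCircuit.uniform {α : Type} [Primcodable α] {F : α → Circuit} (hF : PrimCircuit F) :
    Uniform F :=
  Primrec.to_comp hF

namespace Uniform

variable {α : Type} [Primcodable α] {F G : α → Circuit}

theorem append (hF : Uniform F) (hG : Uniform G) : Uniform fun a => F a ++ G a :=
  (Computable.list_append.comp hF hG).of_eq fun a => by rw [List.map_append]

theorem inverse (hF : Uniform F) : Uniform fun a => inverse (F a) :=
  (primrec_invCircuitCode.to_comp.comp hF).of_eq fun _ => (code_inverse _).symm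

/-- The printed query circuit determines an address bound computably, and this bound can be passed
on as the parameter `s`. -/
theorem comp_bound {V : α × ℕ → Circuit} (hV : Uniform V) (hF : Uniform F) :
    Uniform fun a => V (a, circuitBound ((F a).map Gate.code)) :=
  Computable.comp (f := fun q => (V q).map Gate.code) hV
    (Computable.pair Computable.id (primrec_circuitBound.to_comp.comp hF))

end Uniform

end

end QuantumMM

/-! ### Assembly of the main theorem -/

open QuantumMM in
theorem mainTheorem3 (c d : ℕ) :
    -- circuits before and after the query, phases for the answer, constants of the time bound
    ∃ (V W : Inst × ℕ → Circuit) (Φ : Inst → Circuit) (K e : ℕ),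
      Uniform V ∧ Uniform W ∧ Uniform Φ ∧
      -- they take time `Õ(n²)`
      (∀ (I : Inst) (s : ℕ), I.Admissible c →
        cost (V (I, s)) + cost (Φ I) + cost (W (I, s)) ≤ K * I.size ^ 2 * Nat.log 2 I.size ^ e) ∧
      -- one query to any phase oracle for `C ↦ ⟨A B, Cᵀ⟩` suffices for `A B`
      (∀ (I : Inst) (s : ℕ) (O : Circuit), I.Admissible c → UsesBelow s O → I.IsPhaseOracle O →
        I.ComputesProduct (1 - 1 / (I.size : ℝ) ^ d) (V (I, s) ++ O ++ W (I, s))) ∧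
      -- a circuit for `tr (A B C)` gives a phase oracle
      (∀ (I : Inst) (U : Circuit), I.Admissible c → I.ComputesTrace U →
        I.IsPhaseOracle (U ++ Φ I ++ inverse U)) ∧
      -- phase oracles in time `T(n)` give an algorithm in time `T(n) + Õ(n²)`
      (∀ (S : Set Inst) (T : ℕ → ℕ) (O : Inst → Circuit), Uniform O →
        (∀ I ∈ S, I.Admissible c → I.IsPhaseOracle (O I) ∧ cost (O I) ≤ T I.size) →
        ∃ s : Inst → ℕ,
          Uniform (fun I => V (I, s I) ++ O I ++ W (I, s I)) ∧
          ∀ I ∈ S, I.Admissible c →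
            I.ComputesProduct (1 - 1 / (I.size : ℝ) ^ d) (V (I, s I) ++ O I ++ W (I, s I)) ∧
            cost (V (I, s I) ++ O I ++ W (I, s I)) ≤
              T I.size + K * I.size ^ 2 * Nat.log 2 I.size ^ e) ∧
      -- an algorithm for `tr (A B C)` in time `T(n)` gives an algorithm in time `2 T(n) + Õ(n²)`
      (∀ (S : Set Inst) (T : ℕ → ℕ) (U : Inst → Circuit), Uniform U →
        (∀ I ∈ S, I.Admissible c → I.ComputesTrace (U I) ∧ cost (U I) ≤ T I.size) →
        ∃ s : Inst → ℕ,
          Uniform (fun I => V (I, s I) ++ (U I ++ Φ I ++ inverse (U I)) ++ W (I, s I)) ∧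
          ∀ I ∈ S, I.Admissible c →
            I.ComputesProduct (1 - 1 / (I.size : ℝ) ^ d)
              (V (I, s I) ++ (U I ++ Φ I ++ inverse (U I)) ++ W (I, s I)) ∧
            cost (V (I, s I) ++ (U I ++ Φ I ++ inverse (U I)) ++ W (I, s I)) ≤
              2 * T I.size + K * I.size ^ 2 * Nat.log 2 I.size ^ e) ∧
      -- with exact Fourier transforms the single query gives `A B` with probability one
      (∀ (F : Type) [Field F] [Fintype F] (χ : AddChar F ℂ), χ ≠ 1 →
        ∀ (n : ℕ) (A B : Matrix (Fin n) (Fin n) F),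
          matQFT χ⁻¹ (fun C => χ (matInner (A * B) C.transpose) * matQFT χ (ket 0) C) =
            ket (A * B).transpose) := by
  have hI : Primrec fun q : Inst × ℕ => q.1 := Primrec.fst
  have hm := Inst.primrec_precision c d hI
  have hV : Uniform fun q : Inst × ℕ => q.1.before (Inst.precision c d q.1) q.2 :=
    (Inst.primCircuit_before hI hm Primrec.snd).uniform
  have hW : Uniform fun q : Inst × ℕ => q.1.after (Inst.precision c d q.1) q.2 :=
    (Inst.primCircuit_after hI hm Primrec.snd).uniform
  have hΦ : Uniform fun I : Inst => I.phaseCircuit :=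
    (Inst.primCircuit_phaseCircuit Primrec.id).uniform
  have query : ∀ (I : Inst) (s : ℕ) (O : Circuit), I.Admissible c → UsesBelow s O →
      I.IsPhaseOracle O → I.ComputesProduct (1 - 1 / (I.size : ℝ) ^ d)
        (I.before (Inst.precision c d I) s ++ O ++ I.after (Inst.precision c d I) s) :=
    fun I s O h hO hphase A B =>
      (sub_le_sub_left (h.failure_le d) 1).trans (h.le_prob (h.char_sq_le d) hO hphase A B)
  refine ⟨fun q => q.1.before (Inst.precision c d q.1) q.2,
    fun q => q.1.after (Inst.precision c d q.1) q.2, fun I => I.phaseCircuit,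
    -- 421 = 197 + 1 + 223 adds the circuits before the query, for the phase of the answer, and
    -- after the query. The fourth power comes from squaring block lengths of order log² n.
    421 * (2 * (2 + 3 * c + d)) ^ 4, 4, hV, hW, hΦ, fun I s h => h.cost_le d s, query,
    fun I U h hU => h.isPhaseOracle_of_computesTrace hU, fun S T O hO hS => ?_,
    fun S T U hU hS => ?_, fun F _ _ χ hχ n A B => matQFT_query hχ n (A * B)⟩
  · refine ⟨fun I => circuitBound ((O I).map Gate.code),
      ((hV.comp_bound hO).append hO).append (hW.comp_bound hO), fun I hI h => ?_⟩
    obtain ⟨hphase, hcost⟩ := hS I hI h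
    refine ⟨query I _ _ h (usesBelow_circuitBound _) hphase, ?_⟩
    have := h.cost_le d (circuitBound ((O I).map Gate.code))
    rw [cost_append, cost_append]
    dsimp only
    omega
  · have hO : Uniform fun I => U I ++ I.phaseCircuit ++ inverse (U I) :=
      (hU.append hΦ).append hU.inverse
    -- The bound is taken for the whole query circuit including the phases. `U` and its inverse have
    -- equal cost, hence 2T, and the cost of the phases is part of the bound in `cost_le`.
    refine ⟨fun I => circuitBound ((U I ++ I.phaseCircuit ++ inverse (U I)).map Gate.code),
      ((hV.comp_bound hO).append hO).append (hW.comp_bound hO), fun I hI h => ?_⟩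
    obtain ⟨htr, hcost⟩ := hS I hI h
    refine ⟨query I _ _ h (usesBelow_circuitBound _) (h.isPhaseOracle_of_computesTrace htr), ?_⟩
    have := h.cost_le d
      (circuitBound ((U I ++ I.phaseCircuit ++ inverse (U I)).map Gate.code))
    simp only [cost_append, cost_inverse]
    omega
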